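/- All graphs are finite and simple. For a graph $G$ and $D\subseteq V(G)$, $N[D]$ is the set of vertices that are in $D$ or adjacent to a vertex in $D$. The $C_4$-isolation number $\iota(G,C_4)$ is the smallest size of a set $D\subseteq V(G)$ such that $G-N[D]$ contains no (not necessarily induced) $4$-cycle. If $\mathcal E$ is a set of graphs, an $\mathcal E$-graph is a graph isomorphic to a member of $\mathcal E$. Let $C_4$ be the $4$-cycle, $C_4'$ the diamond (a $4$-cycle with one chord), $K_4$ the complete graph on $4$ vertices, and let $G_1,\dots,G_6$ be the graphs with vertex set $\{1,\dots,9\}$ and the following edges (where $xy$ stands for $\{x,y\}$). - $G_1$: $12, 23, 34, 45, 56, 67, 78, 89, 19, 29, 24, 18, 13, 79, 68, 57, 46, 35$. - $G_2$: $56, 58, 59, 45, 16, 67, 68, 12, 17, 19, 23, 28, 29, 34, 37, 38, 47, 49$. - $G_3$: $56, 57, 58, 45, 67, 68, 16, 17, 47, 28, 38, 34, 49, 12, 19, 23, 29, 39$. - $G_4$: $12, 13, 14, 15, 23, 26, 27, 36, 37, 45, 48, 49, 58, 59, 67, 69, 78, 89$. - $G_5$: $12, 13, 14, 15, 26, 27,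 36, 37, 45, 48, 49, 58, 59, 67, 69, 78, 89$ (that is, $G_4$ without the edge $23$). - $G_6$: $12, 13, 14, 15, 26, 27, 36, 37, 48, 49, 58, 59, 67, 69, 78, 89$ (that is, $G_4$ without the edges $23$ and $45$). Let $\mathcal E_4=\{C_4,C_4',K_4,G_1,\dots,G_6\}$. For $n\ge 1$, let $B_{n,C_4}$ be the following graph. If $n\le 4$, it is the path on $n$ vertices. If $n\ge 5$, let $a=\lfloor n/5\rfloor$ and $b=n-4a$; the vertices are $1,\dots,b$ together with the vertices of $a$ pairwise disjoint $4$-cycles $F_1,\dots,F_a$ (none of which contains any of $1,\dots,b$), and the edges are $\{i,i+1\}$ for $1\le i<a$, $\{a,j\}$ for $a<j\le b$, the edges of $F_1,\dots,F_a$, and $\{i,v\}$ for $1\le i\le a$ and $v\in V(F_i)$. **Theorem.** 1. If $G$ is a connected $n$-vertex graph that is not an $\mathcal E_4$-graph, then $\iota(G,C_4)\le\lfloor n/5\rfloor$. 2. For every $n\ge1$, $B_{n,C_4}$ is a connected $n$-vertex graph and $\iota(B_{n,C_4},C_4)=\lfloor n/5\rfloor$. 3. $c_4=\tfrac15$. That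 is, $\tfrac15$ is the smallest real number $c$ such that, for some finite set $\mathcal E$ of graphs, $\iota(G,C_4)\le c\,|V(G)|$ for every connected graph $G$ that is not an $\mathcal E$-graph. 4. The exceptional graphs are exactly the $\mathcal E_4$-graphs: every $\mathcal E_4$-graph $G$ is connected and has $\iota(G,C_4)>\lfloor |V(G)|/5\rfloor$. Moreover, the nine members of $\mathcal E_4$ are pairwise non-isomorphic. -/

import Mathlib

universe u

namespace Isolation

/-- The closed neighbourhood `N[D]` of a set `D` of vertices. -/
def closedNeighborhood {V : Type*} (G : SimpleGraph V) (D : Finset V) : Set V :=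
  {w | ∃ v ∈ D, w = v ∨ G.Adj v w}

/-- `D` is an `F`-isolating set of `G`: the graph `G - N[D]` contains no copy of `F`
(as a not necessarily induced subgraph). -/
def IsIsolating {V W : Type*} (F : SimpleGraph W) (G : SimpleGraph V) (D : Finset V) : Prop :=
  F.Free (G.induce (closedNeighborhood G D)ᶜ)

/-- The `F`-isolation number `ι(G, F)`: the size of a smallest `F`-isolating set of `G`. -/
noncomputable def isolationNumber {V W : Type*} (G : SimpleGraph V) (F : SimpleGraph W) : ℕ :=
  sInf {k | ∃ D : Finset V, IsIsolating F G D ∧ D.card = k}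

/-- The whole vertex set is isolating, so `isolationNumber` is a minimum over a nonempty set. -/
theorem isIsolating_univ {V W : Type*} [Fintype V] [Nonempty W]
    (G : SimpleGraph V) (F : SimpleGraph W) : IsIsolating F G Finset.univ := by
  rintro ⟨f⟩
  obtain ⟨w⟩ := (inferInstance : Nonempty W)
  exact (f w).2 ⟨(f w).1, Finset.mem_univ _, Or.inl rfl⟩

/-- The minimum in the definition of `isolationNumber` is attained. -/
theorem exists_isIsolating {V W : Type*} [Fintype V] [Nonempty W]
    (G : SimpleGraph V) (F : SimpleGraph W) :
    ∃ D : Finset V, IsIsolating F G D ∧ D.card = isolationNumber G F :=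
  Nat.sInf_mem (s := {k | ∃ D : Finset V, IsIsolating F G D ∧ D.card = k})
    ⟨_, Finset.univ, isIsolating_univ G F, rfl⟩

/-- Finite graphs on the vertex sets `Fin n`; every finite graph is a copy of one of them. -/
abbrev FinGraph : Type := Σ n : ℕ, SimpleGraph (Fin n)

/-- `G` is an `ℰ`-graph: a copy of a member of `ℰ`. -/
def IsGraphOf {V : Type*} (ℰ : Set FinGraph) (G : SimpleGraph V) : Prop :=
  ∃ H ∈ ℰ, Nonempty (G ≃g H.2)

/-- The graph on `n` vertices, labelled `1, …, n`, whose edges are the listed pairs of labels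
(the label of `i : Fin n` is `i + 1`). -/
def ofEdges (n : ℕ) (l : List (ℕ × ℕ)) : SimpleGraph (Fin n) :=
  SimpleGraph.fromRel fun i j => (i.val + 1, j.val + 1) ∈ l

/-- The diamond graph `C₄'`: a 4-cycle with one chord. -/
def diamond : SimpleGraph (Fin 4) := ofEdges 4 [(1, 2), (2, 3), (3, 4), (4, 1), (1, 3)]

def graph1 : SimpleGraph (Fin 9) := ofEdges 9
  [(1, 2), (2, 3), (3, 4), (4, 5), (5, 6), (6, 7), (7, 8), (8, 9), (9, 1),
   (2, 9), (2, 4), (1, 8), (1, 3), (9, 7), (8, 6), (7, 5), (6, 4), (5, 3)]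

def graph2 : SimpleGraph (Fin 9) := ofEdges 9
  [(5, 6), (5, 8), (5, 9), (5, 4), (6, 1), (6, 7), (6, 8), (1, 2), (1, 7),
   (1, 9), (2, 3), (2, 8), (2, 9), (3, 4), (3, 7), (3, 8), (4, 7), (4, 9)]

def graph3 : SimpleGraph (Fin 9) := ofEdges 9
  [(5, 6), (5, 7), (5, 8), (5, 4), (6, 7), (6, 8), (6, 1), (7, 1), (7, 4),
   (8, 2), (8, 3), (4, 3), (4, 9), (1, 2), (1, 9), (2, 3), (2, 9), (3, 9)]

def graph4 : SimpleGraph (Fin 9) := ofEdges 9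
  [(1, 2), (1, 3), (1, 4), (1, 5), (2, 3), (2, 6), (2, 7), (3, 6), (3, 7),
   (4, 5), (4, 8), (4, 9), (5, 8), (5, 9), (6, 7), (6, 9), (7, 8), (8, 9)]

def graph5 : SimpleGraph (Fin 9) := ofEdges 9
  [(1, 2), (1, 3), (1, 4), (1, 5), (2, 6), (2, 7), (3, 6), (3, 7),
   (4, 5), (4, 8), (4, 9), (5, 8), (5, 9), (6, 7), (6, 9), (7, 8), (8, 9)]

def graph6 : SimpleGraph (Fin 9) := ofEdges 9
  [(1, 2), (1, 3), (1, 4), (1, 5), (2, 6), (2, 7), (3, 6), (3, 7),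
   (4, 8), (4, 9), (5, 8), (5, 9), (6, 7), (6, 9), (7, 8), (8, 9)]

/-- The exceptional set `ℰ₄`. -/
def exceptional : Set FinGraph :=
  {⟨4, SimpleGraph.cycleGraph 4⟩, ⟨4, diamond⟩, ⟨4, SimpleGraph.completeGraph (Fin 4)⟩,
   ⟨9, graph1⟩, ⟨9, graph2⟩, ⟨9, graph3⟩, ⟨9, graph4⟩, ⟨9, graph5⟩, ⟨9, graph6⟩}

/-- The vertex set of `B_{n,F}` for a `k`-vertex graph `F`: with `a = ⌊n/(k+1)⌋`, it consists of
`n - k a` vertices `1, …, n - k a` (the label of `inl i` is `i + 1`), and of the vertices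
of `a` disjoint copies of `F`. For `n ≤ k` it is just `{1, …, n}`. -/
abbrev BVert (n k : ℕ) : Type := Fin (n - k * (n / (k + 1))) ⊕ (Fin (n / (k + 1)) × Fin k)

/-- The adjacencies of `B_{n,F}`, each edge being listed in at least one direction. -/
def BRel (n k : ℕ) (F : SimpleGraph (Fin k)) : BVert n k → BVert n k → Prop
  | .inl i, .inl j =>
      if n ≤ k then i.val + 1 = j.val
      -- the path on the first `a` vertices, whose last vertex is joined to all the later ones
      else (i.val + 1 = j.val ∧ j.val < n / (k + 1)) ∨
        (i.val + 1 = n / (k + 1) ∧ n / (k + 1) ≤ j.val)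
  -- the `p`-th vertex is joined to all vertices of the `p`-th copy of `F`
  | .inl i, .inr (p, _) => i.val = p.val
  | .inr _, .inl _ => False
  | .inr (p, v), .inr (q, w) => p = q ∧ F.Adj v w

/-- The graph `B_{n,F}`. -/
def B (n k : ℕ) (F : SimpleGraph (Fin k)) : SimpleGraph (BVert n k) :=
  SimpleGraph.fromRel (BRel n k F)

/-- `c` is admissible for `k`-cycles: for some finite set `ℰ` of graphs, `ι(G, C_k) ≤ c |V(G)|`
for every connected finite graph `G` that is not an `ℰ`-graph. -/
def IsAdmissible (k : ℕ) (c : ℝ) : Prop :=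
  ∃ ℰ : Set FinGraph, ℰ.Finite ∧
    ∀ (V : Type u) [Fintype V] (G : SimpleGraph V), G.Connected → ¬ IsGraphOf ℰ G →
      (isolationNumber G (SimpleGraph.cycleGraph k) : ℝ) ≤ c * (Fintype.card V : ℝ)

end Isolation

/-! The upper bound comes from a smallest counterexample `G` (`MinCE`). An exceptional graph `K`
misses the bound narrowly: it has an isolating set `D` with `5|D| ≤ |K| + 1`, and as soon as one of
its vertices is dominated from outside, some `D` with `5|D| + 4 ≤ |K|` is enough. Suppose that `D`
kills all 4-cycles meeting a nonempty set `Y`, and that among the exceptional components of `G - Y`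
there are `h` that meet `N[D]` and `u` that do not. Adding up the costs of all components gives `|Y|
+ 4h < 5|D| + u` (`MinCE.card_add_lt`). Everything else exploits this inequality.

First, an exceptional connected part whose outside neighbours are linked outside of it has at least
three of them (`MinCE.three_le_card_outer`). Taking the closed neighbourhood of a vertex as `Y` then
shows that degrees are at most 4, and that a vertex of degree 4 sees exactly one exceptional
component (`MinCE.four_le_degree`). Further, no nine-vertex exceptional graph is a proper induced
subgraph (`MinCE.not_exc9`), so this component has four vertices. Together with the closed
neighbourhood it forms a nine-vertex core, which is attached to the rest of `G` only through the
four neighbours.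

A computer search (`search4`) goes through all such cores. Each of them admits a single vertex whose
neighbourhood can be removed profitably (`MinCE.not_reduces`), or is one of two special families
treated by hand (`MinCE.not_twoPairs`, `MinCE.not_square`), or is itself an exceptional graph, which
is impossible. Hence degrees are at most 3. Then a 4-cycle with one further neighbour of one of its
vertices takes over the role of the closed neighbourhood, and a second search (`search3`) finishes
the proof (`not_minCE`).

For sharpness, each 4-cycle of `B_{n,C₄}` together with its hub needs a vertex of its own, and the
hubs suffice. These graphs have unbounded order, so finitely many exceptions cannot lower the
constant. The exceptional graphs are handled by direct computation, and their orders and numbers of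
triangles tell them apart. -/

namespace Isolation

open Finset
open scoped Classical

/-! ### Four-cycles, domination, and exceptional graphs as vertex sets -/

section Basics

variable {V : Type*}

/-- `a b c d` is a (not necessarily induced) 4-cycle of `G`. -/
def IsC4 (G : SimpleGraph V) (a b c d : V) : Prop :=
  G.Adj a b ∧ G.Adj b c ∧ G.Adj c d ∧ G.Adj d a ∧ a ≠ c ∧ b ≠ d

theorem IsC4.rotate {G : SimpleGraph V} {a b c d : V} (h : IsC4 G a b c d) : IsC4 G b c d a :=
  ⟨h.2.1, h.2.2.1, h.2.2.2.1, h.1, h.2.2.2.2.2, h.2.2.2.2.1.symm⟩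

/-- `w` lies in the closed neighbourhood of `D`. -/
def Dom (G : SimpleGraph V) (D : Finset V) (w : V) : Prop := ∃ v ∈ D, w = v ∨ G.Adj v w

theorem Dom.mono {G : SimpleGraph V} {D E : Finset V} {w : V} (h : Dom G D w) (hDE : D ⊆ E) :
    Dom G E w := by
  obtain ⟨v, hv, h⟩ := h
  exact ⟨v, hDE hv, h⟩

/-- Every 4-cycle of `G` inside `S` meets the closed neighbourhood of `D`. -/
def Isolates (G : SimpleGraph V) (S D : Finset V) : Prop :=
  ∀ a b c d, IsC4 G a b c d → a ∈ S → b ∈ S → c ∈ S → d ∈ S →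
    Dom G D a ∨ Dom G D b ∨ Dom G D c ∨ Dom G D d

theorem cycleGraph_four_isContained_iff {W : Type*} (H : SimpleGraph W) :
    SimpleGraph.IsContained (SimpleGraph.cycleGraph 4) H ↔ ∃ a b c d, IsC4 H a b c d := by
  constructor
  · rintro ⟨f⟩
    have hadj : ∀ i j : Fin 4, (SimpleGraph.cycleGraph 4).Adj i j → H.Adj (f i) (f j) :=
      fun i j h => f.toHom.map_adj h
    refine ⟨f 0, f 1, f 2, f 3, hadj _ _ (by decide), hadj _ _ (by decide), hadj _ _ (by decide),
      hadj _ _ (by decide), fun h => ?_, fun h => ?_⟩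
    · exact absurd (f.injective h) (by decide)
    · exact absurd (f.injective h) (by decide)
  · rintro ⟨a, b, c, d, h1, h2, h3, h4, h5, h6⟩
    refine ⟨⟨⟨![a, b, c, d], ?_⟩, ?_⟩⟩
    · intro i j hij
      fin_cases i <;> fin_cases j <;>
        simp [SimpleGraph.cycleGraph_adj, show ¬((-2 : Fin 4) = 1) by decide] at hij ⊢ <;>
        first | assumption | (apply SimpleGraph.Adj.symm; assumption)
    · intro i j hij
      fin_cases i <;> fin_cases j <;> simp at hij ⊢ <;>
        first
        | exact absurd hij h1.ne | exact absurd hij.symm h1.ne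
        | exact absurd hij h2.ne | exact absurd hij.symm h2.ne
        | exact absurd hij h3.ne | exact absurd hij.symm h3.ne
        | exact absurd hij h4.ne | exact absurd hij.symm h4.ne
        | exact absurd hij h5 | exact absurd hij.symm h5
        | exact absurd hij h6 | exact absurd hij.symm h6

theorem isIsolating_iff [Fintype V] (G : SimpleGraph V) (D : Finset V) :
    IsIsolating (SimpleGraph.cycleGraph 4) G D ↔ Isolates G univ D := by
  unfold IsIsolating SimpleGraph.Free
  rw [cycleGraph_four_isContained_iff]
  constructor
  · intro h a b c d hc _ _ _ _
    by_contra hcon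
    push Not at hcon
    obtain ⟨ha, hb, hc', hd⟩ := hcon
    refine h ⟨⟨a, ha⟩, ⟨b, hb⟩, ⟨c, hc'⟩, ⟨d, hd⟩, hc.1, hc.2.1, hc.2.2.1, hc.2.2.2.1, ?_, ?_⟩
    · intro h; exact hc.2.2.2.2.1 (congrArg Subtype.val h)
    · intro h; exact hc.2.2.2.2.2 (congrArg Subtype.val h)
  · rintro h ⟨a, b, c, d, hc⟩
    have := h a b c d ⟨hc.1, hc.2.1, hc.2.2.1, hc.2.2.2.1, fun h => hc.2.2.2.2.1 (Subtype.ext h),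
      fun h => hc.2.2.2.2.2 (Subtype.ext h)⟩ (mem_univ _) (mem_univ _) (mem_univ _) (mem_univ _)
    rcases this with h | h | h | h
    · exact a.2 h
    · exact b.2 h
    · exact c.2 h
    · exact d.2 h

theorem isolationNumber_le [Fintype V] {G : SimpleGraph V} {D : Finset V}
    (h : Isolates G univ D) : isolationNumber G (SimpleGraph.cycleGraph 4) ≤ D.card :=
  Nat.sInf_le ⟨D, (isIsolating_iff G D).2 h, rfl⟩

theorem exists_isolates [Fintype V] (G : SimpleGraph V) :
    ∃ D : Finset V, Isolates G univ D ∧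
      D.card = isolationNumber G (SimpleGraph.cycleGraph 4) := by
  obtain ⟨D, h, hD⟩ := exists_isIsolating G (SimpleGraph.cycleGraph 4)
  exact ⟨D, (isIsolating_iff G D).1 h, hD⟩

/-- `f` identifies `K`, as an induced subgraph of `G`, with the graph `H`. -/
def IsCopyOn {n : ℕ} (G : SimpleGraph V) (K : Finset V) (H : SimpleGraph (Fin n))
    (f : Fin n → V) : Prop :=
  Function.Injective f ∧ image f univ = K ∧ ∀ i j, G.Adj (f i) (f j) ↔ H.Adj i j

/-- The six exceptional graphs on nine vertices. -/
def nineGraphs : List (SimpleGraph (Fin 9)) := [graph1, graph2, graph3, graph4, graph5, graph6]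

/-- `K` induces a 4-vertex graph with a 4-cycle. -/
def Exc4 (G : SimpleGraph V) (K : Finset V) : Prop :=
  ∃ a b c d, IsC4 G a b c d ∧ K = {a, b, c, d}

/-- `K` induces a copy of one of the six exceptional graphs on nine vertices. -/
def Exc9 (G : SimpleGraph V) (K : Finset V) : Prop :=
  ∃ H ∈ nineGraphs, ∃ f, IsCopyOn G K H f

/-- `K` induces an exceptional graph. -/
def Exc (G : SimpleGraph V) (K : Finset V) : Prop := Exc4 G K ∨ Exc9 G K

theorem IsC4.card_eq {G : SimpleGraph V} {a b c d : V} (h : IsC4 G a b c d) :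
    ({a, b, c, d} : Finset V).card = 4 := by
  obtain ⟨h1, h2, h3, h4, h5, h6⟩ := h
  rw [card_insert_of_notMem, card_insert_of_notMem, card_insert_of_notMem, card_singleton]
  · simpa using h3.ne
  · simpa using ⟨h2.ne, h6⟩
  · simpa using ⟨h1.ne, h5, h4.ne'⟩

theorem Exc4.card_eq {G : SimpleGraph V} {K : Finset V} (h : Exc4 G K) : K.card = 4 := by
  obtain ⟨a, b, c, d, hc, rfl⟩ := h
  exact hc.card_eq

theorem IsCopyOn.card_eq {n : ℕ} {G : SimpleGraph V} {K : Finset V} {H : SimpleGraph (Fin n)}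
    {f : Fin n → V} (h : IsCopyOn G K H f) : K.card = n := by
  rw [← h.2.1, card_image_of_injective _ h.1, card_univ, Fintype.card_fin]

theorem Exc9.card_eq {G : SimpleGraph V} {K : Finset V} (h : Exc9 G K) : K.card = 9 := by
  obtain ⟨H, -, f, hf⟩ := h
  exact hf.card_eq

theorem isCopyOn_of_iso {n : ℕ} {G : SimpleGraph V} {K : Finset V} {H : SimpleGraph (Fin n)}
    (e : G.induce (K : Set V) ≃g H) : IsCopyOn G K H (fun i => (e.symm i : V)) := by
  refine ⟨fun i j h => e.symm.injective (Subtype.ext h), ?_, fun i j => ?_⟩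
  · ext x
    simp only [mem_image, mem_univ, true_and]
    constructor
    · rintro ⟨i, rfl⟩
      exact (e.symm i).2
    · intro hx
      exact ⟨e ⟨x, hx⟩, by simp⟩
  · have := e.symm.map_adj_iff (v := i) (w := j)
    rw [← this]
    rfl

theorem exc_of_isGraphOf {G : SimpleGraph V} {K : Finset V}
    (h : IsGraphOf exceptional (G.induce (K : Set V))) : Exc G K := by
  obtain ⟨H, hH, ⟨e⟩⟩ := h
  have four : ∀ H : SimpleGraph (Fin 4), (G.induce (K : Set V) ≃g H) → IsC4 H 0 1 2 3 →
      Exc G K := by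
    intro H e hH
    have hc := isCopyOn_of_iso e
    refine Or.inl ⟨_, _, _, _, ⟨(hc.2.2 _ _).2 hH.1, (hc.2.2 _ _).2 hH.2.1, (hc.2.2 _ _).2 hH.2.2.1,
      (hc.2.2 _ _).2 hH.2.2.2.1, fun h => hH.2.2.2.2.1 (hc.1 h),
      fun h => hH.2.2.2.2.2 (hc.1 h)⟩, ?_⟩
    refine hc.2.1.symm.trans ?_
    ext x
    simp [Fin.exists_fin_succ, eq_comm]
  simp only [exceptional, Set.mem_insert_iff, Set.mem_singleton_iff] at hH
  rcases hH with rfl | rfl | rfl | rfl | rfl | rfl | rfl | rfl | rfl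
  · exact four _ e ⟨by decide, by decide, by decide, by decide, by decide, by decide⟩
  · refine four _ e ⟨?_, ?_, ?_, ?_, by decide, by decide⟩ <;> simp [diamond, ofEdges]
  · exact four _ e ⟨by simp, by simp, by simp, by simp, by decide, by decide⟩
  all_goals exact Or.inr ⟨_, by simp [nineGraphs], _, isCopyOn_of_iso e⟩

theorem isGraphOf_of_isCopyOn [Fintype V] {n : ℕ} {G : SimpleGraph V} {H : SimpleGraph (Fin n)}
    {f : Fin n → V} (h : IsCopyOn G univ H f) : Nonempty (G ≃g H) := by
  have hb : Function.Bijective f := by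
    refine ⟨h.1, fun x => ?_⟩
    have := h.2.1 ▸ mem_univ x
    simpa using this
  refine ⟨SimpleGraph.Iso.symm ⟨Equiv.ofBijective f hb, ?_⟩⟩
  intro i j
  exact h.2.2 i j

theorem IsC4.injective {G : SimpleGraph V} {a b c d : V} (h : IsC4 G a b c d) :
    Function.Injective ![a, b, c, d] := by
  obtain ⟨h1, h2, h3, h4, h5, h6⟩ := h
  intro i j hij
  fin_cases i <;> fin_cases j <;> simp at hij ⊢ <;>
    first
    | exact absurd hij h1.ne | exact absurd hij.symm h1.ne
    | exact absurd hij h2.ne | exact absurd hij.symm h2.ne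
    | exact absurd hij h3.ne | exact absurd hij.symm h3.ne
    | exact absurd hij h4.ne | exact absurd hij.symm h4.ne
    | exact absurd hij h5 | exact absurd hij.symm h5
    | exact absurd hij h6 | exact absurd hij.symm h6

/-- On four vertices the chords of the cycle decide between the three graphs. A lone chord is
rotated to join the first and third vertices, as in `diamond`. -/
theorem isGraphOf_of_exc [Fintype V] {G : SimpleGraph V} (h : Exc G univ) :
    IsGraphOf exceptional G := by
  rcases h with ⟨a, b, c, d, hc, hK⟩ | ⟨H, hH, f, hf⟩
  · have key : ∀ a b c d, IsC4 G a b c d → univ = ({a, b, c, d} : Finset V) →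
        ∀ H : SimpleGraph (Fin 4), (⟨4, H⟩ : FinGraph) ∈ exceptional →
        (∀ f : Fin 4 → V, f = ![a, b, c, d] → ∀ i j, i < j → (G.Adj (f i) (f j) ↔ H.Adj i j)) →
        IsGraphOf exceptional G := by
      intro a b c d hc hK H hH hadj
      refine ⟨_, hH, isGraphOf_of_isCopyOn (f := ![a, b, c, d]) ⟨hc.injective, ?_, ?_⟩⟩
      · rw [hK]
        ext x
        simp [Fin.exists_fin_succ, eq_comm]
      · intro i j
        rcases lt_trichotomy i j with hij | rfl | hij
        · exact hadj _ rfl i j hij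
        · simp
        · rw [G.adj_comm, H.adj_comm]; exact hadj _ rfl j i hij
    have key' : ∀ a b c d, IsC4 G a b c d → univ = ({a, b, c, d} : Finset V) → G.Adj a c →
        IsGraphOf exceptional G := by
      intro a b c d hc hK hac
      obtain ⟨h1, h2, h3, h4, -, -⟩ := id hc
      have h4' := h4.symm
      by_cases hbd : G.Adj b d
      · refine key _ _ _ _ hc hK (SimpleGraph.completeGraph (Fin 4)) (by simp [exceptional]) ?_
        rintro f rfl i j hij
        fin_cases i <;> fin_cases j <;> simp at hij ⊢ <;> assumption
      · refine key _ _ _ _ hc hK diamond (by simp [exceptional]) ?_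
        rintro f rfl i j hij
        fin_cases i <;> fin_cases j <;> simp [diamond, ofEdges] at hij ⊢ <;> assumption
    by_cases hac : G.Adj a c
    · exact key' _ _ _ _ hc hK hac
    · by_cases hbd : G.Adj b d
      · refine key' _ _ _ _ hc.rotate (hK.trans ?_) hbd
        ext x; simp; tauto
      · refine key _ _ _ _ hc hK (SimpleGraph.cycleGraph 4) (by simp [exceptional]) ?_
        obtain ⟨h1, h2, h3, h4, -, -⟩ := id hc
        have h4' := h4.symm
        rintro f rfl i j hij
        fin_cases i <;> fin_cases j <;>
          simp [SimpleGraph.cycleGraph_adj, show ¬((-2 : Fin 4) = 1) by decide,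
            show ((-3 : Fin 4) = 1) by decide] at hij ⊢ <;> assumption
  · refine ⟨⟨9, H⟩, ?_, isGraphOf_of_isCopyOn hf⟩
    simp only [nineGraphs, List.mem_cons, List.not_mem_nil, or_false] at hH
    rcases hH with rfl | rfl | rfl | rfl | rfl | rfl <;> simp [exceptional]

end Basics

end Isolation

namespace Isolation

open Finset
open scoped Classical

/-! ### Components as vertex sets, and the smallest counterexample -/

section Components

variable {V : Type*}

/-- `K` induces a connected graph: no proper nonempty part of `K` is closed under adjacency. -/
def PConn (G : SimpleGraph V) (K : Finset V) : Prop :=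
  ∀ A ⊆ K, A.Nonempty → (∀ y ∈ A, ∀ z ∈ K, G.Adj y z → z ∈ A) → A = K

/-- `K` is the vertex set of a component of `G[S]`. -/
structure IsComp (G : SimpleGraph V) (S K : Finset V) : Prop where
  sub : K ⊆ S
  ne : K.Nonempty
  conn : PConn G K
  closed : ∀ y ∈ K, ∀ z ∈ S, G.Adj y z → z ∈ K

/-- The vertex sets of the components of `G[S]`. -/
noncomputable def comps (G : SimpleGraph V) (S : Finset V) : Finset (Finset V) :=
  S.powerset.filter (IsComp G S)

variable {G : SimpleGraph V} {S K L : Finset V}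

theorem mem_comps : K ∈ comps G S ↔ IsComp G S K := by
  simp only [comps, mem_filter, mem_powerset, and_iff_right_iff_imp]
  exact fun h => h.sub

/-- The set `K ∩ L` is closed under adjacency within `K`, so the connectedness of `K` makes it all
of `K`. -/
theorem IsComp.subset_of_mem (hK : IsComp G S K) (hL : IsComp G S L) {x : V} (hxK : x ∈ K)
    (hxL : x ∈ L) : K ⊆ L := by
  have := hK.conn (K ∩ L) inter_subset_left ⟨x, mem_inter.2 ⟨hxK, hxL⟩⟩ (by
    intro y hy z hz hyz
    rw [mem_inter] at hy ⊢
    exact ⟨hz, hL.closed y hy.2 z (hK.sub hz) hyz⟩)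
  rw [← this]
  exact inter_subset_right

theorem IsComp.eq_of_mem (hK : IsComp G S K) (hL : IsComp G S L) {x : V} (hxK : x ∈ K)
    (hxL : x ∈ L) : K = L :=
  Subset.antisymm (hK.subset_of_mem hL hxK hxL) (hL.subset_of_mem hK hxL hxK)

/-- A smallest adjacency-closed subset of `S` containing `x` is connected: for a proper closed part,
either the part or its complement contains `x` and contradicts minimality. -/
theorem exists_isComp {x : V} (hx : x ∈ S) : ∃ K, IsComp G S K ∧ x ∈ K := by
  let F : Finset (Finset V) :=
    S.powerset.filter fun A => x ∈ A ∧ ∀ y ∈ A, ∀ z ∈ S, G.Adj y z → z ∈ A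
  have hF : F.Nonempty := by
    refine ⟨S, ?_⟩
    simp only [F, mem_filter, mem_powerset]
    exact ⟨Subset.rfl, hx, fun _ _ z hz _ => hz⟩
  obtain ⟨K, hKF, hmin⟩ := exists_min_image F card hF
  simp only [F, mem_filter, mem_powerset] at hKF hmin
  obtain ⟨hKS, hxK, hcl⟩ := hKF
  refine ⟨K, ⟨hKS, ⟨x, hxK⟩, ?_, hcl⟩, hxK⟩
  intro A hAK hA hAcl
  by_cases hxA : x ∈ A
  · exact eq_of_subset_of_card_le hAK (hmin A ⟨hAK.trans hKS, hxA, fun y hy z hz hyz =>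
      hAcl y hy z (hcl y (hAK hy) z hz hyz) hyz⟩)
  · have := hmin (K \ A) ⟨sdiff_subset.trans hKS, by simp [hxK, hxA], fun y hy z hz hyz => by
      rw [mem_sdiff] at hy ⊢
      have hzK := hcl y hy.1 z hz hyz
      exact ⟨hzK, fun hzA => hy.2 (hAcl z hzA y hy.1 hyz.symm)⟩⟩
    rw [card_sdiff_of_subset hAK] at this
    have h1 := card_le_card hAK
    have h2 := hA.card_pos
    omega

theorem sum_card_comps : ∑ K ∈ comps G S, K.card = S.card := by
  rw [← card_biUnion]
  · congr 1
    ext x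
    simp only [mem_biUnion, mem_comps]
    constructor
    · rintro ⟨K, hK, hx⟩
      exact hK.sub hx
    · intro hx
      obtain ⟨K, hK, hxK⟩ := exists_isComp (G := G) hx
      exact ⟨K, hK, hxK⟩
  · intro K hK L hL hne
    rw [Function.onFun, disjoint_left]
    intro x hxK hxL
    exact hne ((mem_comps.1 hK).eq_of_mem (mem_comps.1 hL) hxK hxL)

theorem PConn.connected (h : PConn G K) (hne : K.Nonempty) :
    (G.induce (K : Set V)).Connected := by
  obtain ⟨x, hx⟩ := hne
  have : Nonempty (K : Set V) := ⟨⟨x, hx⟩⟩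
  rw [SimpleGraph.connected_iff_exists_forall_reachable]
  refine ⟨⟨x, hx⟩, ?_⟩
  have := h (K.filter fun y => ∃ hy : y ∈ K, (G.induce (K : Set V)).Reachable ⟨x, hx⟩ ⟨y, hy⟩)
    (filter_subset _ _) ⟨x, by simp [hx]⟩ (by
      intro y hy z hz hyz
      simp only [mem_filter] at hy ⊢
      obtain ⟨-, hyK, hr⟩ := hy
      refine ⟨hz, hz, hr.trans (SimpleGraph.Adj.reachable ?_)⟩
      exact hyz)
  rintro ⟨y, hy⟩
  have hy' : y ∈ K := hy
  rw [← this] at hy'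
  simp only [mem_filter] at hy'
  exact hy'.2.2

theorem pconn_univ [Fintype V] (h : G.Connected) : PConn G univ := by
  intro A _ ⟨x, hx⟩ hcl
  ext y
  simp only [mem_univ, iff_true]
  obtain ⟨p⟩ := h.preconnected x y
  induction p with
  | nil => exact hx
  | cons hadj _ ih => exact ih (hcl _ hx _ (mem_univ _) hadj)

/-- `G` is a smallest connected graph violating the bound without being exceptional. -/
structure MinCE [Fintype V] (G : SimpleGraph V) : Prop where
  conn : PConn G univ
  notExc : ¬ Exc G univ
  large : ∀ D, Isolates G univ D → Fintype.card V < 5 * D.card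
  ih : ∀ K, K ≠ univ → K.Nonempty → PConn G K →
    Exc G K ∨ ∃ D, Isolates G K D ∧ 5 * D.card ≤ K.card

theorem Isolates.of_induce {K : Finset V} {D : Finset (K : Set V)} [Fintype (K : Set V)]
    (h : Isolates (G.induce (K : Set V)) univ D) :
    Isolates G K (D.map ⟨Subtype.val, Subtype.val_injective⟩) := by
  have dom : ∀ w : (K : Set V), Dom (G.induce (K : Set V)) D w →
      Dom G (D.map ⟨Subtype.val, Subtype.val_injective⟩) w := by
    rintro w ⟨v, hv, h⟩
    refine ⟨v, mem_map.2 ⟨v, hv, rfl⟩, h.imp (congrArg Subtype.val) fun h => h⟩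
  intro a b c d hc ha hb hc' hd
  have := h ⟨a, ha⟩ ⟨b, hb⟩ ⟨c, hc'⟩ ⟨d, hd⟩ ⟨hc.1, hc.2.1, hc.2.2.1, hc.2.2.2.1,
    fun h => hc.2.2.2.2.1 (congrArg Subtype.val h),
    fun h => hc.2.2.2.2.2 (congrArg Subtype.val h)⟩
    (mem_univ _) (mem_univ _) (mem_univ _) (mem_univ _)
  exact this.imp (dom _) (Or.imp (dom _) (Or.imp (dom _) (dom _)))

end Components

/-- The bound holds as soon as there is no smallest counterexample. -/
theorem bound_of_no_minCE
    (hno : ∀ (V : Type u) [Fintype V] (G : SimpleGraph V), ¬ MinCE G)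
    (V : Type u) [Fintype V] (G : SimpleGraph V) (hG : G.Connected)
    (hexc : ¬ IsGraphOf exceptional G) :
    isolationNumber G (SimpleGraph.cycleGraph 4) ≤ Fintype.card V / 5 := by
  induction hn : Fintype.card V using Nat.strong_induction_on generalizing V with
  | _ n ih =>
    subst hn
    by_contra hlt
    refine hno V G ⟨pconn_univ hG, fun h => hexc (isGraphOf_of_exc h), ?_, ?_⟩
    · intro D hD
      have := isolationNumber_le hD
      omega
    · intro K hK hne hconn
      by_cases hE : IsGraphOf exceptional (G.induce (K : Set V))
      · exact Or.inl (exc_of_isGraphOf hE)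
      · right
        have hcard : Fintype.card (K : Set V) = K.card := Fintype.card_coe K
        have hlt : K.card < Fintype.card V := by
          rw [← card_univ]
          exact card_lt_card (ssubset_univ_iff.2 hK)
        have := ih _ (by rwa [hcard]) (K : Set V) (G.induce (K : Set V)) (hconn.connected hne) hE rfl
        obtain ⟨D, hD, hDc⟩ := exists_isolates (G.induce (K : Set V))
        refine ⟨_, hD.of_induce, ?_⟩
        rw [card_map, hDc]
        omega

end Isolation

namespace Isolation

open Finset

/-! ### Nine-vertex graphs as 81-bit numbers, and facts about them checked by evaluation -/

section Masks

/-- The `i`-th row of a `9 × 9` matrix of bits. -/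
def row (M i : ℕ) : ℕ := Nat.mod (Nat.shiftRight M (Nat.mul 9 i)) 512

/-- Whether at least two bits of `x` are set. -/
def two (x : ℕ) : Bool := !Nat.beq (Nat.land x (Nat.sub x 1)) 0

/-- The vertices different from and not adjacent to `d`. -/
def away (M d : ℕ) : ℕ := Nat.xor 511 (Nat.lor (row M d) (Nat.shiftLeft 1 d))

/-- The bit of `x` at position `i`, in a form that is cheap to evaluate. -/
def bit (x i : ℕ) : Bool := Nat.beq (Nat.mod (Nat.shiftRight x i) 2) 1

def allNine (p : ℕ → Bool) : Bool := p 0 && p 1 && p 2 && p 3 && p 4 && p 5 && p 6 && p 7 && p 8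

def anyNine (p : ℕ → Bool) : Bool := p 0 || p 1 || p 2 || p 3 || p 4 || p 5 || p 6 || p 7 || p 8

/-- No two vertices of `S` have two common neighbours in `S`. -/
def c4free (M S : ℕ) : Bool :=
  allNine fun i => !bit S i ||
    allNine fun j => !bit (Nat.mod S (Nat.shiftLeft 1 i)) j ||
      !two (Nat.land (Nat.land (row M i) (row M j)) S)

/-- The number of set bits among the last nine. -/
def popc (x : ℕ) : ℕ :=
  x % 2 + x / 2 % 2 + x / 4 % 2 + x / 8 % 2 + x / 16 % 2 + x / 32 % 2 + x / 64 % 2 + x / 128 % 2 +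
    x / 256 % 2

theorem bit_eq (x i : ℕ) : bit x i = x.testBit i := by
  rw [Nat.testBit_eq_decide_div_mod_eq, Bool.eq_iff_iff, decide_eq_true_eq,
    ← Nat.shiftRight_eq_div_pow]
  exact Nat.beq_eq ▸ Iff.rfl

theorem allNine_iff {p : ℕ → Bool} : allNine p = true ↔ ∀ i < 9, p i = true := by
  simp only [allNine, Bool.and_eq_true]
  constructor
  · rintro h i hi
    interval_cases i <;> simp [h]
  · intro h
    simp [h]

theorem anyNine_iff {p : ℕ → Bool} : anyNine p = true ↔ ∃ i < 9, p i = true := by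
  simp only [anyNine, Bool.or_eq_true]
  constructor
  · rintro ((((((((h | h) | h) | h) | h) | h) | h) | h) | h)
    exacts [⟨0, by norm_num, h⟩, ⟨1, by norm_num, h⟩, ⟨2, by norm_num, h⟩, ⟨3, by norm_num, h⟩,
      ⟨4, by norm_num, h⟩, ⟨5, by norm_num, h⟩, ⟨6, by norm_num, h⟩, ⟨7, by norm_num, h⟩,
      ⟨8, by norm_num, h⟩]
  · rintro ⟨i, hi, h⟩
    interval_cases i <;> simp [h]

theorem testBit_row {M i j : ℕ} (hj : j < 9) : (row M i).testBit j = M.testBit (9 * i + j) := by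
  change ((M >>> (9 * i)) % 2 ^ 9).testBit j = _
  rw [Nat.testBit_mod_two_pow]
  simp [hj]

theorem lt_nine_of_testBit_row {M i j : ℕ} (h : (row M i).testBit j = true) : j < 9 := by
  change ((M >>> (9 * i)) % 2 ^ 9).testBit j = _ at h
  rw [Nat.testBit_mod_two_pow] at h
  simp at h
  exact h.1

theorem two_eq_true {x i j : ℕ} (hi : x.testBit i = true) (hj : x.testBit j = true)
    (hij : i ≠ j) : two x = true := by
  by_contra h
  simp only [two, Bool.not_eq_true, Bool.not_eq_false'] at h
  rw [Nat.beq_eq] at h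
  change x &&& (x - 1) = 0 at h
  have hx : x ≠ 0 := by
    rintro rfl
    simp at hi
  obtain ⟨k, rfl⟩ := (Nat.and_sub_one_eq_zero_iff_isPowerOfTwo hx).1 h
  rw [Nat.testBit_two_pow] at hi hj
  simp at hi hj
  exact hij (hi.symm.trans hj)

theorem testBit_away {M d i : ℕ} (hd9 : d < 9) :
    (away M d).testBit i = true ↔ i < 9 ∧ i ≠ d ∧ M.testBit (9 * d + i) = false := by
  change ((2 ^ 9 - 1) ^^^ (row M d ||| 1 <<< d)).testBit i = true ↔ _
  rw [Nat.testBit_xor, Nat.testBit_or,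
    Nat.testBit_two_pow_sub_one, Nat.one_shiftLeft, Nat.testBit_two_pow]
  by_cases hi : i < 9
  · rw [testBit_row hi]
    by_cases hd : d = i
    · simp [hd, hi]
    · simp [hi, hd, Ne.symm hd]
  · have : (row M d).testBit i = false := by
      by_contra h
      exact hi (lt_nine_of_testBit_row (by simpa using h))
    simp [this, hi, show d ≠ i by omega]

/-- On a 4-cycle the opposite vertices `a` and `c` have the two common neighbours `b` and `d`. The
test looks at each pair only with the larger number first, hence the final case distinction. -/
theorem c4free_sound {M S a b c d : ℕ} (h : c4free M S = true)
    (ha9 : a < 9) (hb9 : b < 9) (hc9 : c < 9) (hd9 : d < 9)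
    (ha : S.testBit a = true) (hb : S.testBit b = true) (hc : S.testBit c = true)
    (hd : S.testBit d = true)
    (hab : M.testBit (9 * a + b) = true) (had : M.testBit (9 * a + d) = true)
    (hcb : M.testBit (9 * c + b) = true) (hcd : M.testBit (9 * c + d) = true)
    (hac : a ≠ c) (hbd : b ≠ d) : False := by
  have key : ∀ a c, a < 9 → c < 9 → S.testBit a = true → S.testBit c = true → c < a →
      M.testBit (9 * a + b) = true → M.testBit (9 * a + d) = true →
      M.testBit (9 * c + b) = true → M.testBit (9 * c + d) = true → False := by
    intro a c ha9 hc9 ha hc hlt hab had hcb hcd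
    rw [c4free, allNine_iff] at h
    have h1 := h a ha9
    rw [bit_eq, ha, Bool.not_true, Bool.false_or, allNine_iff] at h1
    have h2 := h1 c hc9
    have hc' : (Nat.mod S (Nat.shiftLeft 1 a)).testBit c = true := by
      change (S % (1 <<< a)).testBit c = true
      rw [Nat.one_shiftLeft, Nat.testBit_mod_two_pow, hc]
      simp [hlt]
    rw [bit_eq, hc', Bool.not_true, Bool.false_or] at h2
    rw [two_eq_true (i := b) (j := d) _ _ hbd] at h2
    · simp at h2
    · change (row M a &&& row M c &&& S).testBit b = true
      simp [testBit_row, hb9, hab, hcb, hb]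
    · change (row M a &&& row M c &&& S).testBit d = true
      simp [testBit_row, hd9, had, hcd, hd]
  rcases lt_or_gt_of_ne hac with hlt | hlt
  · exact key c a hc9 ha9 hc ha hlt hcb hcd hab had
  · exact key a c ha9 hc9 ha hc hlt hab had hcb hcd

/-- The adjacency matrices of the six exceptional graphs on nine vertices. -/
def nineMasks : List ℕ :=
  [924125104315999978396550, 128002775158120017234786, 71334593523272299252578,
   872091274716011238836766, 872091274716011238310430, 872091274715459335012894]

theorem adj_ofEdges_iff (n : ℕ) (l : List (ℕ × ℕ)) (i j : Fin n) :
    (ofEdges n l).Adj i j ↔ i ≠ j ∧ ((i.val + 1, j.val + 1) ∈ l ∨ (j.val + 1, i.val + 1) ∈ l) := by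
  simp [ofEdges]

theorem forall₂_nineMasks : List.Forall₂
    (fun (H : SimpleGraph (Fin 9)) (M : ℕ) => ∀ i j, H.Adj i j ↔ M.testBit (9 * i + j) = true)
    nineGraphs nineMasks := by
  refine .cons ?_ (.cons ?_ (.cons ?_ (.cons ?_ (.cons ?_ (.cons ?_ .nil)))))
  · simp only [graph1, adj_ofEdges_iff]
    decide +kernel
  · simp only [graph2, adj_ofEdges_iff]
    decide +kernel
  · simp only [graph3, adj_ofEdges_iff]
    decide +kernel
  · simp only [graph4, adj_ofEdges_iff]
    decide +kernel
  · simp only [graph5, adj_ofEdges_iff]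
    decide +kernel
  · simp only [graph6, adj_ofEdges_iff]
    decide +kernel

theorem exists_rel_of_forall₂ {α β : Type*} {R : α → β → Prop} {l : List α} {l' : List β}
    (h : List.Forall₂ R l l') {a : α} (ha : a ∈ l) : ∃ b ∈ l', R a b := by
  induction h with
  | nil => simp at ha
  | cons hab _ ih =>
    rcases List.mem_cons.1 ha with rfl | ha
    · exact ⟨_, by simp, hab⟩
    · obtain ⟨b, hb, h⟩ := ih ha
      exact ⟨b, List.mem_cons_of_mem _ hb, h⟩

theorem exists_nineMask {H : SimpleGraph (Fin 9)} (hH : H ∈ nineGraphs) :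
    ∃ M ∈ nineMasks, ∀ i j : Fin 9, H.Adj i j ↔ M.testBit (9 * i + j) = true :=
  exists_rel_of_forall₂ forall₂_nineMasks hH

theorem exists_nineGraph {M : ℕ} (hM : M ∈ nineMasks) :
    ∃ H ∈ nineGraphs, ∀ i j : Fin 9, H.Adj i j ↔ M.testBit (9 * i + j) = true :=
  exists_rel_of_forall₂ (List.Forall₂.flip forall₂_nineMasks) hM

/-- Two vertices isolate. -/
theorem nineMasks_isolate_two : ∀ M ∈ nineMasks, ∃ d < 9, ∃ e < 9,
    c4free M (away M d &&& away M e) = true := by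
  decide +kernel

/-- One vertex isolates as soon as one vertex is deleted. -/
theorem nineMasks_isolate_erase : ∀ M ∈ nineMasks, ∀ p < 9, ∃ h < 9,
    c4free M (away M h &&& (511 ^^^ 1 <<< p)) = true := by
  decide +kernel

/-- The vertices that isolate `M` after the deletion of `r` and `s`. -/
def isolators (M r s : ℕ) : ℕ :=
  (List.range 9).foldl (fun acc h =>
    bif c4free M (away M h &&& (511 ^^^ (1 <<< r ||| 1 <<< s))) then acc ||| 1 <<< h else acc) 0

/-- `h` isolates after the deletion of `r` and `s`, and no remaining vertex has two remaining
neighbours outside `isolators M r s`. -/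
def goodIsolator (M r s h : ℕ) : Bool :=
  let L := away M h &&& (511 ^^^ (1 <<< r ||| 1 <<< s))
  c4free M L && let Q := L &&& (511 ^^^ isolators M r s)
    allNine fun m => !bit L m || !two (row M m &&& Q)

/-- Meant for an exceptional graph attached at two outside vertices `x` and `y`, with `r` and `s`
adjacent to `y`. If a neighbour of `x` is an isolator, choosing it also dominates `x`. Otherwise the
remaining neighbours of `x` avoid `isolators M r s`, and after choosing `h` no two of them close a
4-cycle through `x`. -/
theorem nineMasks_goodIsolator : ∀ M ∈ nineMasks, ∀ r < 9, ∀ s < r, ∃ h < 9,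
    goodIsolator M r s h = true := by
  decide +kernel

/-- The vertices of degree less than 4. -/
def lows (M : ℕ) : ℕ :=
  (List.range 9).foldl (fun acc h => bif popc (row M h) < 4 then acc ||| 1 <<< h else acc) 0

/-- In a graph of maximum degree 4, only the vertices of degree less than 4 in the copy can have
outside neighbours. If at most one of them stays undominated, no undominated 4-cycle can leave the
copy. -/
theorem nineMasks_isolate_low : ∀ M ∈ nineMasks, ∀ p < 9, (lows M).testBit p = true → ∃ h < 9,
    let L := away M h &&& (511 ^^^ 1 <<< p)
    c4free M L = true ∧ two (L &&& lows M) = false := by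
  decide +kernel

theorem nineMasks_degree : ∀ M ∈ nineMasks, ∀ i < 9, 3 ≤ popc (row M i) := by
  decide +kernel

/-- Used to see that two triples of low vertices intersect. -/
theorem nineMasks_lows : ∀ M ∈ nineMasks, popc (lows M) ≤ 4 := by
  decide +kernel

end Masks

end Isolation

namespace Isolation

open Finset
open scoped Classical

/-! ### Isolating sets of exceptional subgraphs -/

section Masked

variable {V : Type*} {G : SimpleGraph V} {K : Finset V}

/-- The adjacency between the vertices `f 0, …, f 8` is recorded in `M`. -/
structure IsMasked (G : SimpleGraph V) (f : Fin 9 → V) (M : ℕ) : Prop where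
  inj : Function.Injective f
  adj : ∀ i j : Fin 9, G.Adj (f i) (f j) ↔ M.testBit (9 * i + j) = true

theorem popc_eq_card (x : ℕ) : popc x = (univ.filter fun i : Fin 9 => x.testBit i = true).card := by
  have h : ∀ i, (if x.testBit i = true then 1 else 0) = x / 2 ^ i % 2 := by
    intro i
    rw [Nat.testBit_eq_decide_div_mod_eq]
    rcases Nat.mod_two_eq_zero_or_one (x / 2 ^ i) with h | h <;> simp [h]
  rw [card_filter]
  simp only [h, Fin.sum_univ_succ, popc]
  simp
  ring

variable {f : Fin 9 → V} {M : ℕ}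

theorem IsMasked.not_isC4 (h : IsMasked G f M) {S : ℕ} (hS : c4free M S = true) {i j k l : Fin 9}
    (hi : S.testBit i = true) (hj : S.testBit j = true) (hk : S.testBit k = true)
    (hl : S.testBit l = true) : ¬ IsC4 G (f i) (f j) (f k) (f l) := by
  rintro ⟨h1, h2, h3, h4, h5, h6⟩
  have h2 := h2.symm
  have h4 := h4.symm
  rw [h.adj] at h1 h2 h3 h4
  exact c4free_sound hS i.2 j.2 k.2 l.2 hi hj hk hl h1 h4 h2 h3
    (fun e => h5 (congrArg f (Fin.ext e))) (fun e => h6 (congrArg f (Fin.ext e)))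

theorem IsMasked.testBit_away (h : IsMasked G f M) {D : Finset V} {d i : Fin 9} (hd : f d ∈ D)
    (hi : ¬ Dom G D (f i)) : (away M d).testBit i = true := by
  rw [Isolation.testBit_away d.2]
  refine ⟨i.2, fun e => hi ⟨_, hd, Or.inl (congrArg f (Fin.ext e))⟩, ?_⟩
  by_contra hadj
  exact hi ⟨_, hd, Or.inr ((h.adj d i).2 (by simpa using hadj))⟩

theorem IsMasked.testBit_row (h : IsMasked G f M) (i j : Fin 9) :
    (row M i).testBit j = true ↔ G.Adj (f i) (f j) := by
  rw [Isolation.testBit_row j.2, h.adj]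

theorem IsMasked.card_adj (h : IsMasked G f M) (i : Fin 9) :
    ((image f univ).filter (G.Adj (f i))).card = popc (row M i) := by
  rw [popc_eq_card, filter_image, card_image_of_injective _ h.inj]
  congr 1
  ext j
  simp [h.testBit_row]

theorem testBit_away_and {M h p i : ℕ} (h1 : (away M h).testBit i = true) (hi : i < 9)
    (h2 : i ≠ p) : (away M h &&& (511 ^^^ 1 <<< p)).testBit i = true := by
  rw [Nat.testBit_and, h1, Nat.testBit_xor, show 511 = 2 ^ 9 - 1 from rfl,
    Nat.testBit_two_pow_sub_one, Nat.one_shiftLeft, Nat.testBit_two_pow]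
  simp [hi, Ne.symm h2]

theorem testBit_away_and_or {M h p q i : ℕ} (h1 : (away M h).testBit i = true) (hi : i < 9)
    (h2 : i ≠ p) (h3 : i ≠ q) :
    (away M h &&& (511 ^^^ (1 <<< p ||| 1 <<< q))).testBit i = true := by
  rw [Nat.testBit_and, h1, Nat.testBit_xor, show 511 = 2 ^ 9 - 1 from rfl,
    Nat.testBit_two_pow_sub_one, Nat.one_shiftLeft, Nat.testBit_or, Nat.testBit_two_pow,
    Nat.one_shiftLeft, Nat.testBit_two_pow]
  simp [hi, Ne.symm h2, Ne.symm h3]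

theorem testBit_foldl_or (p : ℕ → Bool) (l : List ℕ) (acc i : ℕ) :
    (l.foldl (fun acc h => bif p h then acc ||| 1 <<< h else acc) acc).testBit i = true ↔
      acc.testBit i = true ∨ i ∈ l ∧ p i = true := by
  induction l generalizing acc with
  | nil => simp
  | cons a l ih =>
    rw [List.foldl_cons, ih]
    cases hp : p a
    · simp only [cond_false, List.mem_cons]
      constructor
      · rintro (h | h)
        · exact Or.inl h
        · exact Or.inr ⟨Or.inr h.1, h.2⟩
      · rintro (h | ⟨rfl | h, h'⟩)
        · exact Or.inl h
        · simp [hp] at h'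
        · exact Or.inr ⟨h, h'⟩
    · simp only [cond_true, List.mem_cons, Nat.testBit_or, Nat.one_shiftLeft, Nat.testBit_two_pow,
        Bool.or_eq_true, decide_eq_true_eq]
      constructor
      · rintro ((h | rfl) | h)
        · exact Or.inl h
        · exact Or.inr ⟨Or.inl rfl, hp⟩
        · exact Or.inr ⟨Or.inr h.1, h.2⟩
      · rintro (h | ⟨rfl | h, h'⟩)
        · exact Or.inl (Or.inl h)
        · exact Or.inl (Or.inr rfl)
        · exact Or.inr ⟨h, h'⟩

theorem testBit_isolators {M r s h : ℕ} : (isolators M r s).testBit h = true ↔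
    h < 9 ∧ c4free M (away M h &&& (511 ^^^ (1 <<< r ||| 1 <<< s))) = true := by
  rw [isolators, testBit_foldl_or (fun h => c4free M (away M h &&& (511 ^^^ (1 <<< r ||| 1 <<< s))))]
  simp

theorem testBit_lows {M h : ℕ} : (lows M).testBit h = true ↔ h < 9 ∧ popc (row M h) < 4 := by
  have := testBit_foldl_or (fun h => decide (popc (row M h) < 4)) (List.range 9) 0 h
  simp only [lows] at *
  rw [this]
  simp

theorem Exc9.exists_masked (h : Exc9 G K) :
    ∃ M ∈ nineMasks, ∃ f, IsMasked G f M ∧ image f univ = K := by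
  obtain ⟨H, hH, f, hinj, him, hadj⟩ := h
  obtain ⟨M, hM, hMadj⟩ := exists_nineMask hH
  exact ⟨M, hM, f, ⟨hinj, fun i j => (hadj i j).trans (hMadj i j)⟩, him⟩

theorem IsC4.four_le_card {S : Finset V} {a b c d : V} (h : IsC4 G a b c d) (ha : a ∈ S)
    (hb : b ∈ S) (hc : c ∈ S) (hd : d ∈ S) : 4 ≤ S.card := by
  rw [← h.card_eq]
  apply card_le_card
  simp [insert_subset_iff, ha, hb, hc, hd]

/-- One vertex for four vertices and two for nine: an untouched exceptional component costs one unit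
too much. -/
theorem Exc.exists_isolates (h : Exc G K) : ∃ D, Isolates G K D ∧ 5 * D.card ≤ K.card + 1 := by
  rcases h with h | h
  · obtain ⟨a, b, c, d, hc, rfl⟩ := id h
    refine ⟨{a}, ?_, by rw [h.card_eq]; simp⟩
    intro a' b' c' d' hc' ha' hb' hcc' hd'
    by_contra hcon
    push Not at hcon
    -- The vertex `a` leaves at most its opposite vertex undominated.
    have hsub : ∀ x ∈ ({a, b, c, d} : Finset V), ¬ Dom G {a} x → x ∈ ({c} : Finset V) := by
      intro x hx hd
      simp only [mem_insert, mem_singleton] at hx ⊢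
      rcases hx with rfl | rfl | rfl | rfl
      · exact absurd ⟨x, by simp, Or.inl rfl⟩ hd
      · exact absurd ⟨a, by simp, Or.inr hc.1⟩ hd
      · rfl
      · exact absurd ⟨a, by simp, Or.inr hc.2.2.2.1.symm⟩ hd
    have := hc'.four_le_card (hsub _ ha' hcon.1) (hsub _ hb' hcon.2.1) (hsub _ hcc' hcon.2.2.1)
      (hsub _ hd' hcon.2.2.2)
    simp at this
  · rw [h.card_eq]
    obtain ⟨M, hM, f, hf, rfl⟩ := h.exists_masked
    obtain ⟨d, hd, e, he, hde⟩ := nineMasks_isolate_two M hM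
    refine ⟨{f ⟨d, hd⟩, f ⟨e, he⟩}, ?_, by have := card_le_two (a := f ⟨d, hd⟩) (b := f ⟨e, he⟩); omega⟩
    intro a b c d' hc ha hb hc' hd'
    simp only [mem_image, mem_univ, true_and] at ha hb hc' hd'
    obtain ⟨a, rfl⟩ := ha
    obtain ⟨b, rfl⟩ := hb
    obtain ⟨c, rfl⟩ := hc'
    obtain ⟨d', rfl⟩ := hd'
    by_contra hcon
    push Not at hcon
    have key : ∀ i : Fin 9, ¬ Dom G {f ⟨d, hd⟩, f ⟨e, he⟩} (f i) →
        (away M d &&& away M e).testBit i = true := by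
      intro i hi
      rw [Nat.testBit_and, hf.testBit_away (d := ⟨d, hd⟩) (by simp) hi,
        hf.testBit_away (d := ⟨e, he⟩) (by simp) hi]
      rfl
    exact hf.not_isC4 hde (key _ hcon.1) (key _ hcon.2.1) (key _ hcon.2.2.1) (key _ hcon.2.2.2) hc

/-- With one vertex already removed, the empty set suffices for four vertices and a single vertex
for nine. A component that is hit from outside thus gains four units. -/
theorem Exc.exists_isolates_erase (h : Exc G K) {p : V} (hp : p ∈ K) :
    ∃ D, Isolates G (K.erase p) D ∧ 5 * D.card + 4 ≤ K.card := by
  rcases h with h | h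
  · refine ⟨∅, ?_, by simp [h.card_eq]⟩
    intro a b c d hc ha hb hc' hd
    have := hc.four_le_card ha hb hc' hd
    rw [card_erase_of_mem hp, h.card_eq] at this
    omega
  · rw [h.card_eq]
    obtain ⟨M, hM, f, hf, rfl⟩ := h.exists_masked
    simp only [mem_image, mem_univ, true_and] at hp
    obtain ⟨p, rfl⟩ := hp
    obtain ⟨e, he, hde⟩ := nineMasks_isolate_erase M hM p p.2
    refine ⟨{f ⟨e, he⟩}, ?_, by simp⟩
    intro a b c d' hc ha hb hc' hd'
    simp only [mem_erase, mem_image, mem_univ, true_and] at ha hb hc' hd'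
    obtain ⟨ha, a, rfl⟩ := ha
    obtain ⟨hb, b, rfl⟩ := hb
    obtain ⟨hc', c, rfl⟩ := hc'
    obtain ⟨hd', d', rfl⟩ := hd'
    by_contra hcon
    push Not at hcon
    have key : ∀ i : Fin 9, f i ≠ f p → ¬ Dom G {f ⟨e, he⟩} (f i) →
        (away M e &&& (511 ^^^ 1 <<< p.1)).testBit i = true := by
      intro i hne hi
      exact testBit_away_and (hf.testBit_away (d := ⟨e, he⟩) (by simp) hi) i.2
        fun h => hne (congrArg f (Fin.ext h))
    exact hf.not_isC4 hde (key _ ha hcon.1) (key _ hb hcon.2.1) (key _ hc' hcon.2.2.1)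
      (key _ hd' hcon.2.2.2) hc

/-- Here `P` and `R` stand for the neighbours in `K` of two outside vertices `x` and `y`, of which
`y` will be chosen too. The last clause says that `D` dominates `x`, or that no surviving 4-cycle
consists of `x` and three vertices of `K`. The assumption `hPR` holds after exchanging `x` and `y`
if necessary. -/
theorem Exc.exists_isolates_links (h : Exc G K) {P R : Finset V} (hP : P ⊆ K) (hR : R ⊆ K)
    (hRne : R.Nonempty) (hPR : 2 ≤ R.card ∨ P.card ≤ 1) :
    ∃ D, 5 * D.card + 4 ≤ K.card ∧ Isolates G (K \ R) D ∧
      ((∃ p ∈ P, p ∈ D) ∨ ∀ m ∈ K \ R, ∀ l ∈ P \ R, ∀ l' ∈ P \ R, ¬ Dom G D m → ¬ Dom G D l →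
        ¬ Dom G D l' → G.Adj m l → G.Adj m l' → l = l') := by
  have hcard : ∀ D : Finset V, P.card ≤ 1 → ∀ m ∈ K \ R, ∀ l ∈ P \ R, ∀ l' ∈ P \ R, ¬ Dom G D m →
      ¬ Dom G D l → ¬ Dom G D l' → G.Adj m l → G.Adj m l' → l = l' := by
    intro D hP1 m _ l hl l' hl' _ _ _ _ _
    exact card_le_one.1 hP1 l (mem_sdiff.1 hl).1 l' (mem_sdiff.1 hl').1
  rcases h with h | h
  · refine ⟨∅, by simp [h.card_eq], ?_, Or.inr ?_⟩
    · intro a b c d hc ha hb hc' hd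
      have := hc.four_le_card ha hb hc' hd
      rw [card_sdiff_of_subset hR, h.card_eq] at this
      have := hRne.card_pos
      omega
    · rcases hPR with hR2 | hP1
      · intro m hm l hl l' hl' _ _ _ hml hml'
        by_contra hne
        have h3 : ({m, l, l'} : Finset V).card = 3 := card_eq_three.2
          ⟨m, l, l', hml.ne, hml'.ne, hne, rfl⟩
        have hsub : ({m, l, l'} : Finset V) ⊆ K \ R := by
          have : P \ R ⊆ K \ R := sdiff_subset_sdiff hP Subset.rfl
          simp [insert_subset_iff, hm, this hl, this hl', -mem_sdiff]
        have := card_le_card hsub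
        rw [card_sdiff_of_subset hR, h.card_eq] at this
        omega
      · exact hcard _ hP1
  · have hK9 := h.card_eq
    rcases hPR with hR2 | hP1
    · obtain ⟨M, hM, f, hf, rfl⟩ := h.exists_masked
      obtain ⟨r, hr, s, hs, hrs⟩ := one_lt_card.1 hR2
      have hrK := hR hr
      have hsK := hR hs
      simp only [mem_image, mem_univ, true_and] at hrK hsK
      obtain ⟨r, rfl⟩ := hrK
      obtain ⟨s, rfl⟩ := hsK
      wlog hlt : s < r generalizing r s
      · refine this s hs r hr hrs.symm (lt_of_le_of_ne (not_lt.1 hlt) ?_)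
        rintro rfl
        exact hrs rfl
      obtain ⟨h, hh, hgood⟩ := nineMasks_goodIsolator M hM r r.2 s hlt
      simp only [goodIsolator, Bool.and_eq_true] at hgood
      obtain ⟨hfree, hgood⟩ := hgood
      have key : ∀ (e : Fin 9) (i : Fin 9), f i ∉ R → ¬ Dom G {f e} (f i) →
          (away M e &&& (511 ^^^ (1 <<< r.1 ||| 1 <<< s.1))).testBit i = true := by
        intro e i hne hi
        refine testBit_away_and_or (hf.testBit_away (by simp) hi) i.2 ?_ ?_
        · intro h; exact hne ((Fin.ext h : i = r) ▸ hr)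
        · intro h; exact hne ((Fin.ext h : i = s) ▸ hs)
      have iso : ∀ e : Fin 9, c4free M (away M e &&& (511 ^^^ (1 <<< r.1 ||| 1 <<< s.1))) = true →
          Isolates G (image f univ \ R) {f e} := by
        intro e hde a b c d' hc ha hb hc' hd'
        simp only [mem_sdiff, mem_image, mem_univ, true_and] at ha hb hc' hd'
        obtain ⟨⟨a, rfl⟩, ha⟩ := ha
        obtain ⟨⟨b, rfl⟩, hb⟩ := hb
        obtain ⟨⟨c, rfl⟩, hc'⟩ := hc'
        obtain ⟨⟨d', rfl⟩, hd'⟩ := hd'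
        by_contra hcon
        push Not at hcon
        exact hf.not_isC4 hde (key _ _ ha hcon.1) (key _ _ hb hcon.2.1) (key _ _ hc' hcon.2.2.1)
          (key _ _ hd' hcon.2.2.2) hc
      -- A vertex of `P` that isolates is the best choice. If there is none, `P` avoids all
      -- isolators, which is what `goodIsolator` presupposes.
      by_cases hPS : ∃ i : Fin 9, f i ∈ P ∧
          c4free M (away M i &&& (511 ^^^ (1 <<< r.1 ||| 1 <<< s.1))) = true
      · obtain ⟨i, hiP, hi⟩ := hPS
        exact ⟨{f i}, by simp [hK9], iso i hi, Or.inl ⟨f i, hiP, by simp⟩⟩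
      · push Not at hPS
        refine ⟨{f ⟨h, hh⟩}, by simp [hK9], iso ⟨h, hh⟩ hfree, Or.inr ?_⟩
        intro m hm l hl l' hl' hdm hdl hdl' hml hml'
        by_contra hne
        have hlK := hP (mem_sdiff.1 hl).1
        have hlK' := hP (mem_sdiff.1 hl').1
        simp only [mem_sdiff, mem_image, mem_univ, true_and] at hm hlK hlK'
        obtain ⟨⟨m, rfl⟩, hm⟩ := hm
        obtain ⟨l, rfl⟩ := hlK
        obtain ⟨l', rfl⟩ := hlK'
        rw [mem_sdiff] at hl hl'
        rw [allNine_iff] at hgood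
        have h1 := hgood m m.2
        rw [bit_eq, key ⟨h, hh⟩ m hm hdm] at h1
        have bit : ∀ l : Fin 9, f l ∈ P → f l ∉ R → ¬ Dom G {f ⟨h, hh⟩} (f l) →
            G.Adj (f m) (f l) → (row M m &&& (away M h &&& (511 ^^^ (1 <<< r.1 ||| 1 <<< s.1)) &&&
              (511 ^^^ isolators M r s))).testBit l = true := by
          intro l hlP hlR hd hadj
          rw [Nat.testBit_and, Nat.testBit_and, (hf.testBit_row m l).2 hadj,
            key ⟨h, hh⟩ l hlR hd, Nat.testBit_xor, show 511 = 2 ^ 9 - 1 from rfl,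
            Nat.testBit_two_pow_sub_one]
          have : (isolators M r s).testBit l = false := by
            by_contra hcon
            have := (testBit_isolators.1 (by simpa using hcon)).2
            exact hPS l hlP this
          simp [this]
        rw [two_eq_true (bit l hl.1 hl.2 hdl hml) (bit l' hl'.1 hl'.2 hdl' hml')
          (fun e => hne (congrArg f (Fin.ext e)))] at h1
        simp at h1
    · obtain ⟨r, hr⟩ := hRne
      obtain ⟨D, hD, hDc⟩ := Exc.exists_isolates_erase (Or.inr h) (hR hr)
      refine ⟨D, hDc, ?_, Or.inr (hcard D hP1)⟩
      have hsub : K \ R ⊆ K.erase r := fun x hx => by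
        rw [mem_sdiff] at hx
        exact mem_erase.2 ⟨fun e => hx.2 (e ▸ hr), hx.1⟩
      exact fun a b c d hc ha hb hc' hd => hD a b c d hc (hsub ha) (hsub hb) (hsub hc') (hsub hd)

theorem Exc9.exists_isolates_low (h : Exc9 G K) {p : V} (hp : p ∈ K)
    (hlow : (K.filter (G.Adj p)).card < 4) :
    ∃ h ∈ K, Isolates G (K.erase p) {h} ∧
      ∀ l ∈ K.erase p, ∀ l' ∈ K.erase p, ¬ Dom G {h} l → ¬ Dom G {h} l' →
        (K.filter (G.Adj l)).card < 4 → (K.filter (G.Adj l')).card < 4 → l = l' := by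
  obtain ⟨M, hM, f, hf, rfl⟩ := h.exists_masked
  simp only [mem_image, mem_univ, true_and] at hp
  obtain ⟨p, rfl⟩ := hp
  rw [hf.card_adj] at hlow
  obtain ⟨e, he, hfree, htwo⟩ := nineMasks_isolate_low M hM p p.2 (testBit_lows.2 ⟨p.2, hlow⟩)
  have key : ∀ i : Fin 9, f i ≠ f p → ¬ Dom G {f ⟨e, he⟩} (f i) →
      (away M e &&& (511 ^^^ 1 <<< p.1)).testBit i = true := by
    intro i hne hi
    exact testBit_away_and (hf.testBit_away (d := ⟨e, he⟩) (by simp) hi) i.2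
      fun h => hne (congrArg f (Fin.ext h))
  refine ⟨f ⟨e, he⟩, by simp, ?_, ?_⟩
  · intro a b c d' hc ha hb hc' hd'
    simp only [mem_erase, mem_image, mem_univ, true_and] at ha hb hc' hd'
    obtain ⟨ha, a, rfl⟩ := ha
    obtain ⟨hb, b, rfl⟩ := hb
    obtain ⟨hc', c, rfl⟩ := hc'
    obtain ⟨hd', d', rfl⟩ := hd'
    by_contra hcon
    push Not at hcon
    exact hf.not_isC4 hfree (key _ ha hcon.1) (key _ hb hcon.2.1) (key _ hc' hcon.2.2.1)
      (key _ hd' hcon.2.2.2) hc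
  · intro l hl l' hl' hd hd' hlow hlow'
    simp only [mem_erase, mem_image, mem_univ, true_and] at hl hl'
    obtain ⟨hl, l, rfl⟩ := hl
    obtain ⟨hl', l', rfl⟩ := hl'
    rw [hf.card_adj] at hlow hlow'
    by_contra hne
    rw [two_eq_true (i := l) (j := l')] at htwo
    · simp at htwo
    · rw [Nat.testBit_and, key l hl hd, testBit_lows.2 ⟨l.2, hlow⟩]; rfl
    · rw [Nat.testBit_and, key l' hl' hd', testBit_lows.2 ⟨l'.2, hlow'⟩]; rfl
    · exact fun e => hne (congrArg f (Fin.ext e))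

theorem Exc9.three_le_card_adj (h : Exc9 G K) {p : V} (hp : p ∈ K) :
    3 ≤ (K.filter (G.Adj p)).card := by
  obtain ⟨M, hM, f, hf, rfl⟩ := h.exists_masked
  simp only [mem_image, mem_univ, true_and] at hp
  obtain ⟨p, rfl⟩ := hp
  rw [hf.card_adj]
  exact nineMasks_degree M hM p p.2

theorem Exc9.card_low_le (h : Exc9 G K) :
    (K.filter fun p => (K.filter (G.Adj p)).card < 4).card ≤ 4 := by
  obtain ⟨M, hM, f, hf, rfl⟩ := h.exists_masked
  have hle := nineMasks_lows M hM
  rw [popc_eq_card] at hle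
  refine le_trans (le_trans (card_le_card ?_) (card_image_le (f := f))) hle
  intro x hx
  rw [mem_filter, mem_image] at hx
  obtain ⟨⟨i, -, rfl⟩, hi⟩ := hx
  rw [hf.card_adj] at hi
  exact mem_image.2 ⟨i, mem_filter.2 ⟨mem_univ _, testBit_lows.2 ⟨i.2, hi⟩⟩, rfl⟩

end Masked

end Isolation

namespace Isolation

open Finset
open scoped Classical

/-! ### Connectedness of two vertices through adjacency-closed sets -/

section Linked

variable {V : Type*} {G : SimpleGraph V}

/-- `x` and `y` lie in the same component of `G[S]`. -/
def Linked (G : SimpleGraph V) (S : Finset V) (x y : V) : Prop :=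
  ∀ A ⊆ S, (∀ a ∈ A, ∀ z ∈ S, G.Adj a z → z ∈ A) → (x ∈ A ↔ y ∈ A)

theorem Linked.symm {S : Finset V} {x y : V} (h : Linked G S x y) : Linked G S y x :=
  fun A hA hcl => (h A hA hcl).symm

theorem Linked.trans {S : Finset V} {x y z : V} (h : Linked G S x y) (h' : Linked G S y z) :
    Linked G S x z :=
  fun A hA hcl => (h A hA hcl).trans (h' A hA hcl)

theorem Linked.of_adj {S : Finset V} {x y : V} (hx : x ∈ S) (hy : y ∈ S) (h : G.Adj x y) :
    Linked G S x y :=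
  fun _ _ hcl => ⟨fun hxA => hcl x hxA y hy h, fun hyA => hcl y hyA x hx h.symm⟩

end Linked

/-! ### The counting inequality, few attachments, and large degrees -/

section Counterexample

variable {V : Type*} [Fintype V] {G : SimpleGraph V}

/-- The exceptional components of `G[S]` that meet the closed neighbourhood of `D`. -/
noncomputable def hitComps (G : SimpleGraph V) (S D : Finset V) : Finset (Finset V) :=
  (comps G S).filter fun K => Exc G K ∧ ∃ x ∈ K, Dom G D x

/-- The exceptional components of `G[S]` that avoid the closed neighbourhood of `D`. -/
noncomputable def unhitComps (G : SimpleGraph V) (S D : Finset V) : Finset (Finset V) :=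
  (comps G S).filter fun K => Exc G K ∧ ∀ x ∈ K, ¬ Dom G D x

theorem mem_unhitComps {S D K : Finset V} :
    K ∈ unhitComps G S D ↔ IsComp G S K ∧ Exc G K ∧ ∀ x ∈ K, ¬ Dom G D x := by
  simp [unhitComps, mem_comps]

/-- Delete a set `Y` all of whose 4-cycles are killed by `D`, and apply the minimality of `G` to
the components that are left. -/
theorem MinCE.card_add_lt (h : MinCE G) {D Y : Finset V} (hY : Y.Nonempty)
    (hav : ∀ a b c d, IsC4 G a b c d → a ∈ Y → Dom G D a ∨ Dom G D b ∨ Dom G D c ∨ Dom G D d) :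
    Y.card + 4 * (hitComps G Yᶜ D).card < 5 * D.card + (unhitComps G Yᶜ D).card := by
  -- Balance of one component: a hit exceptional component gains 4, an unhit one loses 1, and any
  -- other breaks even by minimality.
  have hex : ∀ K ∈ comps G Yᶜ, ∃ E : Finset V,
      5 * E.card + (if Exc G K ∧ ∃ x ∈ K, Dom G D x then 4 else 0) ≤
        K.card + (if Exc G K ∧ ∀ x ∈ K, ¬ Dom G D x then 1 else 0) ∧ Isolates G K (D ∪ E) := by
    intro K hK
    rw [mem_comps] at hK
    have hKne : K ≠ univ := by
      rintro rfl
      obtain ⟨y, hy⟩ := hY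
      have := hK.sub (mem_univ y)
      simp [hy] at this
    have mono : ∀ E, Isolates G K E → Isolates G K (D ∪ E) := by
      intro E hE a b c d hc ha hb hc' hd
      have key : ∀ x, Dom G E x → Dom G (D ∪ E) x := fun x hx => hx.mono subset_union_right
      exact (hE a b c d hc ha hb hc' hd).imp (key _) (Or.imp (key _) (Or.imp (key _) (key _)))
    by_cases hE : Exc G K
    · by_cases hhit : ∃ x ∈ K, Dom G D x
      · obtain ⟨x, hx, hdx⟩ := id hhit
        obtain ⟨E, hE1, hE2⟩ := hE.exists_isolates_erase hx
        refine ⟨E, ?_, ?_⟩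
        · rw [if_pos ⟨hE, hhit⟩]; omega
        · intro a b c d hc ha hb hc' hd
          by_contra hcon
          push Not at hcon
          have key : ∀ y, y ∈ K → ¬ Dom G (D ∪ E) y → y ∈ K.erase x := by
            intro y hy hdy
            refine mem_erase.2 ⟨?_, hy⟩
            rintro rfl
            exact hdy (hdx.mono subset_union_left)
          have key' : ∀ y, Dom G E y → Dom G (D ∪ E) y := fun x hx => hx.mono subset_union_right
          rcases hE1 a b c d hc (key _ ha hcon.1) (key _ hb hcon.2.1) (key _ hc' hcon.2.2.1)
            (key _ hd hcon.2.2.2) with h | h | h | h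
          · exact hcon.1 (key' _ h)
          · exact hcon.2.1 (key' _ h)
          · exact hcon.2.2.1 (key' _ h)
          · exact hcon.2.2.2 (key' _ h)
      · obtain ⟨E, hE1, hE2⟩ := hE.exists_isolates
        refine ⟨E, ?_, mono E hE1⟩
        rw [if_neg (fun h => hhit h.2), if_pos ⟨hE, fun x hx hd => hhit ⟨x, hx, hd⟩⟩]
        omega
    · rcases h.ih K hKne hK.ne hK.conn with h1 | ⟨E, hE1, hE2⟩
      · exact absurd h1 hE
      · refine ⟨E, ?_, mono E hE1⟩
        rw [if_neg (fun h => hE h.1), if_neg (fun h => hE h.1)]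
        omega
  choose! E hE using hex
  have hsum := sum_le_sum fun K hK => (hE K hK).1
  rw [sum_add_distrib, sum_add_distrib, sum_card_comps, ← mul_sum] at hsum
  have h1 : ∑ K ∈ comps G Yᶜ, (if Exc G K ∧ ∃ x ∈ K, Dom G D x then 4 else 0) =
      4 * (hitComps G Yᶜ D).card := by
    rw [hitComps, ← sum_filter, sum_const, smul_eq_mul, mul_comm]
  have h2 : ∑ K ∈ comps G Yᶜ, (if Exc G K ∧ ∀ x ∈ K, ¬ Dom G D x then 1 else 0) =
      (unhitComps G Yᶜ D).card := by
    rw [unhitComps, ← sum_filter, sum_const, smul_eq_mul, mul_one]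
  rw [h1, h2] at hsum
  -- By `hav`, applied to all rotations, an undominated 4-cycle avoids `Y`. It then lies in a single
  -- component `K`, where `D ∪ E K` kills it.
  have hiso : Isolates G univ (D ∪ (comps G Yᶜ).biUnion E) := by
    intro a b c d hc _ _ _ _
    by_contra hcon
    push Not at hcon
    have hD : ∀ x, ¬ Dom G (D ∪ (comps G Yᶜ).biUnion E) x → ¬ Dom G D x :=
      fun x hx hd => hx (hd.mono subset_union_left)
    have hrot : ∀ a b c d, IsC4 G a b c d → ¬ Dom G (D ∪ (comps G Yᶜ).biUnion E) a →
        ¬ Dom G (D ∪ (comps G Yᶜ).biUnion E) b → ¬ Dom G (D ∪ (comps G Yᶜ).biUnion E) c →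
        ¬ Dom G (D ∪ (comps G Yᶜ).biUnion E) d → a ∈ Yᶜ := by
      intro a b c d hc h1 h2 h3 h4
      rw [mem_compl]
      intro ha
      rcases hav a b c d hc ha with h | h | h | h
      · exact hD _ h1 h
      · exact hD _ h2 h
      · exact hD _ h3 h
      · exact hD _ h4 h
    obtain ⟨n1, n2, n3, n4⟩ := hcon
    have ha := hrot a b c d hc n1 n2 n3 n4
    have hb := hrot b c d a hc.rotate n2 n3 n4 n1
    have hcc := hrot c d a b hc.rotate.rotate n3 n4 n1 n2
    have hd := hrot d a b c hc.rotate.rotate.rotate n4 n1 n2 n3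
    obtain ⟨K, hK, haK⟩ := exists_isComp (G := G) ha
    have hbK := hK.closed a haK b hb hc.1
    have hcK := hK.closed b hbK c hcc hc.2.1
    have hdK := hK.closed c hcK d hd hc.2.2.1
    have hsub : D ∪ E K ⊆ D ∪ (comps G Yᶜ).biUnion E :=
      union_subset_union Subset.rfl (subset_biUnion_of_mem E (mem_comps.2 hK))
    rcases (hE K (mem_comps.2 hK)).2 a b c d hc haK hbK hcK hdK with h | h | h | h
    · exact n1 (h.mono hsub)
    · exact n2 (h.mono hsub)
    · exact n3 (h.mono hsub)
    · exact n4 (h.mono hsub)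
  have hlarge := h.large _ hiso
  have hcard : (D ∪ (comps G Yᶜ).biUnion E).card ≤ D.card + ∑ K ∈ comps G Yᶜ, (E K).card :=
    (card_union_le _ _).trans (Nat.add_le_add_left card_biUnion_le _)
  have hcompl := card_add_card_compl Y
  omega

theorem MinCE.exists_adj (h : MinCE G) {K Y : Finset V} (hK : IsComp G Yᶜ K) (hY : Y.Nonempty) :
    ∃ k ∈ K, ∃ y ∈ Y, G.Adj k y := by
  by_contra hcon
  push Not at hcon
  have := h.conn K (subset_univ _) hK.ne (by
    intro k hk z _ hkz
    by_cases hz : z ∈ Y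
    · exact absurd hkz (hcon k hk z hz)
    · exact hK.closed k hk z (mem_compl.2 hz) hkz)
  obtain ⟨y, hy⟩ := hY
  have hyK : y ∈ K := this ▸ mem_univ y
  exact (mem_compl.1 (hK.sub hyK)) hy

/-- No exceptional connected proper part of `G` is attached to the rest at a single vertex. -/
theorem MinCE.not_exc_of_one_link (h : MinCE G) {x : V} {K : Finset V} (hne : K.Nonempty)
    (hK : PConn G K) (hx : x ∉ K) (hl : ∀ k ∈ K, ∀ z ∉ K, G.Adj k z → z = x) : ¬ Exc G K := by
  intro hE
  have hcomp : IsComp G ({x} : Finset V)ᶜ K := by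
    refine ⟨fun k hk => ?_, hne, hK, fun k hk z hz hkz => ?_⟩
    · rw [mem_compl, mem_singleton]
      rintro rfl
      exact hx hk
    · by_contra hzK
      rw [mem_compl, mem_singleton] at hz
      exact hz (hl k hk z hzK hkz)
  -- By connectedness of `G`, every component of `G - x` is hit by `x`, so `1 + 4h < 5` leaves no
  -- room for the exceptional component `K`.
  have hlt := h.card_add_lt (D := {x}) (Y := {x}) (singleton_nonempty x) (by
    intro a b c d _ ha
    exact Or.inl ⟨a, ha, Or.inl rfl⟩)
  have hhit : ∀ L, IsComp G ({x} : Finset V)ᶜ L → ∃ y ∈ L, Dom G {x} y := by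
    intro L hL
    obtain ⟨k, hk, y, hy, hky⟩ := h.exists_adj hL (singleton_nonempty x)
    exact ⟨k, hk, y, hy, Or.inr hky.symm⟩
  have h1 : unhitComps G ({x} : Finset V)ᶜ {x} = ∅ := by
    rw [eq_empty_iff_forall_notMem]
    intro L hL
    rw [mem_unhitComps] at hL
    obtain ⟨y, hy, hd⟩ := hhit L hL.1
    exact hL.2.2 y hy hd
  have h2 : 0 < (hitComps G ({x} : Finset V)ᶜ {x}).card := by
    refine card_pos.2 ⟨K, ?_⟩
    rw [hitComps, mem_filter, mem_comps]
    exact ⟨hcomp, hE, hhit K hcomp⟩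
  rw [h1] at hlt
  simp at hlt
  omega

/-- Delete `K` and `y`, choosing `y` and the set `D` of `Exc.exists_isolates_links`. No exceptional
component stays unhit, so `|K| + 1 < 5(|D| + 1) ≤ |K| + 1`. A surviving 4-cycle meeting `K` would
avoid the neighbours of `y` and could leave `K` only through `x`. -/
theorem MinCE.not_exc_of_two_links_aux (h : MinCE G) {x y : V} {K : Finset V} (hne : K.Nonempty)
    (hK : PConn G K) (hx : x ∉ K) (hy : y ∉ K)
    (hl : ∀ k ∈ K, ∀ z ∉ K, G.Adj k z → z = x ∨ z = y) (hlink : Linked G Kᶜ x y)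
    (hPR : 2 ≤ (K.filter (G.Adj y)).card ∨ (K.filter (G.Adj x)).card ≤ 1) : ¬ Exc G K := by
  intro hE
  have hR : (K.filter (G.Adj y)).Nonempty := by
    by_contra hR
    rw [not_nonempty_iff_eq_empty, filter_eq_empty_iff] at hR
    refine h.not_exc_of_one_link hne hK hx (fun k hk z hz hkz => ?_) hE
    rcases hl k hk z hz hkz with rfl | rfl
    · rfl
    · exact absurd hkz.symm (hR hk)
  obtain ⟨D, hD, hiso, hlinks⟩ := hE.exists_isolates_links (filter_subset (G.Adj x) K)
    (filter_subset (G.Adj y) K) hR hPR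
  have hmono : ∀ z, ¬ Dom G (insert y D) z → ¬ Dom G D z :=
    fun z hz hd => hz (hd.mono (subset_insert _ _))
  have hny : ∀ z, ¬ Dom G (insert y D) z → z ≠ y ∧ ¬ G.Adj y z := by
    intro z hz
    exact ⟨fun e => hz ⟨y, mem_insert_self _ _, Or.inl e⟩,
      fun e => hz ⟨y, mem_insert_self _ _, Or.inr e⟩⟩
  have hlt := h.card_add_lt (D := insert y D) (Y := insert y K) ⟨y, mem_insert_self _ _⟩ (by
    intro a b c d hc ha
    by_contra hcon
    push Not at hcon
    obtain ⟨na, nb, nc, nd⟩ := hcon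
    have haK : a ∈ K := by
      rcases mem_insert.1 ha with rfl | ha
      · exact absurd rfl (hny _ na).1
      · exact ha
    have mem : ∀ k ∈ K, ∀ z, G.Adj k z → ¬ Dom G (insert y D) z → z ∈ K ∨ z = x := by
      intro k hk z hkz hz
      by_cases hzK : z ∈ K
      · exact Or.inl hzK
      · exact Or.inr ((hl k hk z hzK hkz).resolve_right (hny z hz).1)
    have memR : ∀ z ∈ K, ¬ Dom G (insert y D) z → z ∈ K \ K.filter (G.Adj y) := by
      intro z hzK hz
      rw [mem_sdiff, mem_filter]
      exact ⟨hzK, fun e => (hny z hz).2 e.2⟩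
    have memP : ∀ z ∈ K, ¬ Dom G (insert y D) z → G.Adj x z →
        z ∈ K.filter (G.Adj x) \ K.filter (G.Adj y) := by
      intro z hzK hz hxz
      rw [mem_sdiff, mem_filter, mem_filter]
      exact ⟨⟨hzK, hxz⟩, fun e => (hny z hz).2 e.2⟩
    have path : ¬ Dom G (insert y D) x → ∀ m ∈ K, ∀ l ∈ K, ∀ l' ∈ K, ¬ Dom G (insert y D) m →
        ¬ Dom G (insert y D) l → ¬ Dom G (insert y D) l' → G.Adj m l → G.Adj m l' →
        G.Adj x l → G.Adj x l' → l = l' := by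
      intro hnx m hm l hlK l' hl'K nm nl nl' hml hml' hxl hxl'
      rcases hlinks with ⟨p, hp, hpD⟩ | hlinks
      · exact absurd ⟨p, mem_insert_of_mem hpD, Or.inr (mem_filter.1 hp).2.symm⟩ hnx
      · exact hlinks m (memR m hm nm) l (memP l hlK nl hxl) l' (memP l' hl'K nl' hxl')
          (hmono _ nm) (hmono _ nl) (hmono _ nl') hml hml'
    obtain ⟨h1, h2, h3, h4, h5, h6⟩ := id hc
    rcases mem a haK b h1 nb with hb | rfl
    · rcases mem a haK d h4.symm nd with hd | rfl
      · rcases mem b hb c h2 nc with hcK | rfl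
        · rcases hiso a b c d hc (memR a haK na) (memR b hb nb) (memR c hcK nc) (memR d hd nd)
            with h | h | h | h
          · exact hmono _ na h
          · exact hmono _ nb h
          · exact hmono _ nc h
          · exact hmono _ nd h
        · exact h6 (path nc a haK b hb d hd na nb nd h1 h4.symm h2.symm h3)
      · rcases mem b hb c h2 nc with hcK | rfl
        · exact h5 (path nd b hb a haK c hcK nb na nc h1.symm h2 h4 h3.symm)
        · exact h3.ne rfl
    · rcases mem a haK d h4.symm nd with hd | rfl
      · rcases mem d hd c h3.symm nc with hcK | rfl
        · exact h5 (path nb d hd a haK c hcK nd na nc h4 h3.symm h1.symm h2)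
        · exact h2.ne rfl
      · exact h6 rfl)
  -- A component without neighbours of `y` is closed under adjacency outside `K`. By `hlink` it
  -- cannot contain `x` without containing `y`, so it would be cut off from the rest of `G`.
  have h1 : unhitComps G (insert y K)ᶜ (insert y D) = ∅ := by
    rw [eq_empty_iff_forall_notMem]
    intro L hL
    rw [mem_unhitComps] at hL
    obtain ⟨hL, -, hun⟩ := hL
    have hyL : y ∉ L := fun hyL => (hny y (hun y hyL)).1 rfl
    have hLK : ∀ k ∈ K, k ∉ L := fun k hk hkL => by
      have := hL.sub hkL
      simp [hk] at this
    have hcl : ∀ l ∈ L, ∀ z ∈ Kᶜ, G.Adj l z → z ∈ L := by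
      intro l hlL z hz hlz
      refine hL.closed l hlL z ?_ hlz
      rw [mem_compl] at hz ⊢
      rw [mem_insert, not_or]
      exact ⟨fun e => (hny l (hun l hlL)).2 (e ▸ hlz.symm), hz⟩
    have hxL : x ∉ L := by
      intro hxL
      exact hyL ((hlink L (fun l hl => mem_compl.2 fun hlK => hLK l hlK hl) hcl).1 hxL)
    have := h.conn L (subset_univ _) hL.ne (by
      intro l hlL z _ hlz
      by_cases hz : z ∈ K
      · rcases hl z hz l (fun hlK => hLK l hlK hlL) hlz.symm with rfl | rfl
        · exact absurd hlL hxL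
        · exact absurd hlL hyL
      · exact hcl l hlL z (mem_compl.2 hz) hlz)
    exact hyL (this ▸ mem_univ y)
  rw [h1, card_insert_of_notMem hy] at hlt
  have := card_insert_le y D
  simp at hlt
  omega

/-- No exceptional connected part of `G` is attached to the rest at two vertices that are connected
outside of it. -/
theorem MinCE.not_exc_of_two_links (h : MinCE G) {x y : V} {K : Finset V} (hne : K.Nonempty)
    (hK : PConn G K) (hx : x ∉ K) (hy : y ∉ K)
    (hl : ∀ k ∈ K, ∀ z ∉ K, G.Adj k z → z = x ∨ z = y) (hlink : Linked G Kᶜ x y) :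
    ¬ Exc G K := by
  by_cases hPR : 2 ≤ (K.filter (G.Adj y)).card ∨ (K.filter (G.Adj x)).card ≤ 1
  · exact h.not_exc_of_two_links_aux hne hK hx hy hl hlink hPR
  · exact h.not_exc_of_two_links_aux hne hK hy hx (fun k hk z hz hkz => (hl k hk z hz hkz).symm)
      hlink.symm (by omega)

/-- The vertices outside `K` with a neighbour in `K`. -/
noncomputable def outer (G : SimpleGraph V) (K : Finset V) : Finset V :=
  univ.filter fun z => z ∉ K ∧ ∃ k ∈ K, G.Adj k z

theorem mem_outer {K : Finset V} {z : V} : z ∈ outer G K ↔ z ∉ K ∧ ∃ k ∈ K, G.Adj k z := by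
  simp [outer]

/-- Without outer vertices `K` would be all of `G`, which is not exceptional; one or two outer
vertices are excluded by the preceding lemmas. -/
theorem MinCE.three_le_card_outer (h : MinCE G) {K : Finset V} (hne : K.Nonempty)
    (hK : PConn G K) (hE : Exc G K)
    (hlink : ∀ x ∈ outer G K, ∀ y ∈ outer G K, Linked G Kᶜ x y) : 3 ≤ (outer G K).card := by
  by_contra hlt
  have hmem : ∀ k ∈ K, ∀ z ∉ K, G.Adj k z → z ∈ outer G K :=
    fun k hk z hz hkz => mem_outer.2 ⟨hz, k, hk, hkz⟩
  have hcases : (outer G K).card = 0 ∨ (outer G K).card = 1 ∨ (outer G K).card = 2 := by omega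
  rcases hcases with h0 | h1 | h2
  · rw [card_eq_zero] at h0
    have := h.conn K (subset_univ _) hne (by
      intro k hk z _ hkz
      by_contra hz
      have := hmem k hk z hz hkz
      simp [h0] at this)
    exact h.notExc (this ▸ hE)
  · obtain ⟨x, hx⟩ := card_eq_one.1 h1
    have hxo : x ∈ outer G K := by simp [hx]
    exact h.not_exc_of_one_link hne hK (mem_outer.1 hxo).1 (fun k hk z hz hkz => by
      have := hmem k hk z hz hkz
      rw [hx] at this
      simpa using this) hE
  · obtain ⟨x, y, -, hxy⟩ := card_eq_two.1 h2
    have hxo : x ∈ outer G K := by simp [hxy]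
    have hyo : y ∈ outer G K := by simp [hxy]
    exact h.not_exc_of_two_links hne hK (mem_outer.1 hxo).1 (mem_outer.1 hyo).1
      (fun k hk z hz hkz => by
        have := hmem k hk z hz hkz
        rw [hxy] at this
        simpa using this) (hlink x hxo y hyo) hE

/-- A vertex of degree at least 4 has degree 4, and exactly one component of what is left after
deleting its closed neighbourhood is exceptional. -/
theorem MinCE.four_le_degree (h : MinCE G) (v : V) (hv : 4 ≤ (univ.filter (G.Adj v)).card) :
    (univ.filter (G.Adj v)).card = 4 ∧
      ∃ K, IsComp G (insert v (univ.filter (G.Adj v)))ᶜ K ∧ Exc G K ∧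
        (∀ L, IsComp G (insert v (univ.filter (G.Adj v)))ᶜ L → Exc G L → L = K) ∧
        3 ≤ ((univ.filter (G.Adj v)).filter fun x => ∃ k ∈ K, G.Adj x k).card := by
  set N := univ.filter (G.Adj v) with hN
  set Y := insert v N with hY
  have hvN : v ∉ N := by simp [hN]
  set E := (comps G Yᶜ).filter (Exc G) with hEdef
  have hE : ∀ {K}, K ∈ E ↔ IsComp G Yᶜ K ∧ Exc G K := by
    intro K
    rw [hEdef, mem_filter, mem_comps]
  clear_value E
  let r : Finset V → V → Prop := fun K x => ∃ k ∈ K, G.Adj x k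
  -- All outer vertices of `K` are neighbours of `v`, hence linked outside `K` through `v`.
  have hthree : ∀ K ∈ E, 3 ≤ (N.filter (r K)).card := by
    intro K hK
    obtain ⟨hK, hKE⟩ := hE.1 hK
    have hnot : ∀ k ∈ K, k ≠ v ∧ k ∉ N := by
      intro k hk
      have := hK.sub hk
      rw [mem_compl, hY, mem_insert, not_or] at this
      exact this
    have hsub : outer G K ⊆ N.filter (r K) := by
      intro z hz
      obtain ⟨hzK, k, hk, hkz⟩ := mem_outer.1 hz
      have hzY : z ∈ Y := by
        by_contra hzY
        exact hzK (hK.closed k hk z (mem_compl.2 hzY) hkz)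
      rw [hY, mem_insert] at hzY
      rw [mem_filter]
      refine ⟨hzY.resolve_left ?_, k, hk, hkz.symm⟩
      rintro rfl
      exact (hnot k hk).2 (by simpa [hN] using hkz.symm)
    have hvK : v ∈ Kᶜ := mem_compl.2 fun hvK => (hnot v hvK).1 rfl
    have hlv : ∀ x ∈ outer G K, Linked G Kᶜ x v := by
      intro x hx
      have hxN := (mem_filter.1 (hsub hx)).1
      exact (Linked.of_adj hvK (mem_compl.2 (mem_outer.1 hx).1) (by simpa [hN] using hxN)).symm
    exact (h.three_le_card_outer hK.ne hK.conn hKE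
      fun x hx y hy => (hlv x hx).trans (hlv y hy).symm).trans (card_le_card hsub)
  let k : Finset V → ℕ := fun S => (E.filter fun K => ∃ x ∈ S, r K x).card
  -- The counting inequality with `insert v S` as dominating set. A component touched by `S` counts
  -- 5: 4 for being hit and 1 for not being unhit.
  have hmaster : ∀ S ⊆ N, N.card + 5 * k S < 4 + 5 * S.card + E.card := by
    intro S hS
    have hlt := h.card_add_lt (D := insert v S) (Y := Y) ⟨v, by simp [hY]⟩ (by
      intro a b c d _ ha
      refine Or.inl ⟨v, mem_insert_self _ _, ?_⟩
      simpa [hY, hN] using ha)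
    have h1 : E.filter (fun K => ∃ x ∈ S, r K x) ⊆ hitComps G Yᶜ (insert v S) := by
      intro K hK
      obtain ⟨hK, x, hx, l, hl, hxl⟩ := mem_filter.1 hK
      obtain ⟨hK, hKE⟩ := hE.1 hK
      rw [hitComps, mem_filter, mem_comps]
      exact ⟨hK, hKE, l, hl, x, mem_insert_of_mem hx, Or.inr hxl⟩
    have h2 : unhitComps G Yᶜ (insert v S) ⊆ E \ E.filter (fun K => ∃ x ∈ S, r K x) := by
      intro K hK
      obtain ⟨hK, hKE, hun⟩ := mem_unhitComps.1 hK
      rw [mem_sdiff, mem_filter]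
      refine ⟨hE.2 ⟨hK, hKE⟩, ?_⟩
      rintro ⟨-, x, hx, l, hl, hxl⟩
      exact hun l hl ⟨x, mem_insert_of_mem hx, Or.inr hxl⟩
    have h3 := card_le_card h1
    have h4 := card_le_card h2
    rw [card_sdiff_of_subset (filter_subset _ _)] at h4
    have h5 : k S ≤ E.card := card_le_card (filter_subset _ _)
    have h6 : Y.card = N.card + 1 := card_insert_of_notMem hvN
    have h7 : (insert v S).card = S.card + 1 := card_insert_of_notMem fun hvS => hvN (hS hvS)
    change k S ≤ _ at h3
    change _ ≤ E.card - k S at h4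
    omega
  -- A largest `S` that touches at least two components per vertex: every further vertex of `N`
  -- touches at most one new component.
  obtain ⟨S, hS, hmax⟩ := exists_max_image (N.powerset.filter fun S => 2 * S.card ≤ k S) card
    ⟨∅, by simp⟩
  rw [mem_filter, mem_powerset] at hS
  obtain ⟨hSN, hS⟩ := hS
  -- Double counting: an untouched component has three neighbours in `N`, all outside `S`, and each
  -- of these touches only one untouched component.
  have hcount : (E.filter fun K => ¬ ∃ x ∈ S, r K x).card * 3 ≤ (N \ S).card * 1 := by
    refine card_mul_le_card_mul r ?_ ?_
    · intro K hK
      obtain ⟨hK, hun⟩ := mem_filter.1 hK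
      refine (hthree K hK).trans (card_le_card ?_)
      intro x hx
      rw [mem_bipartiteAbove, mem_sdiff]
      obtain ⟨hxN, hx⟩ := mem_filter.1 hx
      exact ⟨⟨hxN, fun hxS => hun ⟨x, hxS, hx⟩⟩, hx⟩
    · intro x hx
      rw [mem_sdiff] at hx
      by_contra hcon
      rw [not_le] at hcon
      have hins : 2 * (insert x S).card ≤ k (insert x S) := by
        have hdisj : Disjoint (E.filter fun K => ∃ x ∈ S, r K x)
            (bipartiteBelow r (E.filter fun K => ¬ ∃ x ∈ S, r K x) x) := by
          rw [disjoint_left]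
          intro K hK hK'
          rw [mem_bipartiteBelow, mem_filter] at hK'
          exact hK'.1.2 (mem_filter.1 hK).2
        have hsub : (E.filter fun K => ∃ x ∈ S, r K x) ∪
            (bipartiteBelow r (E.filter fun K => ¬ ∃ x ∈ S, r K x) x) ⊆
            E.filter fun K => ∃ y ∈ insert x S, r K y := by
          intro K hK
          rw [mem_union, mem_bipartiteBelow, mem_filter, mem_filter] at hK
          rw [mem_filter]
          rcases hK with ⟨hK, y, hy, hyK⟩ | ⟨⟨hK, -⟩, hxK⟩
          · exact ⟨hK, y, mem_insert_of_mem hy, hyK⟩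
          · exact ⟨hK, x, mem_insert_self _ _, hxK⟩
        have := card_le_card hsub
        rw [card_union_of_disjoint hdisj] at this
        rw [card_insert_of_notMem hx.2]
        change k S + _ ≤ k (insert x S) at this
        omega
      have := hmax (insert x S) (by
        rw [mem_filter, mem_powerset]
        exact ⟨insert_subset hx.1 hSN, hins⟩)
      rw [card_insert_of_notMem hx.2] at this
      omega
  have hsplit : k S + (E.filter fun K => ¬ ∃ x ∈ S, r K x).card = E.card :=
    card_filter_add_card_filter_not _
  rw [card_sdiff_of_subset hSN] at hcount
  have hSle := card_le_card hSN
  have hm := hmaster S hSN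
  -- For `u` untouched components, `|N| + 4 k S < 4 + 5|S| + u`, `3u ≤ |N| - |S|`, `2|S| ≤ k S` and
  -- `|N| ≥ 4` force `S` to be empty, `|N| = 4` and `u = 1`.
  have hfin : N.card = 4 ∧ E.card = 1 := by omega
  obtain ⟨K, hK⟩ := card_eq_one.1 hfin.2
  have hKE : K ∈ E := by simp [hK]
  refine ⟨hfin.1, K, (hE.1 hKE).1, (hE.1 hKE).2, ?_, hthree K hKE⟩
  intro L hL hLE
  have : L ∈ E := hE.2 ⟨hL, hLE⟩
  simpa [hK] using this

end Counterexample

end Isolation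

namespace Isolation

open Finset
open scoped Classical

/-- Diameter at most 2 is the convenient form of connectedness here: it can be evaluated, and it
needs no walks. -/
theorem nineMasks_diam : ∀ M ∈ nineMasks, ∀ i < 9, ∀ j < 9, i = j ∨ M.testBit (9 * i + j) = true ∨
    ∃ k < 9, M.testBit (9 * i + k) = true ∧ M.testBit (9 * k + j) = true := by
  decide +kernel

/-! ### Excluding nine-vertex exceptional subgraphs, and reducible cores -/

section Counterexample

variable {V : Type*} {G : SimpleGraph V}

theorem Exc9.linked {K S : Finset V} (h : Exc9 G K) (hKS : K ⊆ S) {x y : V} (hx : x ∈ K)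
    (hy : y ∈ K) : Linked G S x y := by
  obtain ⟨M, hM, f, hf, rfl⟩ := h.exists_masked
  have hmem : ∀ i, f i ∈ S := fun i => hKS (mem_image_of_mem f (mem_univ i))
  simp only [mem_image, mem_univ, true_and] at hx hy
  obtain ⟨i, rfl⟩ := hx
  obtain ⟨j, rfl⟩ := hy
  rcases nineMasks_diam M hM i i.2 j j.2 with hij | hij | ⟨k, hk, hik, hkj⟩
  · rw [Fin.ext hij]
    exact fun _ _ _ => Iff.rfl
  · exact Linked.of_adj (hmem i) (hmem j) ((hf.adj i j).2 hij)
  · exact (Linked.of_adj (hmem i) (hmem ⟨k, hk⟩) ((hf.adj i ⟨k, hk⟩).2 hik)).trans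
      (Linked.of_adj (hmem ⟨k, hk⟩) (hmem j) ((hf.adj ⟨k, hk⟩ j).2 hkj))

theorem not_dom_singleton {d x : V} (h : ¬ Dom G {d} x) : x ≠ d ∧ ¬ G.Adj d x :=
  ⟨fun e => h ⟨d, by simp, Or.inl e⟩, fun e => h ⟨d, by simp, Or.inr e⟩⟩

variable [Fintype V]

/-- Degrees are at least 3 inside `K` and at most 4 in `G`, which leaves room for a single outside
neighbour, and only at a vertex of degree 3 in `K`. -/
theorem Exc9.low_of_adj {K : Finset V} (hK : Exc9 G K)
    (hdeg : ∀ v, (univ.filter (G.Adj v)).card ≤ 4) {k z z' : V} (hk : k ∈ K) (hz : z ∉ K)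
    (hz' : z' ∉ K) (hkz : G.Adj k z) (hkz' : G.Adj k z') :
    (K.filter (G.Adj k)).card < 4 ∧ z = z' := by
  have h3 := hK.three_le_card_adj hk
  have hsub : K.filter (G.Adj k) ∪ {z, z'} ⊆ univ.filter (G.Adj k) := by
    intro w hw
    simp only [mem_union, mem_filter, mem_insert, mem_singleton, mem_univ, true_and] at hw ⊢
    rcases hw with hw | rfl | rfl
    · exact hw.2
    · exact hkz
    · exact hkz'
  have hdisj : Disjoint (K.filter (G.Adj k)) {z, z'} := by
    rw [disjoint_left]
    intro w hw
    rw [mem_insert, mem_singleton, not_or]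
    exact ⟨fun e => hz (e ▸ (mem_filter.1 hw).1), fun e => hz' (e ▸ (mem_filter.1 hw).1)⟩
  have hle := (card_le_card hsub).trans (hdeg k)
  rw [card_union_of_disjoint hdisj] at hle
  have hpos : 0 < ({z, z'} : Finset V).card := card_pos.2 ⟨z, by simp⟩
  refine ⟨by omega, ?_⟩
  by_contra hne
  rw [card_pair hne] at hle
  omega

/-- Delete the ten vertices of `K` and `y`, choosing `y` and the vertex `e` that isolates `K - p`.
The counting inequality becomes `10 + 4h < 10 + u`, so `u` is positive. -/
theorem MinCE.exists_unlinked_comp (h : MinCE G) (hdeg : ∀ v, (univ.filter (G.Adj v)).card ≤ 4)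
    {K : Finset V} (hK : Exc9 G K) {p y : V} (hp : p ∈ K) (hy : y ∉ K) (hpy : G.Adj p y) :
    ∃ B, IsComp G (insert y K)ᶜ B ∧ Exc G B ∧ ∀ b ∈ B, ¬ G.Adj y b := by
  obtain ⟨e, heK, hiso, huniq⟩ :=
    hK.exists_isolates_low hp (hK.low_of_adj hdeg hp hy hy hpy hpy).1
  have hmono : ∀ z, ¬ Dom G {y, e} z → ¬ Dom G {e} z :=
    fun z hz hd => hz (hd.mono (by simp))
  have hny : ∀ z, ¬ Dom G {y, e} z → z ≠ y ∧ ¬ G.Adj y z := by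
    intro z hz
    exact ⟨fun e => hz ⟨y, by simp, Or.inl e⟩, fun e => hz ⟨y, by simp, Or.inr e⟩⟩
  have hlt := h.card_add_lt (D := {y, e}) (Y := insert y K) ⟨y, mem_insert_self _ _⟩ (by
    intro a b c d hc ha
    by_contra hcon
    push Not at hcon
    obtain ⟨na, nb, nc, nd⟩ := hcon
    have haK : a ∈ K := by
      rcases mem_insert.1 ha with rfl | ha
      · exact absurd rfl (hny _ na).1
      · exact ha
    have mem : ∀ k ∈ K, ¬ Dom G {y, e} k → k ∈ K.erase p := by
      intro k hk hd
      refine mem_erase.2 ⟨?_, hk⟩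
      rintro rfl
      exact (hny _ hd).2 hpy.symm
    -- At most one edge leaves `K` from an undominated vertex, whereas a 4-cycle leaving `K` uses at
    -- least two.
    have cross : ∀ k ∈ K, ∀ k' ∈ K, ∀ z ∉ K, ∀ z' ∉ K, ¬ Dom G {y, e} k → ¬ Dom G {y, e} k' →
        G.Adj k z → G.Adj k' z' → k = k' ∧ z = z' := by
      intro k hk k' hk' z hz z' hz' nk nk' hkz hkz'
      have := huniq k (mem k hk nk) k' (mem k' hk' nk') (hmono _ nk) (hmono _ nk')
        (hK.low_of_adj hdeg hk hz hz hkz hkz).1 (hK.low_of_adj hdeg hk' hz' hz' hkz' hkz').1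
      subst this
      exact ⟨rfl, (hK.low_of_adj hdeg hk hz hz' hkz hkz').2⟩
    obtain ⟨h1, h2, h3, h4, h5, h6⟩ := id hc
    by_cases hb : b ∈ K
    · by_cases hd : d ∈ K
      · by_cases hcK : c ∈ K
        · rcases hiso a b c d hc (mem a haK na) (mem b hb nb) (mem c hcK nc) (mem d hd nd)
            with h | h | h | h
          · exact hmono _ na h
          · exact hmono _ nb h
          · exact hmono _ nc h
          · exact hmono _ nd h
        · exact h6 (cross b hb d hd c hcK c hcK nb nd h2 h3.symm).1
      · by_cases hcK : c ∈ K
        · exact h5 (cross a haK c hcK d hd d hd na nc h4.symm h3).1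
        · exact h1.ne (cross a haK b hb d hd c hcK na nb h4.symm h2).1
    · by_cases hd : d ∈ K
      · by_cases hcK : c ∈ K
        · exact h5 (cross a haK c hcK b hb b hb na nc h1 h2.symm).1
        · exact h4.ne' (cross a haK d hd b hb c hcK na nd h1 h3.symm).1
      · exact h6 (cross a haK a haK b hb d hd na na h1 h4.symm).2)
  rw [card_insert_of_notMem hy, hK.card_eq] at hlt
  have := card_le_two (a := y) (b := e)
  obtain ⟨B, hB⟩ := card_pos.1 (show 0 < (unhitComps G (insert y K)ᶜ {y, e}).card by omega)
  rw [mem_unhitComps] at hB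
  exact ⟨B, hB.1, hB.2.1, fun b hb => (hny b (hB.2.2 b hb)).2⟩

/-- An exceptional graph on nine vertices is not a proper induced subgraph of `G`. -/
theorem MinCE.not_exc9 (h : MinCE G) (hdeg : ∀ v, (univ.filter (G.Adj v)).card ≤ 4)
    {K : Finset V} (hne : K ≠ univ) : ¬ Exc9 G K := by
  intro hK
  have hKne : K.Nonempty := by
    rw [← card_pos, hK.card_eq]
    norm_num
  have step : ∀ p ∈ K, ∀ y ∉ K, G.Adj p y → ∃ B, IsComp G Kᶜ B ∧ y ∉ B ∧ 3 ≤ (outer G B).card ∧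
      outer G B ⊆ K.filter fun p => (K.filter (G.Adj p)).card < 4 := by
    intro p hp y hy hpy
    obtain ⟨B, hB, hBE, hBy⟩ := h.exists_unlinked_comp hdeg hK hp hy hpy
    have hBK : ∀ b ∈ B, b ∉ K ∧ b ≠ y := by
      intro b hb
      have := hB.sub hb
      rw [mem_compl, mem_insert, not_or] at this
      exact this.symm
    have hcl : ∀ b ∈ B, ∀ z ∈ Kᶜ, G.Adj b z → z ∈ B := by
      intro b hb z hz hbz
      refine hB.closed b hb z ?_ hbz
      rw [mem_compl, mem_insert, not_or]
      exact ⟨fun e => hBy b hb (e ▸ hbz.symm), mem_compl.1 hz⟩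
    have hout : ∀ z ∈ outer G B, z ∈ K ∧ (K.filter (G.Adj z)).card < 4 := by
      intro z hz
      obtain ⟨hzB, b, hb, hbz⟩ := mem_outer.1 hz
      have hzK : z ∈ K := by
        by_contra hzK
        exact hzB (hcl b hb z (mem_compl.2 hzK) hbz)
      exact ⟨hzK, (hK.low_of_adj hdeg hzK (hBK b hb).1 (hBK b hb).1 hbz.symm hbz.symm).1⟩
    have hsub : K ⊆ Bᶜ := fun k hk => mem_compl.2 fun hkB => (hBK k hkB).1 hk
    refine ⟨B, ⟨fun b hb => mem_compl.2 (hBK b hb).1, hB.ne, hB.conn, hcl⟩,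
      fun hyB => (hBK y hyB).2 rfl, ?_, fun z hz => mem_filter.2 (hout z hz)⟩
    exact h.three_le_card_outer hB.ne hB.conn hBE
      fun x hx y hy => hK.linked hsub (hout x hx).1 (hout y hy).1
  have hlink : ∃ p ∈ K, ∃ y ∉ K, G.Adj p y := by
    by_contra hcon
    push Not at hcon
    exact hne (h.conn K (subset_univ _) hKne fun p hp y _ hpy => by
      by_contra hy
      exact hcon p hp y hy hpy)
  obtain ⟨p, hp, y, hy, hpy⟩ := hlink
  obtain ⟨B, hB, -, hB3, hBlow⟩ := step p hp y hy hpy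
  obtain ⟨q, hq⟩ := card_pos.1 (show 0 < (outer G B).card by omega)
  obtain ⟨-, z, hz, hzq⟩ := mem_outer.1 hq
  have hqK := (mem_filter.1 (hBlow hq)).1
  -- The same argument with `z ∈ B` as the deleted outside vertex yields a component that misses
  -- `z`, hence differs from `B`.
  obtain ⟨B', hB', hzB', hB3', hBlow'⟩ := step q hqK z (mem_compl.1 (hB.sub hz)) hzq.symm
  -- Two sets of at least three among at most four low vertices intersect. The only outside
  -- neighbour of a common vertex then lies in both `B` and `B'`.
  have hint : (outer G B ∩ outer G B').Nonempty := by
    rw [← card_pos]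
    have h1 := card_union_add_card_inter (outer G B) (outer G B')
    have h2 := card_le_card (union_subset hBlow hBlow')
    have h3 := hK.card_low_le
    omega
  obtain ⟨w, hw⟩ := hint
  rw [mem_inter] at hw
  obtain ⟨-, b, hb, hbw⟩ := mem_outer.1 hw.1
  obtain ⟨-, b', hb', hbw'⟩ := mem_outer.1 hw.2
  have hwK := (mem_filter.1 (hBlow hw.1)).1
  have hbb := (hK.low_of_adj hdeg hwK (mem_compl.1 (hB.sub hb)) (mem_compl.1 (hB'.sub hb'))
    hbw.symm hbw'.symm).2
  subst hbb
  exact hzB' (hB.eq_of_mem hB' hb hb' ▸ hz)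

theorem IsComp.of_disjoint {C Y L : Finset V} (hYC : Y ⊆ C) (hL : IsComp G Yᶜ L)
    (hLC : Disjoint L C) : IsComp G Cᶜ L :=
  ⟨fun _ hw => mem_compl.2 (disjoint_left.1 hLC hw), hL.ne, hL.conn,
    fun l hl z hz hlz => hL.closed l hl z (compl_subset_compl.2 hYC hz) hlz⟩

/-- A set `Y` whose 4-cycles are all killed by one vertex is small if all the components of `G - Y`
that might be exceptional meet `C`, and every vertex of `C \ Y` is dominated by `R`, inside
`C \ Y`. -/
theorem MinCE.false_of_dominated_rest (h : MinCE G) {C Y R : Finset V} {d : V}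
    (hgood : ∀ L, IsComp G Yᶜ L → Disjoint L C → (∀ x ∈ L, ¬ Dom G {d} x) → ¬ Exc G L)
    (hav : ∀ a b c e, IsC4 G a b c e → a ∈ Y →
      Dom G {d} a ∨ Dom G {d} b ∨ Dom G {d} c ∨ Dom G {d} e)
    (hRY : Disjoint R Y) (hR : ∀ w ∈ C, w ∉ Y → ∃ r ∈ R, w = r ∨ G.Adj r w)
    (hcard : 5 ≤ Y.card)
    (hsmall : 5 + R.card ≤ Y.card ∨
      ∀ L, IsComp G Yᶜ L → (∃ r ∈ R, r ∈ L) → ¬ Exc G L) : False := by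
  have : Nonempty V := ⟨d⟩
  have hlt := h.card_add_lt (D := {d}) (Y := Y) (card_pos.1 (by omega)) hav
  have hex : ∀ L ∈ unhitComps G Yᶜ {d}, ∃ r ∈ R, r ∈ L := by
    intro L hL
    obtain ⟨hL, hLE, hun⟩ := mem_unhitComps.1 hL
    have : ∃ w ∈ L, w ∈ C := by
      by_contra hcon
      push Not at hcon
      exact hgood L hL (disjoint_left.2 hcon) hun hLE
    obtain ⟨w, hwL, hwC⟩ := this
    obtain ⟨r, hr, hrw⟩ := hR w hwC (mem_compl.1 (hL.sub hwL))
    refine ⟨r, hr, ?_⟩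
    rcases hrw with rfl | hrw
    · exact hwL
    · exact hL.closed w hwL r (mem_compl.2 (disjoint_left.1 hRY hr)) hrw.symm
  -- Now `|Y| + 4h < 5 + u`. Each of the `u` components contains a vertex of `R`, different ones for
  -- different components.
  rw [card_singleton] at hlt
  rcases hsmall with hsmall | hsmall
  · choose! g hgR hgL using hex
    have := card_le_card_of_injOn g (fun L hL => hgR L hL) (by
      intro L hL L' hL' he
      have h1 := (mem_unhitComps.1 hL).1
      have h2 := (mem_unhitComps.1 hL').1
      refine h1.eq_of_mem h2 (hgL L hL) ?_
      rw [he]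
      exact hgL L' hL')
    omega
  · obtain ⟨L, hL⟩ := card_pos.1 (show 0 < (unhitComps G Yᶜ {d}).card by omega)
    have hr := hex L hL
    obtain ⟨hL, hLE, -⟩ := mem_unhitComps.1 hL
    exact hsmall L hL hr hLE

/-- `f` lists nine vertices of `G`; only those with numbers in `U` have other neighbours, and no
component of the rest is exceptional. -/
structure IsCore (G : SimpleGraph V) (f : Fin 9 → V) (U : Finset (Fin 9)) : Prop where
  inj : Function.Injective f
  out : ∀ i, i ∉ U → ∀ z, G.Adj (f i) z → ∃ j, z = f j
  good : ∀ L, IsComp G (image f univ)ᶜ L → ¬ Exc G L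

/-- The vertex `d` reduces the core described by the adjacency relation `A`: the vertices that are
left form no 4-cycle, and `T` contains those of them that may lie in a 4-cycle with vertices outside
of the core. -/
structure Reduces (U : Finset (Fin 9)) (A : Fin 9 → Fin 9 → Prop) (d : Fin 9)
    (T : Finset (Fin 9)) : Prop where
  away : ∀ i ∈ T, i ≠ d ∧ ¬ A d i
  free : ∀ i j k l, i ≠ d ∧ ¬ A d i → j ≠ d ∧ ¬ A d j → k ≠ d ∧ ¬ A d k → l ≠ d ∧ ¬ A d l →
    A i j → A j k → A k l → A l i → i ≠ k → j = l
  mem : ∀ i ∈ U, i ≠ d ∧ ¬ A d i → i ∈ T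
  mem_of_adj : ∀ i ∈ U, ∀ j ∈ U,
    i ≠ j → i ≠ d ∧ ¬ A d i → j ≠ d ∧ ¬ A d j → ∀ r, r ≠ d ∧ ¬ A d r → A r i → A r j → r ∈ T
  small : T.card ≤ 2 ∨ T.card ≤ 4 ∧ ∃ r ∈ T, ∀ t ∈ T, t = r ∨ A r t

/-- Delete the core except `T`. A surviving 4-cycle through a deleted vertex would lie in the core,
against `free`, or would leave it between two vertices of `U` whose common neighbour is in `T`. If
`|T| ≤ 2`, or `|T| ≤ 3` with a dominating vertex, the counting inequality fails. If `|T| = 4`, an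
exceptional component containing the dominating vertex would have to be `T` itself, which has no
4-cycle. -/
theorem MinCE.not_reduces (h : MinCE G) (hdeg : ∀ v, (univ.filter (G.Adj v)).card ≤ 4)
    {f : Fin 9 → V} {U : Finset (Fin 9)} (hf : IsCore G f U) (d : Fin 9) (T : Finset (Fin 9)) :
    ¬ Reduces U (fun i j => G.Adj (f i) (f j)) d T := by
  rintro ⟨haway, hfree, hmem, hmemadj, hsmall⟩
  have hnd : ∀ i, ¬ Dom G {f d} (f i) → i ≠ d ∧ ¬ G.Adj (f d) (f i) := by
    intro i hi
    exact ⟨fun e => (not_dom_singleton hi).1 (congrArg f e), (not_dom_singleton hi).2⟩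
  have hav : ∀ a b c e, IsC4 G a b c e → a ∈ image f Tᶜ →
      Dom G {f d} a ∨ Dom G {f d} b ∨ Dom G {f d} c ∨ Dom G {f d} e := by
    intro a b c e hc ha
    by_contra hcon
    push Not at hcon
    obtain ⟨na, nb, nc, ne⟩ := hcon
    obtain ⟨i, hi, rfl⟩ := mem_image.1 ha
    rw [mem_compl] at hi
    have hiU : i ∉ U := fun hiU => hi (hmem i hiU (hnd i na))
    obtain ⟨h1, h2, h3, h4, h5, h6⟩ := hc
    obtain ⟨j, rfl⟩ := hf.out i hiU b h1
    obtain ⟨l, rfl⟩ := hf.out i hiU e h4.symm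
    by_cases hcf : ∃ k, c = f k
    · obtain ⟨k, rfl⟩ := hcf
      exact h6 (congrArg f (hfree i j k l (hnd i na) (hnd j nb) (hnd k nc) (hnd l ne) h1 h2 h3 h4
        fun e => h5 (congrArg f e)))
    · have hjU : j ∈ U := by
        by_contra hj
        exact hcf (hf.out j hj c h2)
      have hlU : l ∈ U := by
        by_contra hl
        exact hcf (hf.out l hl c h3.symm)
      exact hi (hmemadj j hjU l hlU (fun e => h6 (congrArg f e)) (hnd j nb) (hnd l ne) i (hnd i na)
        h1 h4.symm)
  have hsubC : image f Tᶜ ⊆ image f univ := image_subset_image (subset_univ _)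
  have hgood : ∀ L, IsComp G (image f Tᶜ)ᶜ L → Disjoint L (image f univ) →
      (∀ x ∈ L, ¬ Dom G {f d} x) → ¬ Exc G L :=
    fun L hL hLC _ => hf.good L (hL.of_disjoint hsubC hLC)
  have hYcard : (image f Tᶜ).card + T.card = 9 := by
    rw [card_image_of_injective _ hf.inj, add_comm, card_add_card_compl, Fintype.card_fin]
  have hdisj : ∀ R ⊆ T, Disjoint (image f R) (image f Tᶜ) := by
    intro R hR
    rw [disjoint_image hf.inj]
    exact disjoint_compl_right.mono_left hR
  have hnotY : ∀ w ∈ image f univ, w ∉ image f Tᶜ → ∃ t ∈ T, f t = w := by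
    intro w hw hwY
    obtain ⟨t, -, rfl⟩ := mem_image.1 hw
    refine ⟨t, ?_, rfl⟩
    by_contra ht
    exact hwY (mem_image_of_mem f (mem_compl.2 ht))
  rcases hsmall with h2 | ⟨h4, r, hr, hstar⟩
  · refine h.false_of_dominated_rest (R := image f T) hgood hav (hdisj T Subset.rfl) ?_ (by omega)
      (Or.inl ?_)
    · intro w hw hwY
      obtain ⟨t, ht, rfl⟩ := hnotY w hw hwY
      exact ⟨f t, mem_image_of_mem f ht, Or.inl rfl⟩
    · rw [card_image_of_injective _ hf.inj]
      omega
  · refine h.false_of_dominated_rest (R := image f {r}) hgood hav (hdisj {r} (by simpa using hr)) ?_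
      (by omega) ?_
    · intro w hw hwY
      obtain ⟨t, ht, rfl⟩ := hnotY w hw hwY
      exact ⟨f r, by simp, (hstar t ht).imp (congrArg f) id⟩
    · by_cases h3 : T.card ≤ 3
      · left
        simp
        omega
      · right
        rintro L hL ⟨r', hr', hrL⟩ hLE
        rw [image_singleton, mem_singleton] at hr'
        subst hr'
        have hTL : image f T ⊆ L := by
          intro w hw
          obtain ⟨t, ht, rfl⟩ := mem_image.1 hw
          rcases hstar t ht with rfl | hadj
          · exact hrL
          · refine hL.closed _ hrL _ ?_ hadj
            rw [mem_compl]
            exact disjoint_left.1 (hdisj T Subset.rfl) hw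
        have hLne : L ≠ univ := by
          rintro rfl
          obtain ⟨y, hy⟩ := card_pos.1 (show 0 < (image f Tᶜ).card by omega)
          exact mem_compl.1 (hL.sub (mem_univ y)) hy
        have hL4 : Exc4 G L := hLE.resolve_right (h.not_exc9 hdeg hLne)
        have hLT : image f T = L := by
          refine eq_of_subset_of_card_le hTL ?_
          rw [hL4.card_eq, card_image_of_injective _ hf.inj]
          omega
        obtain ⟨a, b, c, e, hc, hLeq⟩ := hL4
        have hidx : ∀ x ∈ L, ∃ t, (t ≠ d ∧ ¬ G.Adj (f d) (f t)) ∧ f t = x := by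
          intro x hx
          rw [← hLT] at hx
          obtain ⟨t, ht, rfl⟩ := mem_image.1 hx
          exact ⟨t, haway t ht, rfl⟩
        obtain ⟨i, hi, rfl⟩ := hidx a (by simp [hLeq])
        obtain ⟨j, hj, rfl⟩ := hidx b (by simp [hLeq])
        obtain ⟨k, hk, rfl⟩ := hidx c (by simp [hLeq])
        obtain ⟨l, hl, rfl⟩ := hidx e (by simp [hLeq])
        obtain ⟨h1, h2, h3, h4, h5, h6⟩ := hc
        exact h6 (congrArg f (hfree i j k l hi hj hk hl h1 h2 h3 h4 fun e => h5 (congrArg f e)))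

end Counterexample

end Isolation

namespace Isolation

open Finset
open scoped Classical

/-! ### Cores with two pairs of twins -/

section Counterexample

theorem card_image_fin {V : Type*} {f : Fin 9 → V} (hf : Function.Injective f)
    (S : Finset (Fin 9)) : (image f S).card = S.card := card_image_of_injective _ hf

variable {V : Type*} [Fintype V] {G : SimpleGraph V} {f : Fin 9 → V}

/-- The vertices 1 and 2 of the core are attached to 0 and `a` only, 3 and 4 to 0 and `c` only. -/
structure TwoPairs (A : Fin 9 → Fin 9 → Prop) (a c : Fin 9) : Prop where
  le_a : 5 ≤ a
  le_c : 5 ≤ c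
  ne : a ≠ c
  one : ∀ j, A 1 j ↔ j = 0 ∨ j = a
  two : ∀ j, A 2 j ↔ j = 0 ∨ j = a
  three : ∀ j, A 3 j ↔ j = 0 ∨ j = c
  four : ∀ j, A 4 j ↔ j = 0 ∨ j = c

/-- Since `f p` dominates 0 and `a`, and 1 to 4 have core neighbours only among 0, `a` and `c`, the
cycle would have to fit into the three vertices of 5 to 8 other than `a`. -/
theorem TwoPairs.inner {a c : Fin 9} (h : TwoPairs (fun i j => G.Adj (f i) (f j)) a c)
    (hf : IsCore G f {1, 2, 3, 4}) {p : Fin 9} (hp : p = 1 ∨ p = 2) {k : Fin 9} (hk : 5 ≤ k) (hka : k ≠ a)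
    (hkc : k ≠ c) {x y z : V} (hC : IsC4 G (f k) x y z) (hx : ¬ Dom G {f p} x)
    (hy : ¬ Dom G {f p} y) (hz : ¬ Dom G {f p} z) : False := by
  have hp0 : G.Adj (f p) (f 0) := by
    rcases hp with rfl | rfl
    · exact (h.one 0).2 (Or.inl rfl)
    · exact (h.two 0).2 (Or.inl rfl)
  have hpa : G.Adj (f p) (f a) := by
    rcases hp with rfl | rfl
    · exact (h.one a).2 (Or.inr rfl)
    · exact (h.two a).2 (Or.inr rfl)
  have step : ∀ k : Fin 9, 5 ≤ k → k ≠ a → k ≠ c → ∀ x, G.Adj (f k) x → ¬ Dom G {f p} x →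
      ∃ j : Fin 9, x = f j ∧ 5 ≤ j ∧ j ≠ a := by
    intro k hk hka hkc x hkx hx
    obtain ⟨j, rfl⟩ := hf.out k (by simp; omega) x hkx
    have hx' := (not_dom_singleton hx).2
    have hk0 : k ≠ 0 := by omega
    refine ⟨j, rfl, ?_, fun e => hx' (e ▸ hpa)⟩
    by_contra hj
    have hj' : j = 0 ∨ j = 1 ∨ j = 2 ∨ j = 3 ∨ j = 4 := by omega
    rcases hj' with rfl | rfl | rfl | rfl | rfl
    · exact hx' hp0
    · exact ((h.one k).1 hkx.symm).elim hk0 hka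
    · exact ((h.two k).1 hkx.symm).elim hk0 hka
    · exact ((h.three k).1 hkx.symm).elim hk0 hkc
    · exact ((h.four k).1 hkx.symm).elim hk0 hkc
  obtain ⟨h1, h2, h3, h4, h5, h6⟩ := hC
  obtain ⟨j, rfl, hj, hja⟩ := step k hk hka hkc x h1 hx
  obtain ⟨l, rfl, hl, hla⟩ := step k hk hka hkc z h4.symm hz
  have hm : ∃ m : Fin 9, y = f m ∧ 5 ≤ m ∧ m ≠ a := by
    by_cases hjc : j = c
    · exact step l hl hla (fun e => h6 (by rw [hjc, e])) y h3.symm hy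
    · exact step j hj hja hjc y h2 hy
  obtain ⟨m, rfl, hm, hma⟩ := hm
  have e1 : k ≠ j := fun e => h1.ne (congrArg f e)
  have e2 : j ≠ m := fun e => h2.ne (congrArg f e)
  have e3 : m ≠ l := fun e => h3.ne (congrArg f e)
  have e4 : l ≠ k := fun e => h4.ne (congrArg f e)
  have e5 : k ≠ m := fun e => h5 (congrArg f e)
  have e6 : j ≠ l := fun e => h6 (congrArg f e)
  have := h.le_a
  omega

/-- If `f 2` has degree at most 3, choose `f 1` and keep 3, 4 and `c`, all dominated by `c`: at
least 6 = 5 + 1 vertices are deleted. Otherwise choose `f 2`, keep also 1, and delete the two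
outside neighbours of `f 2` as well: at least 7 = 5 + 2 vertices are deleted. -/
theorem MinCE.not_twoPairs (h : MinCE G) (hdeg : ∀ v, (univ.filter (G.Adj v)).card ≤ 4)
    (hf : IsCore G f {1, 2, 3, 4}) (a c : Fin 9) : ¬ TwoPairs (fun i j => G.Adj (f i) (f j)) a c := by
  intro hA
  have ha5 := hA.le_a
  have hc5 := hA.le_c
  have hac := hA.ne
  have hc3 : G.Adj (f c) (f 3) := ((hA.three c).2 (Or.inr rfl)).symm
  have hc4 : G.Adj (f c) (f 4) := ((hA.four c).2 (Or.inr rfl)).symm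
  by_cases hd : (univ.filter (G.Adj (f 2))).card ≤ 3
  · have hYcard : 6 ≤ (image f ({3, 4, c} : Finset (Fin 9))ᶜ).card := by
      rw [card_image_fin hf.inj, card_compl, Fintype.card_fin]
      have := card_le_three (a := (3 : Fin 9)) (b := 4) (c := c)
      omega
    refine h.false_of_dominated_rest (d := f 1) (C := image f univ)
      (Y := image f ({3, 4, c} : Finset (Fin 9))ᶜ) (R := image f {c})
      (fun L hL hLC _ => hf.good L (hL.of_disjoint (image_subset_image (subset_univ _)) hLC))
      ?_ ?_ ?_ ?_ ?_
    · intro x y z w hC hx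
      by_contra hcon
      push Not at hcon
      obtain ⟨nx, ny, nz, nw⟩ := hcon
      obtain ⟨i, hi, rfl⟩ := mem_image.1 hx
      simp only [mem_compl, mem_insert, mem_singleton, not_or] at hi
      have hi1 : i ≠ 1 := fun e => (not_dom_singleton nx).1 (congrArg f e)
      have hi1' := (hA.one i).not.1 (not_dom_singleton nx).2
      rw [not_or] at hi1'
      by_cases hi2 : i = 2
      · subst hi2
        -- The neighbours of `f 2` on the cycle are not dominated by `f 1`, hence differ from `f 0`
        -- and `f a`, and the degree would be 4.
        have hsub : ({f 0, f a, y, w} : Finset V) ⊆ univ.filter (G.Adj (f 2)) := by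
          intro u hu
          simp only [mem_insert, mem_singleton, mem_filter, mem_univ, true_and] at hu ⊢
          rcases hu with rfl | rfl | rfl | rfl
          · exact (hA.two 0).2 (Or.inl rfl)
          · exact (hA.two a).2 (Or.inr rfl)
          · exact hC.1
          · exact hC.2.2.2.1.symm
        have hdom : ∀ u, ¬ Dom G {f 1} u → u ≠ f 0 ∧ u ≠ f a := by
          intro u hu
          have := (not_dom_singleton hu).2
          exact ⟨fun e => this (e ▸ (hA.one 0).2 (Or.inl rfl)),
            fun e => this (e ▸ (hA.one a).2 (Or.inr rfl))⟩
        have h0a : f 0 ≠ f a := fun e => by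
          have := hf.inj e
          omega
        have hcard := card_le_card hsub
        rw [card_insert_of_notMem, card_insert_of_notMem, card_pair hC.2.2.2.2.2] at hcard
        · omega
        · simpa using ⟨(hdom y ny).2.symm, (hdom w nw).2.symm⟩
        · simpa using ⟨h0a, (hdom y ny).1.symm, (hdom w nw).1.symm⟩
      · exact hA.inner hf (Or.inl rfl) (by omega) hi1'.2 hi.2.2 hC ny nz nw
    · rw [disjoint_image hf.inj]
      simp
    · intro w hw hwY
      obtain ⟨i, -, rfl⟩ := mem_image.1 hw
      refine ⟨f c, by simp, ?_⟩
      have : i ∈ ({3, 4, c} : Finset (Fin 9)) := by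
        by_contra hi
        exact hwY (mem_image_of_mem f (mem_compl.2 hi))
      simp only [mem_insert, mem_singleton] at this
      rcases this with rfl | rfl | rfl
      · exact Or.inr hc3
      · exact Or.inr hc4
      · exact Or.inl rfl
    · omega
    · left
      simpa using hYcard
  · set Z := (univ.filter (G.Adj (f 2))).filter fun z => z ∉ image f univ with hZ
    have hZcard : Z.card = 2 := by
      have h1 : ((univ.filter (G.Adj (f 2))).filter fun z => z ∈ image f univ).card + Z.card =
          (univ.filter (G.Adj (f 2))).card := card_filter_add_card_filter_not _
      have h2 : (univ.filter (G.Adj (f 2))).filter (fun z => z ∈ image f univ) = {f 0, f a} := by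
        ext z
        simp only [mem_filter, mem_univ, true_and, mem_image, mem_insert, mem_singleton]
        constructor
        · rintro ⟨hz, j, rfl⟩
          exact ((hA.two j).1 hz).imp (congrArg f) (congrArg f)
        · rintro (rfl | rfl)
          · exact ⟨(hA.two 0).2 (Or.inl rfl), 0, rfl⟩
          · exact ⟨(hA.two a).2 (Or.inr rfl), a, rfl⟩
      have h3 : f 0 ≠ f a := fun e => by
        have := hf.inj e
        omega
      rw [h2, card_pair h3] at h1
      have h4 := hdeg (f 2)
      omega
    have hZadj : ∀ z ∈ Z, G.Adj (f 2) z := by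
      intro z hz
      simp only [hZ, mem_filter, mem_univ, true_and] at hz
      exact hz.1
    have hZC : Disjoint (image f univ) Z := by
      rw [disjoint_right]
      intro z hz
      exact (mem_filter.1 hz).2
    have hYcard : 7 ≤ (image f ({1, 3, 4, c} : Finset (Fin 9))ᶜ ∪ Z).card := by
      rw [card_union_of_disjoint (hZC.mono_left (image_subset_image (subset_univ _))), hZcard,
        card_image_fin hf.inj, card_compl, Fintype.card_fin]
      have := card_le_four (a := (1 : Fin 9)) (b := 3) (c := 4) (d := c)
      omega
    refine h.false_of_dominated_rest (d := f 2) (C := image f univ)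
      (Y := image f ({1, 3, 4, c} : Finset (Fin 9))ᶜ ∪ Z) (R := image f {1, c})
      ?_ ?_ ?_ ?_ (by omega) (Or.inl ?_)
    -- Such a component is attached to the two vertices of `Z` at most, and these are linked through
    -- `f 2`: too few for an exceptional component.
    · intro L hL hLC hLd hLE
      have hout : outer G L ⊆ Z := by
        intro z hz
        obtain ⟨hzL, l, hl, hlz⟩ := mem_outer.1 hz
        have hzY : z ∈ image f ({1, 3, 4, c} : Finset (Fin 9))ᶜ ∪ Z := by
          by_contra hzY
          exact hzL (hL.closed l hl z (mem_compl.2 hzY) hlz)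
        rcases mem_union.1 hzY with hz | hz
        · exfalso
          obtain ⟨i, hi, rfl⟩ := mem_image.1 hz
          simp only [mem_compl, mem_insert, mem_singleton, not_or] at hi
          have hi' : i ≠ 2 := by
            rintro rfl
            exact hLd l hl ⟨f 2, by simp, Or.inr hlz.symm⟩
          obtain ⟨j, rfl⟩ := hf.out i (by simp; omega) l hlz.symm
          exact disjoint_left.1 hLC hl (mem_image_of_mem f (mem_univ j))
        · exact hz
      have h2L : f 2 ∈ Lᶜ :=
        mem_compl.2 fun hl => disjoint_left.1 hLC hl (mem_image_of_mem f (mem_univ 2))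
      have hlink : ∀ z ∈ outer G L, Linked G Lᶜ (f 2) z := fun z hz =>
        Linked.of_adj h2L (mem_compl.2 (mem_outer.1 hz).1) (hZadj z (hout hz))
      have := h.three_le_card_outer hL.ne hL.conn hLE
        fun x hx y hy => (hlink x hx).symm.trans (hlink y hy)
      have := card_le_card hout
      omega
    · intro x y z w hC hx
      by_contra hcon
      push Not at hcon
      obtain ⟨nx, ny, nz, nw⟩ := hcon
      rcases mem_union.1 hx with hx | hx
      · obtain ⟨i, hi, rfl⟩ := mem_image.1 hx
        simp only [mem_compl, mem_insert, mem_singleton, not_or] at hi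
        have hi1 : i ≠ 2 := fun e => (not_dom_singleton nx).1 (congrArg f e)
        have hi1' := (hA.two i).not.1 (not_dom_singleton nx).2
        rw [not_or] at hi1'
        exact hA.inner hf (Or.inr rfl) (by omega) hi1'.2 hi.2.2.2 hC ny nz nw
      · exact (not_dom_singleton nx).2 (hZadj x hx)
    · rw [disjoint_union_right, disjoint_image hf.inj]
      refine ⟨?_, hZC.mono_left (image_subset_image (subset_univ _))⟩
      refine disjoint_compl_right.mono_left fun i => ?_
      simp only [mem_insert, mem_singleton]
      tauto
    · intro w hw hwY
      obtain ⟨i, -, rfl⟩ := mem_image.1 hw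
      have : i ∈ ({1, 3, 4, c} : Finset (Fin 9)) := by
        by_contra hi
        exact hwY (mem_union_left _ (mem_image_of_mem f (mem_compl.2 hi)))
      simp only [mem_insert, mem_singleton] at this
      rcases this with rfl | rfl | rfl | rfl
      · exact ⟨f 1, by simp, Or.inl rfl⟩
      · exact ⟨f c, by simp, Or.inr hc3⟩
      · exact ⟨f c, by simp, Or.inr hc4⟩
      · exact ⟨f i, by simp, Or.inl rfl⟩
    · have := card_le_two (a := (1 : Fin 9)) (b := c)
      rw [card_image_fin hf.inj]
      omega

end Counterexample

end Isolation

namespace Isolation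

open Finset

/-! ### The exhaustive search over cores -/

section Search

/-- The bits of the matrix entries `(i, j)` and `(j, i)`. -/
def edgeBits (i j : ℕ) : ℕ := 1 <<< (9 * i + j) ||| 1 <<< (9 * j + i)

/-- Decide the pairs in a list one by one. `K` records the pairs known to be adjacent and `M` those
not known to be nonadjacent. Every branch has to end with `prune`, or with `leaf` if all the pairs
are decided. -/
def search (prune leaf : ℕ → ℕ → Bool) : List (ℕ × ℕ) → ℕ → ℕ → Bool
  | [], K, M => prune K M || leaf K M
  | (i, j) :: l, K, M => prune K M ||
      (search prune leaf l K (M &&& ((2 ^ 81 - 1) ^^^ edgeBits i j)) &&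
        search prune leaf l (K ||| edgeBits i j) M)

def commonsOf (M R i j : ℕ) : ℕ :=
  bif bit R i && bit R j then Nat.land (Nat.land (row M i) (row M j)) R else 0

/-- The common neighbours in `R` of the pairs among the vertices 1, 2, 3, 4 of `R`. -/
def commons (M R : ℕ) : ℕ :=
  Nat.lor (Nat.lor (Nat.lor (commonsOf M R 1 2) (commonsOf M R 1 3))
    (Nat.lor (commonsOf M R 1 4) (commonsOf M R 2 3)))
    (Nat.lor (commonsOf M R 2 4) (commonsOf M R 3 4))

/-- `d` reduces every core between `K` and `M`. -/
def reducesB (K M d : ℕ) : Bool :=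
  c4free M (away K d) &&
    let T := Nat.lor (Nat.land 30 (away K d)) (commons M (away K d))
    Nat.ble (popc T) 2 || Nat.ble (popc T) 4 && anyNine fun r =>
      bit T r && !bit (row M d) r && Nat.beq (Nat.land T (away K r)) 0

/-- For this test as for `linksB` and `orderB`, the value `true` signals a contradiction and closes
the branch. -/
def degreeB (Δ K : ℕ) : Bool := anyNine fun i => !Nat.ble (popc (row K i)) Δ

def linkB (M i : ℕ) : Bool := !Nat.beq (Nat.shiftRight (row M i) 5) 0

/-- By `MinCE.three_le_card_outer`, at least three of the vertices 1 to 4 have neighbours among 5 to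
8; here even the undecided pairs do not provide them. -/
def linksB (M : ℕ) : Bool :=
  !Nat.ble 3 ((linkB M 1).toNat + (linkB M 2).toNat + (linkB M 3).toNat + (linkB M 4).toNat)

/-- Symmetry breaking: in `search4` the vertices 1 to 4 may be sorted by their adjacencies to 5, 6,
7, 8, read as binary numbers. -/
def orderB (K M i : ℕ) : Bool :=
  !Nat.ble (Nat.shiftRight (row K i) 5) (Nat.shiftRight (row M (i + 1)) 5)

/-- The vertices of `A` that the vertex `n` of `N` may be mapped to, if the previous ones are mapped
to the entries of a list, the last one first. -/
def candidates (N A n : ℕ) : List ℕ → ℕ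
  | [] => 511
  | h :: l => Nat.land (bif bit N (9 * n + l.length) then row A h else away A h)
      (candidates N A n l)

/-- Map `n` more vertices of `N` to vertices of `A`. -/
def embeds (N A : ℕ) : ℕ → List ℕ → Bool
  | 0, _ => true
  | n + 1, l => let c := candidates N A l.length l
    anyNine fun h => bit c h && embeds N A n (h :: l)

/-- The number of set bits of `x`, if `x` is less than `2 ^ 81`. -/
def bitCount (x : ℕ) : ℕ :=
  -- The masks repeat the bit patterns 01, 0011 and 00001111. Bits are added in groups of 2, 4 and
  -- 8, and reduction modulo 255 adds up the bytes.
  let y := Nat.sub x (Nat.land (Nat.shiftRight x 1) 1611901092819505566274901)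
  let z := Nat.add (Nat.land y 3868562622766813359059763) (Nat.land (Nat.shiftRight y 2) 3868562622766813359059763)
  Nat.mod (Nat.land (Nat.add z (Nat.shiftRight z 4)) 18205000577726180513222415) 255

def twoPairsB (K : ℕ) : Bool :=
  anyNine fun a => anyNine fun c =>
    Nat.ble 5 a && Nat.ble 5 c && !Nat.beq a c &&
      Nat.beq (row K 1) (1 ||| 1 <<< a) && Nat.beq (row K 2) (1 ||| 1 <<< a) &&
      Nat.beq (row K 3) (1 ||| 1 <<< c) && Nat.beq (row K 4) (1 ||| 1 <<< c)

/-- The matrix of a list of edges. -/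
def matrixOf (l : List (ℕ × ℕ)) : ℕ := l.foldl (fun acc p => acc ||| edgeBits p.1 p.2) 0

/-- The core at a vertex 0 of degree 4. The pairs of 0 with 5 to 8 are absent from `pairs4` as well,
so they are nonadjacent. -/
def edges4 : List (ℕ × ℕ) := [(0, 1), (0, 2), (0, 3), (0, 4), (5, 6), (6, 7), (7, 8), (8, 5)]

def pairs4 : List (ℕ × ℕ) :=
  [(1, 8), (2, 8), (3, 8), (4, 8), (1, 7), (2, 7), (3, 7), (4, 7),
   (1, 6), (2, 6), (3, 6), (4, 6), (1, 5), (2, 5), (3, 5), (4, 5),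
   (1, 2), (3, 4), (1, 3), (2, 4), (1, 4), (2, 3), (5, 7), (6, 8)]

/-- The core for maximum degree 3: a 4-cycle 0, 1, 2, 3, a third neighbour 4 of 0, and the cycle 5,
6, 7, 8. As 0 has no further neighbours, `pairs3` omits the pair of 0 and 2 too. -/
def edges3 : List (ℕ × ℕ) :=
  [(0, 1), (0, 3), (0, 4), (1, 2), (2, 3), (5, 6), (6, 7), (7, 8), (8, 5)]

def pairs3 : List (ℕ × ℕ) :=
  [(1, 5), (2, 5), (3, 5), (4, 5), (1, 6), (2, 6), (3, 6), (4, 6),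
   (1, 7), (2, 7), (3, 7), (4, 7), (1, 8), (2, 8), (3, 8), (4, 8),
   (1, 3), (1, 4), (2, 4), (3, 4), (5, 7), (6, 8)]

/-- The matrix of the cycle 5, 6, 7, 8 and the vertex 0 joined to the vertices 1 to 4, each of which
is joined to the ends of an edge of the cycle, a different one for each. -/
def squareMatrix : ℕ :=
  matrixOf (edges4 ++ [(1, 5), (1, 6), (2, 6), (2, 7), (3, 5), (3, 8), (4, 7), (4, 8)])

/-- Comparing the numbers of bits only saves time; soundness rests on the embedding alone. -/
def leafB (K M : ℕ) : Bool :=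
  Nat.beq K M && (twoPairsB K || Nat.beq K squareMatrix || nineMasks.reverse.any fun N =>
    Nat.beq (bitCount N) (bitCount K) && embeds N K 9 [])

def prune4 (K M : ℕ) : Bool :=
  degreeB 4 K || orderB K M 1 || orderB K M 2 || orderB K M 3 || linksB M ||
    anyNine fun d => reducesB K M d

def prune3 (K M : ℕ) : Bool :=
  degreeB 3 K || linksB M || anyNine fun d => reducesB K M d

theorem search4 : search prune4 leafB pairs4 (matrixOf edges4)
    (matrixOf (edges4 ++ pairs4)) = true := by
  decide +kernel

/-- With maximum degree 3 no special cores survive, so no leaf has to be accepted. -/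
theorem search3 : search prune3 (fun _ _ => false) pairs3 (matrixOf edges3)
    (matrixOf (edges3 ++ pairs3)) = true := by
  decide +kernel

end Search

end Isolation

namespace Isolation

open Finset
open scoped Classical

/-! ### Soundness of the search -/

section Between

variable {A : Fin 9 → Fin 9 → Prop} {K M : ℕ}

/-- The relation `A` lies between the relations recorded in `K` and in `M`. -/
structure Between (A : Fin 9 → Fin 9 → Prop) (K M : ℕ) : Prop where
  lower : ∀ i j : Fin 9, K.testBit (9 * i + j) = true → A i j
  upper : ∀ i j : Fin 9, A i j → M.testBit (9 * i + j) = true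

theorem testBit_edgeBits {i j n : ℕ} :
    (edgeBits i j).testBit n = true ↔ n = 9 * i + j ∨ n = 9 * j + i := by
  rw [edgeBits, Nat.testBit_or, Nat.one_shiftLeft, Nat.one_shiftLeft, Nat.testBit_two_pow,
    Nat.testBit_two_pow, Bool.or_eq_true, decide_eq_true_eq, decide_eq_true_eq]
  exact ⟨Or.imp Eq.symm Eq.symm, Or.imp Eq.symm Eq.symm⟩

theorem fin_nine_index {a b i j : ℕ} (hb : b < 9) (hj : j < 9) (h : 9 * a + b = 9 * i + j) :
    a = i ∧ b = j := by
  omega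

/-- Following the branches that agree with `A` keeps `A` between the two matrices until the search
stops. -/
theorem search_sound (hA : ∀ i j, A i j → A j i) {prune leaf : ℕ → ℕ → Bool}
    {l : List (ℕ × ℕ)} (hl : ∀ p ∈ l, p.1 < 9 ∧ p.2 < 9) (h : Between A K M)
    (hs : search prune leaf l K M = true) :
    ∃ K' M', Between A K' M' ∧ (prune K' M' = true ∨ leaf K' M' = true) := by
  induction l generalizing K M with
  | nil =>
    rw [search, Bool.or_eq_true] at hs
    exact ⟨K, M, h, hs⟩
  | cons p l ih =>
    obtain ⟨i, j⟩ := p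
    rw [search, Bool.or_eq_true, Bool.and_eq_true] at hs
    have hl' := fun p hp => hl p (List.mem_cons_of_mem _ hp)
    obtain ⟨hi, hj⟩ := hl (i, j) (by simp)
    rcases hs with hs | ⟨h0, h1⟩
    · exact ⟨K, M, h, Or.inl hs⟩
    by_cases hij : A ⟨i, hi⟩ ⟨j, hj⟩
    · refine ih hl' ⟨fun a b hab => ?_, h.upper⟩ h1
      rw [Nat.testBit_or, Bool.or_eq_true, testBit_edgeBits] at hab
      rcases hab with hab | hab | hab
      · exact h.lower a b hab
      · obtain ⟨ha, hb⟩ := fin_nine_index b.2 hj hab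
        rw [show a = ⟨i, hi⟩ from Fin.ext ha, show b = ⟨j, hj⟩ from Fin.ext hb]
        exact hij
      · obtain ⟨ha, hb⟩ := fin_nine_index b.2 hi hab
        rw [show a = ⟨j, hj⟩ from Fin.ext ha, show b = ⟨i, hi⟩ from Fin.ext hb]
        exact hA _ _ hij
    · refine ih hl' ⟨h.lower, fun a b hab => ?_⟩ h0
      rw [Nat.testBit_and, h.upper a b hab, Bool.true_and, Nat.testBit_xor,
        Nat.testBit_two_pow_sub_one]
      have h81 : 9 * a.1 + b.1 < 81 := by omega
      rw [decide_eq_true h81, Bool.true_xor, Bool.not_eq_true', ← Bool.not_eq_true,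
        testBit_edgeBits]
      rintro (he | he)
      · obtain ⟨ha, hb⟩ := fin_nine_index b.2 hj he
        rw [show a = ⟨i, hi⟩ from Fin.ext ha, show b = ⟨j, hj⟩ from Fin.ext hb] at hab
        exact hij hab
      · obtain ⟨ha, hb⟩ := fin_nine_index b.2 hi he
        rw [show a = ⟨j, hj⟩ from Fin.ext ha, show b = ⟨i, hi⟩ from Fin.ext hb] at hab
        exact hij (hA _ _ hab)

theorem Between.away (h : Between A K M) {d i : Fin 9} (hi : i ≠ d) (hdi : ¬ A d i) :
    (away K d).testBit i = true := by
  rw [testBit_away d.2]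
  refine ⟨i.2, fun e => hi (Fin.ext e), ?_⟩
  rw [← Bool.not_eq_true]
  exact fun hK => hdi (h.lower d i hK)

theorem testBit_commonsOf {R i j r : ℕ} (hi : R.testBit i = true) (hj : R.testBit j = true)
    (hr : R.testBit r = true) (hr9 : r < 9) (hir : M.testBit (9 * i + r) = true)
    (hjr : M.testBit (9 * j + r) = true) : (commonsOf M R i j).testBit r = true := by
  rw [commonsOf, bit_eq, bit_eq, hi, hj]
  change (row M i &&& row M j &&& R).testBit r = true
  simp [testBit_row hr9, hir, hjr, hr]

theorem testBit_commons {R r : ℕ} {i j : Fin 9} (hi : i ∈ ({1, 2, 3, 4} : Finset (Fin 9)))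
    (hj : j ∈ ({1, 2, 3, 4} : Finset (Fin 9))) (hij : i ≠ j) (hRi : R.testBit i = true)
    (hRj : R.testBit j = true) (hr : R.testBit r = true) (hr9 : r < 9)
    (hir : M.testBit (9 * i + r) = true) (hjr : M.testBit (9 * j + r) = true) :
    (commons M R).testBit r = true := by
  change (((commonsOf M R 1 2 ||| commonsOf M R 1 3) ||| (commonsOf M R 1 4 ||| commonsOf M R 2 3)) |||
    (commonsOf M R 2 4 ||| commonsOf M R 3 4)).testBit r = true
  have h1 := testBit_commonsOf hRi hRj hr hr9 hir hjr
  have h2 := testBit_commonsOf hRj hRi hr hr9 hjr hir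
  simp only [Nat.testBit_or, Bool.or_eq_true]
  simp only [mem_insert, mem_singleton] at hi hj
  rcases hi with rfl | rfl | rfl | rfl <;> rcases hj with rfl | rfl | rfl | rfl <;>
    first
    | exact absurd rfl hij
    | (change (commonsOf M R 1 2).testBit r = true at h1; simp [h1])
    | (change (commonsOf M R 1 3).testBit r = true at h1; simp [h1])
    | (change (commonsOf M R 1 4).testBit r = true at h1; simp [h1])
    | (change (commonsOf M R 2 3).testBit r = true at h1; simp [h1])
    | (change (commonsOf M R 2 4).testBit r = true at h1; simp [h1])
    | (change (commonsOf M R 3 4).testBit r = true at h1; simp [h1])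
    | (change (commonsOf M R 1 2).testBit r = true at h2; simp [h2])
    | (change (commonsOf M R 1 3).testBit r = true at h2; simp [h2])
    | (change (commonsOf M R 1 4).testBit r = true at h2; simp [h2])
    | (change (commonsOf M R 2 3).testBit r = true at h2; simp [h2])
    | (change (commonsOf M R 2 4).testBit r = true at h2; simp [h2])
    | (change (commonsOf M R 3 4).testBit r = true at h2; simp [h2])

/-- The test assumes the worst case: domination is read from `K`, possible 4-cycles and common
neighbours from `M`. Its set may contain vertices that `d` does dominate in `A`; the filter removes
them. -/
theorem Between.exists_reduces (h : Between A K M) (hA : ∀ i j, A i j → A j i) {d : ℕ}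
    (hd : d < 9) (hr : reducesB K M d = true) : ∃ d T, Reduces {1, 2, 3, 4} A d T := by
  obtain ⟨d, rfl⟩ : ∃ e : Fin 9, e.1 = d := ⟨⟨d, hd⟩, rfl⟩
  rw [reducesB, Bool.and_eq_true] at hr
  obtain ⟨hfree, hsmall⟩ := hr
  set T₀ := Nat.lor (Nat.land 30 (Isolation.away K d)) (commons M (Isolation.away K d)) with hT₀
  have hmem : ∀ i : Fin 9, T₀.testBit i = true ↔
      ((30).testBit i = true ∧ (Isolation.away K d).testBit i = true) ∨
        (commons M (Isolation.away K d)).testBit i = true := by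
    intro i
    change (30 &&& Isolation.away K d ||| commons M (Isolation.away K d)).testBit i = true ↔ _
    rw [Nat.testBit_or, Nat.testBit_and, Bool.or_eq_true, Bool.and_eq_true]
  refine ⟨d, univ.filter fun i => T₀.testBit i = true ∧ i ≠ d ∧ ¬ A d i,
    fun i hi => (mem_filter.1 hi).2.2, ?_, ?_, ?_, ?_⟩
  · intro i j k l hi hj hk hl h1 h2 h3 h4 h5
    by_contra h6
    exact c4free_sound hfree i.2 j.2 k.2 l.2 (h.away hi.1 hi.2) (h.away hj.1 hj.2)
      (h.away hk.1 hk.2) (h.away hl.1 hl.2) (h.upper _ _ h1) (h.upper _ _ (hA _ _ h4))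
      (h.upper _ _ (hA _ _ h2)) (h.upper _ _ h3) (fun e => h5 (Fin.ext e))
      (fun e => h6 (Fin.ext e))
  · intro i hi hdi
    refine mem_filter.2 ⟨mem_univ _, (hmem i).2 (Or.inl ⟨?_, h.away hdi.1 hdi.2⟩), hdi⟩
    simp only [mem_insert, mem_singleton] at hi
    rcases hi with rfl | rfl | rfl | rfl <;> decide
  · intro i hi j hj hij hdi hdj r hdr hri hrj
    exact mem_filter.2 ⟨mem_univ _, (hmem r).2 (Or.inr (testBit_commons hi hj hij
      (h.away hdi.1 hdi.2) (h.away hdj.1 hdj.2) (h.away hdr.1 hdr.2) r.2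
      (h.upper _ _ (hA _ _ hri)) (h.upper _ _ (hA _ _ hrj)))), hdr⟩
  · have hle : (univ.filter fun i : Fin 9 => T₀.testBit i = true ∧ i ≠ d ∧ ¬ A d i).card ≤ popc T₀ := by
      rw [popc_eq_card]
      exact card_le_card (monotone_filter_right _ fun i _ hi => hi.1)
    rw [Bool.or_eq_true, Bool.and_eq_true, anyNine_iff] at hsmall
    rcases hsmall with hs | ⟨hs, r, hr9, hr⟩
    · exact Or.inl (hle.trans (Nat.le_of_ble_eq_true hs))
    · obtain ⟨r, rfl⟩ : ∃ e : Fin 9, e.1 = r := ⟨⟨r, hr9⟩, rfl⟩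
      simp only [Bool.and_eq_true, Bool.not_eq_true', bit_eq, testBit_row r.2, Nat.beq_eq] at hr
      obtain ⟨⟨hrT, hdr⟩, hz⟩ := hr
      have hndr : ¬ A d r := fun hadj => by simp [h.upper _ _ hadj] at hdr
      have hrd : r ≠ d := by
        rintro rfl
        have : (Isolation.away K r).testBit r = true := by
          rcases (hmem r).1 hrT with h | h
          · exact h.2
          · by_contra hcon
            rw [Bool.not_eq_true] at hcon
            have : ∀ i j, (commonsOf M (Isolation.away K r) i j).testBit r = false := by
              intro i j
              rw [commonsOf]
              cases bit (Isolation.away K r) i && bit (Isolation.away K r) j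
              · simp
              · change (_ &&& Isolation.away K r).testBit r = false
                rw [Nat.testBit_and, hcon, Bool.and_false]
            change (((commonsOf M _ 1 2 ||| commonsOf M _ 1 3) |||
              (commonsOf M _ 1 4 ||| commonsOf M _ 2 3)) |||
              (commonsOf M _ 2 4 ||| commonsOf M _ 3 4)).testBit r = true at h
            simp only [Nat.testBit_or, this] at h
            simp at h
        rw [testBit_away r.2] at this
        exact this.2.1 rfl
      refine Or.inr ⟨hle.trans (Nat.le_of_ble_eq_true hs), r,
        mem_filter.2 ⟨mem_univ _, hrT, hrd, hndr⟩, fun t ht => ?_⟩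
      by_contra hcon
      rw [not_or] at hcon
      have h1 := h.away hcon.1 hcon.2
      have h2 := (mem_filter.1 ht).2.1
      have h3 : (T₀ &&& Isolation.away K r).testBit t = true := by
        rw [Nat.testBit_and, h1, h2]
        rfl
      change T₀ &&& Isolation.away K r = 0 at hz
      simp [hz] at h3

theorem Between.degreeB_eq_false (h : Between A K M) {Δ : ℕ}
    (hΔ : ∀ i, (univ.filter (A i)).card ≤ Δ) : degreeB Δ K = false := by
  rw [← Bool.not_eq_true, degreeB, anyNine_iff]
  rintro ⟨i, hi, hb⟩
  rw [Bool.not_eq_true', ← Bool.not_eq_true] at hb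
  refine hb (Nat.ble_eq_true_of_le (le_trans ?_ (hΔ ⟨i, hi⟩)))
  rw [popc_eq_card]
  refine card_le_card (monotone_filter_right _ fun j _ hj => ?_)
  rw [testBit_row j.2] at hj
  exact h.lower ⟨i, hi⟩ j hj

theorem Between.linkB (h : Between A K M) {i j : Fin 9} (hj : 5 ≤ j) (hij : A i j) :
    linkB M i = true := by
  rw [Isolation.linkB, Bool.not_eq_true', ← Bool.not_eq_true, Nat.beq_eq]
  intro h0
  change row M i >>> 5 = 0 at h0
  have h1 : (row M i >>> 5).testBit (j - 5) = true := by
    rw [Nat.testBit_shiftRight, show 5 + (j.1 - 5) = j by omega, testBit_row j.2]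
    exact h.upper i j hij
  simp [h0] at h1

theorem Between.linksB_eq_false (h : Between A K M)
    (h3 : 3 ≤ (({1, 2, 3, 4} : Finset (Fin 9)).filter fun i => ∃ j, 5 ≤ j ∧ A i j).card) :
    linksB M = false := by
  rw [linksB, Bool.not_eq_false']
  refine Nat.ble_eq_true_of_le (h3.trans ?_)
  have key : ∀ i : Fin 9, (if ∃ j, 5 ≤ j ∧ A i j then 1 else 0) ≤ (Isolation.linkB M i).toNat := by
    intro i
    split_ifs with hi
    · obtain ⟨j, hj, hij⟩ := hi
      simp [h.linkB hj hij]
    · simp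
  rw [card_filter, sum_insert (by decide), sum_insert (by decide), sum_insert (by decide),
    sum_singleton]
  have h1 := key 1
  have h2 := key 2
  have h3 := key 3
  have h4 := key 4
  change _ ≤ (Isolation.linkB M 1).toNat at h1
  change _ ≤ (Isolation.linkB M 2).toNat at h2
  change _ ≤ (Isolation.linkB M 3).toNat at h3
  change _ ≤ (Isolation.linkB M 4).toNat at h4
  omega

/-- The number whose bits are the adjacencies of `i` to 5, 6, 7, 8. -/
noncomputable def linkCode (A : Fin 9 → Fin 9 → Prop) (i : Fin 9) : ℕ :=
  Nat.ofBits fun j : Fin 4 => decide (A i (Fin.natAdd 5 j))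

theorem le_of_testBit_imp {x y : ℕ} (h : ∀ i, x.testBit i = true → y.testBit i = true) : x ≤ y := by
  have : x &&& y = x := by
    refine Nat.eq_of_testBit_eq fun i => ?_
    rw [Nat.testBit_and]
    cases hx : x.testBit i
    · rfl
    · rw [h i hx]; rfl
  rw [← this]
  exact Nat.and_le_right

theorem testBit_linkCode {i : Fin 9} {j : ℕ} :
    (linkCode A i).testBit j = true ↔ ∃ h : 5 + j < 9, A i ⟨5 + j, h⟩ := by
  by_cases hj : j < 4
  · rw [linkCode, Nat.testBit_ofBits_lt _ _ hj, decide_eq_true_eq]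
    exact ⟨fun h => ⟨by omega, h⟩, fun ⟨_, h⟩ => h⟩
  · rw [linkCode, Nat.testBit_ofBits_ge _ _ (by omega)]
    simp
    intro h
    omega

theorem Between.orderB_eq_false (h : Between A K M) {i : ℕ} (hi : i + 1 < 9)
    (hle : linkCode A ⟨i, by omega⟩ ≤ linkCode A ⟨i + 1, hi⟩) : orderB K M i = false := by
  rw [orderB, Bool.not_eq_false']
  refine Nat.ble_eq_true_of_le (le_trans ?_ (hle.trans ?_))
  · refine le_of_testBit_imp fun j hj => ?_
    change (row K i >>> 5).testBit j = true at hj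
    rw [Nat.testBit_shiftRight] at hj
    have h9 := lt_nine_of_testBit_row hj
    rw [testBit_row h9] at hj
    exact testBit_linkCode.2 ⟨h9, h.lower ⟨i, by omega⟩ ⟨5 + j, h9⟩ hj⟩
  · refine le_of_testBit_imp fun j hj => ?_
    change (row M (i + 1) >>> 5).testBit j = true
    obtain ⟨h9, hj⟩ := testBit_linkCode.1 hj
    rw [Nat.testBit_shiftRight, testBit_row h9]
    exact h.upper ⟨i + 1, hi⟩ ⟨5 + j, h9⟩ hj

theorem Between.exists_twoPairs (h : Between A K K) (hK : twoPairsB K = true) :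
    ∃ a c, TwoPairs A a c := by
  rw [twoPairsB, anyNine_iff] at hK
  obtain ⟨a, ha, hK⟩ := hK
  rw [anyNine_iff] at hK
  obtain ⟨c, hc, hK⟩ := hK
  simp only [Bool.and_eq_true, Bool.not_eq_true', Nat.beq_eq] at hK
  obtain ⟨⟨⟨⟨⟨⟨ha5, hc5⟩, hac⟩, h1⟩, h2⟩, h3⟩, h4⟩ := hK
  have key : ∀ (i a : ℕ) (hi : i < 9) (ha : a < 9), row K i = (1 ||| 1 <<< a) → ∀ j : Fin 9,
      A ⟨i, hi⟩ j ↔ j = 0 ∨ j = ⟨a, ha⟩ := by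
    intro i a hi ha hrow j
    have hb : K.testBit (9 * i + j) = true ↔ j.1 = 0 ∨ j.1 = a := by
      rw [← testBit_row j.2, hrow, Nat.testBit_or, Nat.one_shiftLeft, Nat.testBit_two_pow,
        show (1 : ℕ) = 2 ^ 0 from rfl, Nat.testBit_two_pow, Bool.or_eq_true,
        decide_eq_true_eq, decide_eq_true_eq]
      exact ⟨Or.imp Eq.symm Eq.symm, Or.imp Eq.symm Eq.symm⟩
    rw [Fin.ext_iff, Fin.ext_iff]
    exact ⟨fun hA => hb.1 (h.upper ⟨i, hi⟩ j hA), fun hA => h.lower ⟨i, hi⟩ j (hb.2 hA)⟩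
  refine ⟨⟨a, ha⟩, ⟨c, hc⟩, Nat.le_of_ble_eq_true ha5, Nat.le_of_ble_eq_true hc5, ?_,
    key 1 a _ _ h1, key 2 a _ _ h2, key 3 c _ _ h3, key 4 c _ _ h4⟩
  rintro e
  rw [Fin.mk.injEq] at e
  subst e
  simp at hac

end Between

/-! ### Soundness of the embedding test -/

section Embeddings

variable {N A n h : ℕ}

/-- The `m`-th entry of a list, counted from the end. -/
def entry (l : List ℕ) (m : ℕ) : ℕ := l.reverse.getD m 0

theorem entry_cons_of_lt {l : List ℕ} {m : ℕ} (hm : m < l.length) :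
    entry (h :: l) m = entry l m := by
  rw [entry, entry, List.reverse_cons, List.getD_append _ _ _ _ (by simpa using hm)]

theorem entry_cons_length {l : List ℕ} : entry (h :: l) l.length = h := by
  rw [entry, List.reverse_cons, List.getD_append_right _ _ _ _ (by simp)]
  simp

theorem testBit_candidates {l : List ℕ} (hh : (candidates N A n l).testBit h = true) :
    h < 9 ∧ ∀ m < l.length, (N.testBit (9 * n + m) = true ∧ (row A (entry l m)).testBit h = true) ∨
      (N.testBit (9 * n + m) = false ∧ (away A (entry l m)).testBit h = true) := by
  induction l with
  | nil =>
    change (2 ^ 9 - 1).testBit h = true at hh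
    rw [Nat.testBit_two_pow_sub_one] at hh
    exact ⟨by simpa using hh, by simp⟩
  | cons g l ih =>
    change ((bif bit N (9 * n + l.length) then row A g else away A g) &&&
      candidates N A n l).testBit h = true at hh
    rw [Nat.testBit_and, Bool.and_eq_true, bit_eq] at hh
    obtain ⟨h9, ih⟩ := ih hh.2
    refine ⟨h9, fun m hm => ?_⟩
    rcases Nat.lt_or_eq_of_le (Nat.le_of_lt_succ hm) with hm | rfl
    · rw [entry_cons_of_lt hm]
      exact ih m hm
    · rw [entry_cons_length]
      have := hh.1
      cases hN : N.testBit (9 * n + l.length) <;> rw [hN] at this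
      · exact Or.inr ⟨rfl, this⟩
      · exact Or.inl ⟨rfl, this⟩

/-- Every entry of the list is among the candidates given by the previous ones. -/
def Fits (N A : ℕ) : List ℕ → Prop
  | [] => True
  | h :: l => (candidates N A l.length l).testBit h = true ∧ Fits N A l

theorem exists_fits {l : List ℕ} (hl : Fits N A l) (he : embeds N A n l = true) :
    ∃ l', Fits N A l' ∧ l'.length = l.length + n := by
  induction n generalizing l with
  | zero => exact ⟨l, hl, rfl⟩
  | succ n ih =>
    simp only [embeds, anyNine_iff, Bool.and_eq_true, bit_eq] at he
    obtain ⟨h, -, hh, he⟩ := he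
    obtain ⟨l', hl', hlen⟩ := ih (l := h :: l) ⟨hh, hl⟩ he
    refine ⟨l', hl', ?_⟩
    rw [hlen, List.length_cons]
    omega

theorem Fits.entry {l : List ℕ} (hl : Fits N A l) {j : ℕ} (hj : j < l.length) :
    entry l j < 9 ∧ ∀ m < j,
      (N.testBit (9 * j + m) = true ∧ (row A (entry l m)).testBit (entry l j) = true) ∨
      (N.testBit (9 * j + m) = false ∧ (away A (entry l m)).testBit (entry l j) = true) := by
  induction l with
  | nil => simp at hj
  | cons g l ih =>
    rcases Nat.lt_or_eq_of_le (Nat.le_of_lt_succ hj) with hj | rfl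
    · rw [entry_cons_of_lt hj]
      refine ⟨(ih hl.2 hj).1, fun m hm => ?_⟩
      rw [entry_cons_of_lt (hm.trans hj)]
      exact (ih hl.2 hj).2 m hm
    · rw [entry_cons_length]
      refine ⟨(testBit_candidates hl.1).1, fun m hm => ?_⟩
      rw [entry_cons_of_lt hm]
      exact (testBit_candidates hl.1).2 m hm

/-- Each entry is chosen to match adjacency and nonadjacency to all previous ones, and both `row`
and `away` exclude a repeated entry. -/
theorem exists_embedding {A : Fin 9 → Fin 9 → Prop} {K : ℕ} (hK : Between A K K)
    (hA : ∀ i j, A i j → A j i) (hirr : ∀ i, ¬ A i i) {B : Fin 9 → Fin 9 → Prop}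
    (hN : Between B N N) (hB : ∀ i j, B i j → B j i) (hBirr : ∀ i, ¬ B i i)
    (he : embeds N K 9 [] = true) :
    ∃ σ : Fin 9 → Fin 9, Function.Injective σ ∧ ∀ i j, B i j ↔ A (σ i) (σ j) := by
  obtain ⟨l, hl, hlen⟩ := exists_fits (l := []) trivial he
  have hlen : l.length = 9 := hlen
  have hlt : ∀ i : Fin 9, entry l i < 9 := fun i => (hl.entry (by omega)).1
  set σ : Fin 9 → Fin 9 := fun i => ⟨entry l i, hlt i⟩ with hσ
  have key : ∀ i j : Fin 9, i < j → σ i ≠ σ j ∧ (B i j ↔ A (σ i) (σ j)) := by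
    intro i j hij
    rcases (hl.entry (j := j) (by omega)).2 i hij with ⟨h1, h2⟩ | ⟨h1, h2⟩
    · rw [testBit_row (hlt j)] at h2
      have hadj := hK.lower (σ i) (σ j) h2
      exact ⟨fun e => hirr (σ j) (e ▸ hadj), fun _ => hadj, fun _ => hB _ _ (hN.lower j i h1)⟩
    · rw [testBit_away (hlt i)] at h2
      refine ⟨fun e => h2.2.1 (congrArg Fin.val e).symm, fun hb => ?_, fun ha => ?_⟩
      · simp [hN.upper _ _ (hB _ _ hb)] at h1
      · have := hK.upper _ _ ha
        simp [hσ, h2.2.2] at this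
  refine ⟨σ, fun i j hij => ?_, fun i j => ?_⟩
  · rcases lt_trichotomy i j with h | h | h
    · exact absurd hij (key i j h).1
    · exact h
    · exact absurd hij.symm (key j i h).1
  · rcases lt_trichotomy i j with h | rfl | h
    · exact (key i j h).2
    · exact ⟨fun h => absurd h (hBirr i), fun h => absurd h (hirr _)⟩
    · exact ⟨fun hb => hA _ _ ((key j i h).2.1 (hB _ _ hb)),
        fun ha => hB _ _ ((key j i h).2.2 (hA _ _ ha))⟩

end Embeddings

end Isolation

namespace Isolation

open Finset
open scoped Classical

/-! ### The core given by `squareMatrix` -/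

section Square

variable {V : Type*} [Fintype V] {G : SimpleGraph V} {f : Fin 9 → V}

theorem reduces_squareMatrix :
    Reduces {2, 3, 4} (fun i j => squareMatrix.testBit (9 * i + j) = true) 4 {2, 3} :=
  ⟨by decide +kernel, by decide +kernel, by decide +kernel, by decide +kernel, by decide⟩

theorem squareMatrix_one : ∀ j : Fin 9, squareMatrix.testBit (9 * 1 + j) = true ↔
    j = 0 ∨ j = 5 ∨ j = 6 := by
  decide +kernel

/-- If `f 1` has a neighbour `z` outside the core, delete `z`, 0, 1, 5, 6, all dominated by `f 1`.
The other five core vertices lie in one component, too large for four vertices, and an unhit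
component elsewhere is attached at `z` only. If there is no such `z`, only 2, 3 and 4 have outside
neighbours, and 4 reduces the core. -/
theorem MinCE.not_square (h : MinCE G) (hdeg : ∀ v, (univ.filter (G.Adj v)).card ≤ 4)
    (hf : IsCore G f {1, 2, 3, 4})
    (hA : ∀ i j : Fin 9, G.Adj (f i) (f j) ↔ squareMatrix.testBit (9 * i + j) = true) : False := by
  have h1 : ∀ j, G.Adj (f 1) (f j) ↔ j = 0 ∨ j = 5 ∨ j = 6 :=
    fun j => (hA 1 j).trans (squareMatrix_one j)
  by_cases hz : ∃ z, G.Adj (f 1) z ∧ ∀ j, z ≠ f j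
  · obtain ⟨z, hz1, hzC⟩ := hz
    set Y := insert z (image f {0, 1, 5, 6}) with hY
    have hYcard : Y.card = 5 := by
      rw [hY, card_insert_of_notMem, card_image_fin hf.inj]
      · rfl
      · rw [mem_image]
        rintro ⟨j, -, hj⟩
        exact hzC j hj.symm
    have hYdom : ∀ y ∈ Y, Dom G {f 1} y := by
      intro y hy
      rcases mem_insert.1 hy with rfl | hy
      · exact ⟨f 1, by simp, Or.inr hz1⟩
      · obtain ⟨j, hj, rfl⟩ := mem_image.1 hy
        simp only [mem_insert, mem_singleton] at hj
        rcases hj with rfl | rfl | rfl | rfl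
        · exact ⟨f 1, by simp, Or.inr ((h1 0).2 (by simp))⟩
        · exact ⟨f 1, by simp, Or.inl rfl⟩
        · exact ⟨f 1, by simp, Or.inr ((h1 5).2 (by simp))⟩
        · exact ⟨f 1, by simp, Or.inr ((h1 6).2 (by simp))⟩
    have hnotY : ∀ j : Fin 9, j ∉ ({0, 1, 5, 6} : Finset (Fin 9)) → f j ∉ Y := by
      intro j hj
      rw [hY, mem_insert, mem_image, not_or]
      refine ⟨(hzC j).symm, ?_⟩
      rintro ⟨k, hk, he⟩
      exact hj (hf.inj he ▸ hk)
    have h78 : G.Adj (f 7) (f 8) := (hA 7 8).2 (by decide +kernel)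
    have h72 : G.Adj (f 7) (f 2) := (hA 7 2).2 (by decide +kernel)
    have h74 : G.Adj (f 7) (f 4) := (hA 7 4).2 (by decide +kernel)
    have h83 : G.Adj (f 8) (f 3) := (hA 8 3).2 (by decide +kernel)
    refine h.false_of_dominated_rest (d := f 1) (C := image f univ) (Y := Y)
      (R := image f {7, 8}) ?_ (fun a _ _ _ _ ha => Or.inl (hYdom a ha)) ?_ ?_ hYcard.ge (Or.inr ?_)
    · intro L hL hLC hLd
      refine h.not_exc_of_one_link (x := z) hL.ne hL.conn
        (fun hzL => hLd z hzL (hYdom z (mem_insert_self _ _))) ?_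
      intro l hl w hw hlw
      have hwY : w ∈ Y := by
        by_contra hwY
        exact hw (hL.closed l hl w (mem_compl.2 hwY) hlw)
      rcases mem_insert.1 hwY with rfl | hwY
      · rfl
      · exfalso
        obtain ⟨j, hj, rfl⟩ := mem_image.1 hwY
        by_cases hj1 : j = 1
        · subst hj1
          exact hLd l hl ⟨f 1, by simp, Or.inr hlw.symm⟩
        · obtain ⟨i, rfl⟩ := hf.out j (by
            simp only [mem_insert, mem_singleton] at hj ⊢
            omega) l hlw.symm
          exact disjoint_left.1 hLC hl (mem_image_of_mem f (mem_univ i))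
    · rw [disjoint_left]
      intro w hw
      obtain ⟨j, hj, rfl⟩ := mem_image.1 hw
      refine hnotY j ?_
      simp only [mem_insert, mem_singleton] at hj ⊢
      omega
    · intro w hw hwY
      obtain ⟨j, -, rfl⟩ := mem_image.1 hw
      have hj : j = 2 ∨ j = 3 ∨ j = 4 ∨ j = 7 ∨ j = 8 := by
        by_contra hj
        refine hwY (mem_insert_of_mem (mem_image_of_mem f ?_))
        simp only [mem_insert, mem_singleton]
        omega
      rcases hj with rfl | rfl | rfl | rfl | rfl
      · exact ⟨f 7, by simp, Or.inr h72⟩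
      · exact ⟨f 8, by simp, Or.inr h83⟩
      · exact ⟨f 7, by simp, Or.inr h74⟩
      · exact ⟨f 7, by simp, Or.inl rfl⟩
      · exact ⟨f 8, by simp, Or.inl rfl⟩
    · rintro L hL ⟨r, hr, hrL⟩ hLE
      have hn : ∀ j : Fin 9, j ∉ ({0, 1, 5, 6} : Finset (Fin 9)) → f j ∈ Yᶜ :=
        fun j hj => mem_compl.2 (hnotY j hj)
      have h7 : f 7 ∈ L := by
        obtain ⟨j, hj, rfl⟩ := mem_image.1 hr
        simp only [mem_insert, mem_singleton] at hj
        rcases hj with rfl | rfl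
        · exact hrL
        · exact hL.closed _ hrL _ (hn 7 (by decide)) h78.symm
      have h8 := hL.closed _ h7 _ (hn 8 (by decide)) h78
      have hsub : image f {2, 3, 4, 7, 8} ⊆ L := by
        intro w hw
        obtain ⟨j, hj, rfl⟩ := mem_image.1 hw
        simp only [mem_insert, mem_singleton] at hj
        rcases hj with rfl | rfl | rfl | rfl | rfl
        · exact hL.closed _ h7 _ (hn 2 (by decide)) h72
        · exact hL.closed _ h8 _ (hn 3 (by decide)) h83
        · exact hL.closed _ h7 _ (hn 4 (by decide)) h74
        · exact h7
        · exact h8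
      have hcard := card_le_card hsub
      rw [card_image_fin hf.inj] at hcard
      have hcard : 5 ≤ L.card := hcard
      rcases hLE with h4 | h9
      · rw [h4.card_eq] at hcard
        omega
      · refine h.not_exc9 hdeg ?_ h9
        rintro rfl
        exact mem_compl.1 (hL.sub (mem_univ z)) (mem_insert_self _ _)
  · push Not at hz
    have hf' : IsCore G f {2, 3, 4} := by
      refine ⟨hf.inj, fun i hi z hiz => ?_, hf.good⟩
      by_cases hi1 : i = 1
      · subst hi1
        exact hz z hiz
      · exact hf.out i (by simp only [mem_insert, mem_singleton] at hi ⊢; omega) z hiz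
    refine h.not_reduces hdeg hf' 4 {2, 3} ?_
    simpa only [hA] using reduces_squareMatrix

end Square

/-! ### No core survives the search -/

section Core

variable {V : Type*} [Fintype V] {G : SimpleGraph V} {f : Fin 9 → V} {K : ℕ}

theorem MinCE.not_embeds (h : MinCE G) (hdeg : ∀ v, (univ.filter (G.Adj v)).card ≤ 4)
    (hf : Function.Injective f) (hK : Between (fun i j => G.Adj (f i) (f j)) K K) {N : ℕ}
    (hN : N ∈ nineMasks) : embeds N K 9 [] = false := by
  rw [← Bool.not_eq_true]
  intro he
  obtain ⟨H, hH, hHN⟩ := exists_nineGraph hN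
  obtain ⟨σ, hσ, hadj⟩ := exists_embedding hK (fun _ _ => SimpleGraph.Adj.symm) (fun i => G.loopless.irrefl _)
    (B := H.Adj) ⟨fun i j => (hHN i j).2, fun i j => (hHN i j).1⟩ (fun _ _ => SimpleGraph.Adj.symm)
    (fun i => H.loopless.irrefl _) he
  have hE : Exc9 G (image f univ) := by
    refine ⟨H, hH, f ∘ σ, hf.comp hσ, ?_, fun i j => (hadj i j).symm⟩
    ext w
    simp only [mem_image, mem_univ, true_and, Function.comp_apply]
    exact ((Finite.injective_iff_surjective.1 hσ).exists (p := fun i => f i = w)).symm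
  by_cases hu : image f univ = univ
  · exact h.notExc (Or.inr (hu ▸ hE))
  · exact h.not_exc9 hdeg hu hE

theorem MinCE.leafB_eq_false (h : MinCE G) (hdeg : ∀ v, (univ.filter (G.Adj v)).card ≤ 4)
    (hf : IsCore G f {1, 2, 3, 4}) {M : ℕ} (hK : Between (fun i j => G.Adj (f i) (f j)) K M) :
    leafB K M = false := by
  rw [← Bool.not_eq_true, leafB, Bool.and_eq_true, Nat.beq_eq, Bool.or_eq_true, Bool.or_eq_true,
    Nat.beq_eq, List.any_eq_true]
  rintro ⟨rfl, (hT | rfl) | ⟨N, hN, he⟩⟩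
  · obtain ⟨a, c, hac⟩ := hK.exists_twoPairs hT
    exact h.not_twoPairs hdeg hf a c hac
  · exact h.not_square hdeg hf fun i j => ⟨hK.upper i j, hK.lower i j⟩
  · rw [Bool.and_eq_true, h.not_embeds hdeg hf.inj hK (List.mem_reverse.1 hN)] at he
    exact Bool.false_ne_true he.2

theorem MinCE.anyNine_reducesB (h : MinCE G) (hdeg : ∀ v, (univ.filter (G.Adj v)).card ≤ 4)
    (hf : IsCore G f {1, 2, 3, 4}) {M : ℕ} (hK : Between (fun i j => G.Adj (f i) (f j)) K M) :
    (anyNine fun d => reducesB K M d) = false := by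
  rw [← Bool.not_eq_true, anyNine_iff]
  rintro ⟨d, hd, hr⟩
  obtain ⟨d, T, hT⟩ := hK.exists_reduces (fun _ _ => SimpleGraph.Adj.symm) hd hr
  exact h.not_reduces hdeg hf d T hT

theorem card_core_le {Δ : ℕ} (hdeg : ∀ v, (univ.filter (G.Adj v)).card ≤ Δ)
    (hf : Function.Injective f) (i : Fin 9) :
    (univ.filter fun j => G.Adj (f i) (f j)).card ≤ Δ := by
  refine le_trans ?_ (hdeg (f i))
  rw [← card_image_of_injective _ hf]
  refine card_le_card fun w hw => ?_
  obtain ⟨j, hj, rfl⟩ := mem_image.1 hw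
  exact mem_filter.2 ⟨mem_univ _, (mem_filter.1 hj).2⟩

theorem MinCE.false_of_core4 (h : MinCE G) (hdeg : ∀ v, (univ.filter (G.Adj v)).card ≤ 4)
    (hf : IsCore G f {1, 2, 3, 4})
    (hbase : Between (fun i j => G.Adj (f i) (f j)) (matrixOf edges4)
      (matrixOf (edges4 ++ pairs4)))
    (h3 : 3 ≤ (({1, 2, 3, 4} : Finset (Fin 9)).filter fun i =>
      ∃ j, 5 ≤ j ∧ G.Adj (f i) (f j)).card)
    (hle : linkCode (fun i j => G.Adj (f i) (f j)) 1 ≤ linkCode (fun i j => G.Adj (f i) (f j)) 2 ∧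
      linkCode (fun i j => G.Adj (f i) (f j)) 2 ≤ linkCode (fun i j => G.Adj (f i) (f j)) 3 ∧
      linkCode (fun i j => G.Adj (f i) (f j)) 3 ≤ linkCode (fun i j => G.Adj (f i) (f j)) 4) :
    False := by
  obtain ⟨K, M, hK, hp⟩ := search_sound (fun _ _ => SimpleGraph.Adj.symm) (by decide) hbase search4
  rw [h.leafB_eq_false hdeg hf hK, prune4, h.anyNine_reducesB hdeg hf hK,
    hK.degreeB_eq_false (card_core_le hdeg hf.inj), hK.linksB_eq_false h3,
    hK.orderB_eq_false (i := 1) (by norm_num) hle.1,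
    hK.orderB_eq_false (i := 2) (by norm_num) hle.2.1,
    hK.orderB_eq_false (i := 3) (by norm_num) hle.2.2] at hp
  simp at hp

theorem MinCE.false_of_core3 (h : MinCE G) (hdeg : ∀ v, (univ.filter (G.Adj v)).card ≤ 3)
    (hf : IsCore G f {1, 2, 3, 4})
    (hbase : Between (fun i j => G.Adj (f i) (f j)) (matrixOf edges3)
      (matrixOf (edges3 ++ pairs3)))
    (h3 : 3 ≤ (({1, 2, 3, 4} : Finset (Fin 9)).filter fun i =>
      ∃ j, 5 ≤ j ∧ G.Adj (f i) (f j)).card) : False := by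
  obtain ⟨K, M, hK, hp⟩ := search_sound (fun _ _ => SimpleGraph.Adj.symm) (by decide) hbase search3
  rw [prune3, h.anyNine_reducesB (fun v => (hdeg v).trans (by norm_num)) hf hK,
    hK.degreeB_eq_false (card_core_le hdeg hf.inj), hK.linksB_eq_false h3] at hp
  simp at hp

end Core

end Isolation

namespace Isolation

open Finset
open scoped Classical

/-! ### From a smallest counterexample to a core -/

section CoreMap

variable {V : Type*} {G : SimpleGraph V} {v : V} {x y : Fin 4 → V} {K : Finset V}

/-- The list of the vertex `v`, the four vertices of `x` and the four vertices of `y`. -/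
def coreMap (v : V) (x y : Fin 4 → V) : Fin 9 → V := Fin.cons v (Fin.append x y)

theorem coreMap_mid (j : Fin 4) : coreMap v x y (Fin.castAdd 4 j).succ = x j := by
  rw [coreMap, Fin.cons_succ, Fin.append_left]

theorem coreMap_last (j : Fin 4) : coreMap v x y (Fin.natAdd 4 j).succ = y j := by
  rw [coreMap, Fin.cons_succ, Fin.append_right]

theorem coreMap_cases {P : Fin 9 → Prop} (h0 : P 0) (h1 : ∀ j : Fin 4, P (Fin.castAdd 4 j).succ)
    (h2 : ∀ j : Fin 4, P (Fin.natAdd 4 j).succ) (i : Fin 9) : P i := by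
  refine Fin.cases h0 (fun k => ?_) i
  exact Fin.addCases (m := 4) (n := 4) (motive := fun k => P (Fin.succ k)) h1 h2 k

theorem coreMap_injective (hv : ∀ j, x j ≠ v) (hv' : ∀ j, y j ≠ v) (hx : Function.Injective x)
    (hy : Function.Injective y) (hxy : ∀ i j, x i ≠ y j) : Function.Injective (coreMap v x y) := by
  rw [coreMap, Fin.cons_injective_iff, Fin.append_injective_iff]
  refine ⟨?_, hx, hy, hxy⟩
  rintro ⟨k, hk⟩
  revert hk
  refine Fin.addCases (m := 4) (n := 4)
    (motive := fun k => Fin.append x y k = v → False) ?_ ?_ k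
  · intro j hj
    rw [Fin.append_left] at hj
    exact hv j hj
  · intro j hj
    rw [Fin.append_right] at hj
    exact hv' j hj

theorem image_coreMap :
    image (coreMap v x y) univ = insert v (image x univ) ∪ image y univ := by
  ext w
  simp only [mem_image, mem_univ, true_and, mem_union, mem_insert]
  constructor
  · rintro ⟨i, rfl⟩
    refine coreMap_cases (P := fun i => (coreMap v x y i = v ∨ ∃ a, x a = coreMap v x y i) ∨
      ∃ a, y a = coreMap v x y i) (Or.inl (Or.inl rfl)) (fun j => ?_) (fun j => ?_) i
    · exact Or.inl (Or.inr ⟨j, (coreMap_mid j).symm⟩)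
    · exact Or.inr ⟨j, (coreMap_last j).symm⟩
  · rintro ((rfl | ⟨j, rfl⟩) | ⟨j, rfl⟩)
    exacts [⟨0, rfl⟩, ⟨_, coreMap_mid j⟩, ⟨_, coreMap_last j⟩]

theorem card_links_le (hyK : image y univ = K) :
    ((image x univ).filter fun w => ∃ k ∈ K, G.Adj w k).card ≤
      (({1, 2, 3, 4} : Finset (Fin 9)).filter fun i =>
        ∃ j, 5 ≤ j ∧ G.Adj (coreMap v x y i) (coreMap v x y j)).card := by
  refine (card_le_card fun w hw => ?_).trans (card_image_le (f := coreMap v x y))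
  obtain ⟨hw, k, hk, hwk⟩ := mem_filter.1 hw
  obtain ⟨i, -, rfl⟩ := mem_image.1 hw
  rw [← hyK] at hk
  obtain ⟨j, -, rfl⟩ := mem_image.1 hk
  refine mem_image.2 ⟨(Fin.castAdd 4 i).succ, mem_filter.2 ⟨?_, (Fin.natAdd 4 j).succ, ?_, ?_⟩,
    coreMap_mid i⟩
  · exact (by decide : ∀ i : Fin 4, (Fin.castAdd 4 i).succ ∈ ({1, 2, 3, 4} : Finset (Fin 9))) i
  · exact (by decide : ∀ j : Fin 4, 5 ≤ (Fin.natAdd 4 j).succ) j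
  · rw [coreMap_mid, coreMap_last]
    exact hwk

variable [Fintype V]

/-- Since `K` is a whole component after deleting `v` and the vertices of `x`, only the latter have
neighbours outside the core. A component of the rest is still one when `K` is put back, so by
uniqueness it is not exceptional. -/
theorem isCore_coreMap (hx : Function.Injective x) (hy : Function.Injective y)
    (hvx : ∀ j, x j ≠ v) (hyK : image y univ = K)
    (hK : IsComp G (insert v (image x univ))ᶜ K) (hv : ∀ z, G.Adj v z → z ∈ image x univ)
    (huniq : ∀ L, IsComp G (insert v (image x univ))ᶜ L → Exc G L → L = K) :
    IsCore G (coreMap v x y) {1, 2, 3, 4} := by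
  have hyS : ∀ j, y j ∈ (insert v (image x univ))ᶜ :=
    fun j => hK.sub (hyK ▸ mem_image_of_mem y (mem_univ j))
  have hmem : ∀ z, z ∈ insert v (image x univ) ∪ K → ∃ j, z = coreMap v x y j := by
    intro z hz
    rw [← hyK, ← image_coreMap, mem_image] at hz
    obtain ⟨j, -, hj⟩ := hz
    exact ⟨j, hj.symm⟩
  refine ⟨coreMap_injective hvx ?_ hx hy ?_, ?_, ?_⟩
  · intro j hj
    exact mem_compl.1 (hyS j) (hj ▸ mem_insert_self _ _)
  · intro i j hij
    exact mem_compl.1 (hyS j) (hij ▸ mem_insert_of_mem (mem_image_of_mem x (mem_univ i)))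
  · refine coreMap_cases ?_ ?_ ?_
    · intro _ z hz
      exact hmem z (mem_union_left _ (mem_insert_of_mem (hv z hz)))
    · intro j hj
      refine absurd ?_ hj
      revert j
      decide
    · intro j _ z hz
      rw [coreMap_last] at hz
      refine hmem z ?_
      by_cases hzS : z ∈ insert v (image x univ)
      · exact mem_union_left _ hzS
      · exact mem_union_right _ (hK.closed (y j) (hyK ▸ mem_image_of_mem y (mem_univ j)) z
          (mem_compl.2 hzS) hz)
  · intro L hL hLE
    rw [image_coreMap, hyK] at hL
    have hLK : Disjoint L K := by
      rw [disjoint_left]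
      intro l hl hlK
      exact mem_compl.1 (hL.sub hl) (mem_union_right _ hlK)
    have hLS : L ⊆ (insert v (image x univ))ᶜ :=
      hL.sub.trans (compl_subset_compl.2 subset_union_left)
    have := huniq L ⟨hLS, hL.ne, hL.conn, fun l hl z hz hlz => by
      refine hL.closed l hl z ?_ hlz
      rw [mem_compl, mem_union, not_or]
      exact ⟨mem_compl.1 hz, fun hzK =>
        disjoint_left.1 hLK hl (hK.closed z hzK l (hLS hl) hlz.symm)⟩⟩ hLE
    subst this
    obtain ⟨l, hl⟩ := hL.ne
    exact disjoint_left.1 hLK hl hl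

theorem edges4_cases : ∀ i j : Fin 9, (matrixOf edges4).testBit (9 * i + j) = true →
    (i, j) ∈ [((0 : Fin 9), (1 : Fin 9)), (0, 2), (0, 3), (0, 4), (5, 6), (6, 7), (7, 8), (8, 5)] ∨
    (j, i) ∈ [((0 : Fin 9), (1 : Fin 9)), (0, 2), (0, 3), (0, 4), (5, 6), (6, 7), (7, 8), (8, 5)] := by
  decide +kernel

theorem pairs4_cases : ∀ i j : Fin 9, i ≠ j → ¬ (i = 0 ∧ 5 ≤ j) → ¬ (j = 0 ∧ 5 ≤ i) →
    (matrixOf (edges4 ++ pairs4)).testBit (9 * i + j) = true := by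
  decide +kernel

theorem edges3_cases : ∀ i j : Fin 9, (matrixOf edges3).testBit (9 * i + j) = true →
    (i, j) ∈ [((0 : Fin 9), (1 : Fin 9)), (0, 3), (0, 4), (1, 2), (2, 3), (5, 6), (6, 7), (7, 8),
      (8, 5)] ∨
    (j, i) ∈ [((0 : Fin 9), (1 : Fin 9)), (0, 3), (0, 4), (1, 2), (2, 3), (5, 6), (6, 7), (7, 8),
      (8, 5)] := by
  decide +kernel

theorem pairs3_cases : ∀ i j : Fin 9, i ≠ j → ¬ (i = 0 ∧ (5 ≤ j ∨ j = 2)) →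
    ¬ (j = 0 ∧ (5 ≤ i ∨ i = 2)) →
    (matrixOf (edges3 ++ pairs3)).testBit (9 * i + j) = true := by
  decide +kernel

theorem MinCE.degree_lt_four (h : MinCE G) (v : V) : (univ.filter (G.Adj v)).card < 4 := by
  have hdeg : ∀ v, (univ.filter (G.Adj v)).card ≤ 4 := by
    intro v
    by_contra hv
    have := (h.four_le_degree v (by omega)).1
    omega
  by_contra hv
  obtain ⟨hN4, K, hK, hKE, huniq, hlinks⟩ := h.four_le_degree v (not_lt.1 hv)
  set N := univ.filter (G.Adj v) with hN
  have hKne : K ≠ univ := by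
    rintro rfl
    exact mem_compl.1 (hK.sub (mem_univ v)) (mem_insert_self _ _)
  obtain ⟨a, b, c, d, hc, hKeq⟩ := hKE.resolve_right (h.not_exc9 hdeg hKne)
  set y : Fin 4 → V := ![a, b, c, d] with hy
  set code : V → ℕ := fun w => Nat.ofBits fun j : Fin 4 => decide (G.Adj w (y j)) with hcode
  set e := (N.equivFinOfCardEq hN4).symm
  -- Sorting the neighbours by their links to `K` provides the order assumed by `orderB`.
  set x : Fin 4 → V := fun i => e (Tuple.sort (fun i => code (e i)) i) with hx
  have hmono : Monotone fun i => code (x i) := Tuple.monotone_sort (fun i => code (e i))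
  have hxinj : Function.Injective x := fun i j hij =>
    (Tuple.sort fun i => code (e i)).injective (e.injective (Subtype.ext hij))
  have hxN : image x univ = N := by
    refine eq_of_subset_of_card_le (fun w hw => ?_) ?_
    · obtain ⟨i, -, rfl⟩ := mem_image.1 hw
      exact (e _).2
    · rw [card_image_of_injective _ hxinj, hN4]
      rfl
  have hyK : image y univ = K := by
    rw [hKeq]
    ext w
    simp [hy, Fin.exists_fin_succ, eq_comm]
  have hadj : ∀ w, G.Adj v w ↔ w ∈ N := fun w => by simp [hN]
  have hvx : ∀ j, G.Adj v (x j) := fun j => (hadj _).2 (hxN ▸ mem_image_of_mem x (mem_univ j))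
  have hf : IsCore G (coreMap v x y) {1, 2, 3, 4} := by
    refine isCore_coreMap hxinj hc.injective (fun j => (hvx j).ne') hyK (hxN ▸ hK)
      (fun z hz => hxN ▸ (hadj z).1 hz) (fun L hL => huniq L (hxN ▸ hL))
  have hnv : ∀ j : Fin 9, 5 ≤ j → ¬ G.Adj v (coreMap v x y j) := by
    refine coreMap_cases (by simp) ?_ ?_
    · intro j hj
      exfalso
      revert j
      decide
    · intro j _ hadj'
      rw [coreMap_last] at hadj'
      exact mem_compl.1 (hK.sub (hyK ▸ mem_image_of_mem y (mem_univ j)))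
        (mem_insert_of_mem ((hadj _).1 hadj'))
  obtain ⟨h1, h2, h3, h4, -, -⟩ := hc
  have key : ∀ i : Fin 4, linkCode (fun i j => G.Adj (coreMap v x y i) (coreMap v x y j))
      (Fin.castAdd 4 i).succ = code (x i) := by
    intro i
    rw [linkCode, hcode]
    simp only [coreMap_mid]
    refine congrArg Nat.ofBits (funext fun j => ?_)
    rw [show Fin.natAdd 5 j = (Fin.natAdd 4 j).succ from Fin.ext (by simp; omega), coreMap_last]
  refine h.false_of_core4 hdeg hf ⟨?_, ?_⟩ ?_ ⟨?_, ?_, ?_⟩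
  · have hE : ∀ i j : Fin 9, (i, j) ∈ [((0 : Fin 9), (1 : Fin 9)), (0, 2), (0, 3), (0, 4), (5, 6),
        (6, 7), (7, 8), (8, 5)] → G.Adj (coreMap v x y i) (coreMap v x y j) := by
      intro i j hij
      simp only [List.mem_cons, List.not_mem_nil, or_false, Prod.mk.injEq] at hij
      rcases hij with ⟨rfl, rfl⟩ | ⟨rfl, rfl⟩ | ⟨rfl, rfl⟩ | ⟨rfl, rfl⟩ | ⟨rfl, rfl⟩ | ⟨rfl, rfl⟩ |
        ⟨rfl, rfl⟩ | ⟨rfl, rfl⟩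
      exacts [hvx 0, hvx 1, hvx 2, hvx 3, h1, h2, h3, h4]
    exact fun i j hij => (edges4_cases i j hij).elim (hE i j) fun h => (hE j i h).symm
  · intro i j hij
    refine pairs4_cases i j (fun e => hij.ne (congrArg _ e)) ?_ ?_
    · rintro ⟨rfl, hj⟩
      exact hnv j hj hij
    · rintro ⟨rfl, hi⟩
      exact hnv i hi hij.symm
  · refine le_trans ?_ (card_links_le hyK)
    rwa [hxN]
  · exact (key 0).trans_le ((hmono (by decide : (0 : Fin 4) ≤ 1)).trans_eq (key 1).symm)
  · exact (key 1).trans_le ((hmono (by decide : (1 : Fin 4) ≤ 2)).trans_eq (key 2).symm)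
  · exact (key 2).trans_le ((hmono (by decide : (2 : Fin 4) ≤ 3)).trans_eq (key 3).symm)

/-- Without 4-cycles the empty set would isolate, and a spanning 4-cycle would make `G` exceptional.
Connectedness gives an edge leaving the cycle, and a rotation moves it to `a`. -/
theorem MinCE.exists_isC4 (h : MinCE G) :
    ∃ a b c d x, IsC4 G a b c d ∧ x ∉ ({a, b, c, d} : Finset V) ∧ G.Adj a x := by
  have hex : ∃ a b c d, IsC4 G a b c d := by
    by_contra hno
    push Not at hno
    have := h.large ∅ fun a b c d hc => absurd hc (hno a b c d)
    simp at this
  obtain ⟨a, b, c, d, hc⟩ := hex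
  have hQ : ({a, b, c, d} : Finset V) ≠ univ :=
    fun hu => h.notExc (Or.inl ⟨a, b, c, d, hc, hu.symm⟩)
  have hx : ∃ p ∈ ({a, b, c, d} : Finset V), ∃ x ∉ ({a, b, c, d} : Finset V), G.Adj p x := by
    by_contra hno
    push Not at hno
    refine hQ (h.conn _ (subset_univ _) ⟨a, by simp⟩ fun p hp z _ hpz => ?_)
    by_contra hz
    exact hno p hp z hz hpz
  obtain ⟨p, hp, x, hx, hpx⟩ := hx
  have rot : ∀ a b c d : V, ({b, c, d, a} : Finset V) = {a, b, c, d} := by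
    intro a b c d
    ext w
    simp only [mem_insert, mem_singleton]
    tauto
  simp only [mem_insert, mem_singleton] at hp
  rcases hp with rfl | rfl | rfl | rfl
  · exact ⟨_, _, _, _, x, hc, hx, hpx⟩
  · exact ⟨_, _, _, _, x, hc.rotate, rot a p c d ▸ hx, hpx⟩
  · exact ⟨_, _, _, _, x, hc.rotate.rotate, by rwa [rot, rot], hpx⟩
  · exact ⟨_, _, _, _, x, hc.rotate.rotate.rotate, by rwa [rot, rot, rot], hpx⟩

theorem not_minCE (G : SimpleGraph V) : ¬ MinCE G := by
  intro h
  have hdeg : ∀ v, (univ.filter (G.Adj v)).card ≤ 3 :=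
    fun v => Nat.le_of_lt_succ (h.degree_lt_four v)
  have hdeg4 : ∀ v, (univ.filter (G.Adj v)).card ≤ 4 := fun v => (hdeg v).trans (by norm_num)
  obtain ⟨a, b, c, d, x, hc, hxQ, hax⟩ := h.exists_isC4
  obtain ⟨hab, hbc, hcd, hda, hac, hbd⟩ := id hc
  simp only [mem_insert, mem_singleton, not_or] at hxQ
  obtain ⟨hxa, hxb, hxc, hxd⟩ := hxQ
  have four : ∀ v p q r s : V, G.Adj v p → G.Adj v q → G.Adj v r → G.Adj v s → p ≠ q → p ≠ r →
      p ≠ s → q ≠ r → q ≠ s → r ≠ s → False := by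
    intro v p q r s hp hq hr hs h1 h2 h3 h4 h5 h6
    have hsub : ({p, q, r, s} : Finset V) ⊆ univ.filter (G.Adj v) := by
      intro w hw
      simp only [mem_insert, mem_singleton] at hw
      rcases hw with rfl | rfl | rfl | rfl <;> exact mem_filter.2 ⟨mem_univ _, by assumption⟩
    have := (card_le_card hsub).trans (hdeg v)
    rw [card_insert_of_notMem (by simp [h1, h2, h3]), card_insert_of_notMem (by simp [h4, h5]),
      card_pair h6] at this
    omega
  have hNa : ∀ z, G.Adj a z → z = b ∨ z = d ∨ z = x := by
    intro z hz
    by_contra hcon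
    push Not at hcon
    exact four a b d x z hab hda.symm hax hz hbd (Ne.symm hxb) hcon.1.symm (Ne.symm hxd)
      hcon.2.1.symm hcon.2.2.symm
  set xs : Fin 4 → V := ![b, c, d, x] with hxs
  have hxsinj : Function.Injective xs := by
    rw [hxs]
    intro i j hij
    fin_cases i <;> fin_cases j <;> simp at hij ⊢ <;>
      first
      | exact absurd hij hbc.ne | exact absurd hij.symm hbc.ne
      | exact absurd hij hcd.ne | exact absurd hij.symm hcd.ne
      | exact absurd hij hbd | exact absurd hij.symm hbd
      | exact absurd hij hxb | exact absurd hij.symm hxb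
      | exact absurd hij hxc | exact absurd hij.symm hxc
      | exact absurd hij hxd | exact absurd hij.symm hxd
  have hax' : ∀ j, xs j ≠ a := by
    intro j
    fin_cases j
    exacts [hab.ne', hac.symm, hda.ne, hxa]
  have hmem : ∀ z, z ∈ image xs univ ↔ z = b ∨ z = c ∨ z = d ∨ z = x := by
    intro z
    simp [hxs, Fin.exists_fin_succ, eq_comm]
  set Y := insert a (image xs univ) with hY
  have hYcard : Y.card = 5 := by
    rw [hY, card_insert_of_notMem, card_image_of_injective _ hxsinj]
    · rfl
    · rw [mem_image]
      rintro ⟨j, -, hj⟩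
      exact hax' j hj
  -- Only `c` may be undominated in `Y`. On a surviving 4-cycle its two neighbours would differ from
  -- `b` and `d`, giving it degree 4. So `5 + 4h < 5 + u`, and an unhit exceptional component
  -- exists.
  have hlt := h.card_add_lt (D := {a}) (Y := Y) ⟨a, mem_insert_self _ _⟩ (by
    intro p q r s hpc hp
    by_contra hcon
    push Not at hcon
    obtain ⟨np, nq, -, ns⟩ := hcon
    have hp : p = c := by
      rw [hY, mem_insert, hmem] at hp
      rcases hp with rfl | rfl | rfl | rfl | rfl
      · exact absurd rfl (not_dom_singleton np).1
      · exact absurd hab (not_dom_singleton np).2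
      · rfl
      · exact absurd hda.symm (not_dom_singleton np).2
      · exact absurd hax (not_dom_singleton np).2
    subst hp
    have hne : ∀ w, ¬ Dom G {a} w → b ≠ w ∧ d ≠ w := fun w hw =>
      ⟨fun e => (not_dom_singleton hw).2 (e ▸ hab),
        fun e => (not_dom_singleton hw).2 (e ▸ hda.symm)⟩
    exact four p b d q s hbc.symm hcd hpc.1 hpc.2.2.2.1.symm hbd (hne q nq).1 (hne s ns).1
      (hne q nq).2 (hne s ns).2 hpc.2.2.2.2.2)
  rw [card_singleton, hYcard] at hlt
  obtain ⟨K, hK⟩ := card_pos.1 (show 0 < (unhitComps G Yᶜ {a}).card by omega)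
  obtain ⟨hK, hKE, -⟩ := mem_unhitComps.1 hK
  have hout : ∀ L, IsComp G Yᶜ L → Exc G L → outer G L ⊆ image xs univ ∧ 3 ≤ (outer G L).card := by
    intro L hL hLE
    have hYL : ∀ z ∈ Y, z ∉ L := fun z hz hzL => mem_compl.1 (hL.sub hzL) hz
    have hsub : outer G L ⊆ image xs univ := by
      intro z hz
      obtain ⟨hzL, l, hl, hlz⟩ := mem_outer.1 hz
      have hzY : z ∈ Y := by
        by_contra hzY
        exact hzL (hL.closed l hl z (mem_compl.2 hzY) hlz)
      rcases mem_insert.1 hzY with rfl | hz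
      · refine absurd hl (hYL l (mem_insert_of_mem ((hmem l).2 ?_)))
        rcases hNa l hlz.symm with h | h | h <;> simp [h]
      · exact hz
    have hL' : ∀ z ∈ Y, z ∈ Lᶜ := fun z hz => mem_compl.2 (hYL z hz)
    have hYm : ∀ z, (z = b ∨ z = c ∨ z = d ∨ z = x) → z ∈ Lᶜ :=
      fun z hz => hL' z (mem_insert_of_mem ((hmem z).2 hz))
    have ha := hL' a (mem_insert_self _ _)
    have hlink : ∀ z ∈ outer G L, Linked G Lᶜ a z := by
      intro z hz
      rcases (hmem z).1 (hsub hz) with rfl | rfl | rfl | rfl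
      · exact Linked.of_adj ha (hYm _ (by simp)) hab
      · exact (Linked.of_adj ha (hYm b (by simp)) hab).trans
          (Linked.of_adj (hYm b (by simp)) (hYm _ (by simp)) hbc)
      · exact Linked.of_adj ha (hYm _ (by simp)) hda.symm
      · exact Linked.of_adj ha (hYm _ (by simp)) hax
    exact ⟨hsub, h.three_le_card_outer hL.ne hL.conn hLE
      fun p hp q hq => (hlink p hp).symm.trans (hlink q hq)⟩
  have hYQ : ∀ w, w = b ∨ w = c ∨ w = d → ∃ p ∈ Y, ∃ q ∈ Y, p ≠ q ∧ G.Adj w p ∧ G.Adj w q := by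
    have ha : a ∈ Y := mem_insert_self _ _
    have hm : ∀ z, (z = b ∨ z = c ∨ z = d ∨ z = x) → z ∈ Y :=
      fun z hz => mem_insert_of_mem ((hmem z).2 hz)
    rintro w (rfl | rfl | rfl)
    · exact ⟨a, ha, c, hm c (by simp), hac, hab.symm, hbc⟩
    · exact ⟨b, hm b (by simp), d, hm d (by simp), hbd, hbc.symm, hcd⟩
    · exact ⟨a, ha, c, hm c (by simp), hac, hda, hcd.symm⟩
  -- Two exceptional components, each attached to three of `b`, `c`, `d`, `x`, share a vertex other
  -- than `x`. That vertex has two neighbours on the cycle and one in each component, against degree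
  -- 3.
  have huniq : ∀ L, IsComp G Yᶜ L → Exc G L → L = K := by
    intro L hL hLE
    obtain ⟨hKs, hK3⟩ := hout K hK hKE
    obtain ⟨hLs, hL3⟩ := hout L hL hLE
    have hint : 1 < (outer G K ∩ outer G L).card := by
      have h1 := card_union_add_card_inter (outer G K) (outer G L)
      have h2 := card_le_card (union_subset hKs hLs)
      rw [card_image_of_injective _ hxsinj] at h2
      have h2 : (outer G K ∪ outer G L).card ≤ 4 := h2
      omega
    obtain ⟨w, hw, hwx⟩ := exists_mem_ne hint x
    rw [mem_inter] at hw
    obtain ⟨-, k, hk, hkw⟩ := mem_outer.1 hw.1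
    obtain ⟨-, l, hl, hlw⟩ := mem_outer.1 hw.2
    have hw' : w = b ∨ w = c ∨ w = d := by
      have := (hmem w).1 (hKs hw.1)
      tauto
    obtain ⟨p, hp, q, hq, hpq, hwp, hwq⟩ := hYQ w hw'
    have hne : ∀ z ∈ Yᶜ, p ≠ z ∧ q ≠ z := fun z hz =>
      ⟨fun e => mem_compl.1 hz (e ▸ hp), fun e => mem_compl.1 hz (e ▸ hq)⟩
    by_contra hLK
    have hkl : k ≠ l := by
      rintro rfl
      exact hLK (hL.eq_of_mem hK hl hk)
    exact four w p q k l hwp hwq hkw.symm hlw.symm hpq (hne k (hK.sub hk)).1 (hne l (hL.sub hl)).1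
      (hne k (hK.sub hk)).2 (hne l (hL.sub hl)).2 hkl
  have hKne : K ≠ univ := by
    rintro rfl
    exact mem_compl.1 (hK.sub (mem_univ a)) (mem_insert_self _ _)
  obtain ⟨p, q, r, s, hcy, hKeq⟩ := hKE.resolve_right (h.not_exc9 hdeg4 hKne)
  set y : Fin 4 → V := ![p, q, r, s] with hy
  have hyK : image y univ = K := by
    rw [hKeq]
    ext w
    simp [hy, Fin.exists_fin_succ, eq_comm]
  have hNx : ∀ z, G.Adj a z → z ∈ image xs univ := by
    intro z hz
    rw [hmem]
    rcases hNa z hz with h | h | h <;> simp [h]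
  have hf : IsCore G (coreMap a xs y) {1, 2, 3, 4} :=
    isCore_coreMap hxsinj hcy.injective hax' hyK hK hNx huniq
  have hna : ∀ j : Fin 9, 5 ≤ j ∨ j = 2 → ¬ G.Adj a (coreMap a xs y j) := by
    refine coreMap_cases (by simp) ?_ ?_
    · intro j hj
      obtain rfl : j = 1 := by
        revert j
        decide
      rw [coreMap_mid]
      intro hadj
      rcases hNa _ hadj with h | h | h
      exacts [hbc.ne' h, hcd.ne h, hxc h.symm]
    · intro j _ hadj
      rw [coreMap_last] at hadj
      exact mem_compl.1 (hK.sub (hyK ▸ mem_image_of_mem y (mem_univ j)))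
        (mem_insert_of_mem (hNx _ hadj))
  obtain ⟨h1, h2, h3, h4, -, -⟩ := hcy
  refine h.false_of_core3 hdeg hf ⟨?_, ?_⟩ ?_
  · have hE : ∀ i j : Fin 9, (i, j) ∈ [((0 : Fin 9), (1 : Fin 9)), (0, 3), (0, 4), (1, 2), (2, 3),
        (5, 6), (6, 7), (7, 8), (8, 5)] → G.Adj (coreMap a xs y i) (coreMap a xs y j) := by
      intro i j hij
      simp only [List.mem_cons, List.not_mem_nil, or_false, Prod.mk.injEq] at hij
      rcases hij with ⟨rfl, rfl⟩ | ⟨rfl, rfl⟩ | ⟨rfl, rfl⟩ | ⟨rfl, rfl⟩ | ⟨rfl, rfl⟩ | ⟨rfl, rfl⟩ |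
        ⟨rfl, rfl⟩ | ⟨rfl, rfl⟩ | ⟨rfl, rfl⟩
      exacts [hab, hda.symm, hax, hbc, hcd, h1, h2, h3, h4]
    exact fun i j hij => (edges3_cases i j hij).elim (hE i j) fun h => (hE j i h).symm
  · intro i j hij
    refine pairs3_cases i j (fun e => hij.ne (congrArg _ e)) ?_ ?_
    · rintro ⟨rfl, hj⟩
      exact hna j hj hij
    · rintro ⟨rfl, hi⟩
      exact hna i hi hij.symm
  · refine le_trans ?_ (card_links_le hyK)
    obtain ⟨hs, h3⟩ := hout K hK hKE
    refine h3.trans (card_le_card fun w hw => mem_filter.2 ⟨hs hw, ?_⟩)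
    obtain ⟨-, k, hk, hkw⟩ := mem_outer.1 hw
    exact ⟨k, hk, hkw.symm⟩

end CoreMap

theorem isolationNumber_le_card_div_five (V : Type u) [Fintype V] (G : SimpleGraph V)
    (hG : G.Connected) (hexc : ¬ IsGraphOf exceptional G) :
    isolationNumber G (SimpleGraph.cycleGraph 4) ≤ Fintype.card V / 5 :=
  bound_of_no_minCE (fun _ _ G => not_minCE G) V G hG hexc

end Isolation

namespace Isolation

open Finset

/-! ### The graphs `B_{n,C₄}` -/

section Extremal

variable {n : ℕ}

theorem B_adj_inl_inl {k : ℕ} {F : SimpleGraph (Fin k)} {i j : Fin (n - k * (n / (k + 1)))} :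
    (B n k F).Adj (.inl i) (.inl j) ↔
      i ≠ j ∧ (BRel n k F (.inl i) (.inl j) ∨ BRel n k F (.inl j) (.inl i)) := by
  simp [B]

theorem B_adj_inl_inr {k : ℕ} {F : SimpleGraph (Fin k)} {i : Fin (n - k * (n / (k + 1)))}
    {p : Fin (n / (k + 1))} {v : Fin k} :
    (B n k F).Adj (.inl i) (.inr (p, v)) ↔ i.val = p.val := by
  simp [B, BRel]

theorem B_adj_inr_inr {k : ℕ} {F : SimpleGraph (Fin k)} {p q : Fin (n / (k + 1))} {v w : Fin k} :
    (B n k F).Adj (.inr (p, v)) (.inr (q, w)) ↔ p = q ∧ F.Adj v w := by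
  simp only [B, SimpleGraph.fromRel_adj, BRel, F.adj_comm w v]
  constructor
  · rintro ⟨-, h | h⟩
    exacts [h, ⟨h.1.symm, h.2⟩]
  · rintro ⟨rfl, h⟩
    refine ⟨fun e => ?_, Or.inl ⟨rfl, h⟩⟩
    simp only [Sum.inr.injEq, Prod.mk.injEq, true_and] at e
    exact h.ne e

theorem card_BVert : Fintype.card (BVert n 4) = n := by
  simp only [BVert, Fintype.card_sum, Fintype.card_prod, Fintype.card_fin]
  omega

theorem B_connected (hn : 1 ≤ n) : (B n 4 (SimpleGraph.cycleGraph 4)).Connected := by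
  have hpos : 0 < n - 4 * (n / (4 + 1)) := by omega
  have hpath : ∀ (k : ℕ) (hk : k < n - 4 * (n / (4 + 1))),
      (B n 4 (SimpleGraph.cycleGraph 4)).Reachable (.inl ⟨0, hpos⟩) (.inl ⟨k, hk⟩) := by
    intro k
    induction k using Nat.strong_induction_on with
    | _ k ih =>
      intro hk
      rcases Nat.eq_zero_or_pos k with rfl | hk0
      · rfl
      · obtain ⟨j, hj, hjk⟩ : ∃ j, j < k ∧ if n ≤ 4 then j + 1 = k else
            (j + 1 = k ∧ k < n / (4 + 1)) ∨ (j + 1 = n / (4 + 1) ∧ n / (4 + 1) ≤ k) := by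
          by_cases hn4 : n ≤ 4
          · exact ⟨k - 1, by omega, by rw [if_pos hn4]; omega⟩
          · by_cases hka : k < n / (4 + 1)
            · exact ⟨k - 1, by omega, by rw [if_neg hn4]; omega⟩
            · exact ⟨n / (4 + 1) - 1, by omega, by rw [if_neg hn4]; omega⟩
        refine (ih j hj (hj.trans hk)).trans (SimpleGraph.Adj.reachable ?_)
        rw [B_adj_inl_inl]
        exact ⟨fun e => hj.ne (congrArg Fin.val e), Or.inl hjk⟩
  refine (SimpleGraph.connected_iff_exists_forall_reachable _).2 ⟨.inl ⟨0, hpos⟩, ?_⟩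
  rintro (⟨k, hk⟩ | ⟨p, v⟩)
  · exact hpath k hk
  · refine (hpath p (by omega)).trans (SimpleGraph.Adj.reachable ?_)
    rw [B_adj_inl_inr]

/-- The number of the part of `B_{n,F}` that contains a vertex. -/
def BPart {k : ℕ} : BVert n k → ℕ
  | .inl i => i
  | .inr (p, _) => p

/-- A vertex dominating part of the `p`-th cycle is its hub or lies on the cycle. These sets are
disjoint for different `p`, so each needs its own member of `D`. -/
theorem le_card_of_isolates_B {D : Finset (BVert n 4)}
    (hD : Isolates (B n 4 (SimpleGraph.cycleGraph 4)) univ D) : n / 5 ≤ D.card := by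
  have hdom : ∀ (p : Fin (n / (4 + 1))) (v : Fin 4),
      Dom (B n 4 (SimpleGraph.cycleGraph 4)) D (.inr (p, v)) → p.val ∈ D.image BPart := by
    rintro p v ⟨u, hu, h⟩
    refine mem_image.2 ⟨u, hu, ?_⟩
    rcases h with rfl | h
    · rfl
    · rcases u with i | ⟨q, w⟩
      · exact B_adj_inl_inr.1 h
      · exact congrArg Fin.val (B_adj_inr_inr.1 h).1
  have hsub : range (n / (4 + 1)) ⊆ D.image BPart := by
    intro p hp
    have hadj : ∀ v w : Fin 4, (SimpleGraph.cycleGraph 4).Adj v w →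
        (B n 4 (SimpleGraph.cycleGraph 4)).Adj (.inr (⟨p, mem_range.1 hp⟩, v))
          (.inr (⟨p, mem_range.1 hp⟩, w)) := fun v w h => B_adj_inr_inr.2 ⟨rfl, h⟩
    rcases hD _ _ _ _ ⟨hadj 0 1 (by decide), hadj 1 2 (by decide), hadj 2 3 (by decide),
      hadj 3 0 (by decide), by simp, by simp⟩ (mem_univ _) (mem_univ _) (mem_univ _) (mem_univ _)
      with h | h | h | h
    all_goals exact hdom ⟨p, mem_range.1 hp⟩ _ h
  calc n / 5 = (range (n / (4 + 1))).card := (card_range _).symm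
    _ ≤ (D.image BPart).card := card_le_card hsub
    _ ≤ D.card := card_image_le

theorem exists_isolates_B :
    ∃ D, Isolates (B n 4 (SimpleGraph.cycleGraph 4)) univ D ∧ D.card ≤ n / 5 := by
  have hab : ∀ p : Fin (n / (4 + 1)), p.val < n - 4 * (n / (4 + 1)) := fun p => by omega
  refine ⟨univ.image fun p : Fin (n / (4 + 1)) => .inl ⟨p, hab p⟩, ?_, ?_⟩
  · by_cases hn : n ≤ 4
    -- For `n ≤ 4` the graph is a path: positions change by exactly one along edges, and a 4-cycle
    -- would repeat a position.
    · have hpath : ∀ x y : BVert n 4, (B n 4 (SimpleGraph.cycleGraph 4)).Adj x y →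
          BPart x + 1 = BPart y ∨ BPart y + 1 = BPart x := by
        rintro (i | ⟨p, -⟩) (j | ⟨p, -⟩) h
        · rw [B_adj_inl_inl] at h
          simp only [BRel, if_pos hn] at h
          exact h.2
        all_goals
          have := p.2
          omega
      have hinj : ∀ x y : BVert n 4, x ≠ y → BPart x ≠ BPart y := by
        rintro (i | ⟨p, -⟩) (j | ⟨p, -⟩) h e
        · exact h (congrArg Sum.inl (Fin.ext e))
        all_goals
          have := p.2
          omega
      rintro x y z w ⟨h1, h2, h3, h4, h5, h6⟩ - - - -
      have := hpath _ _ h1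
      have := hpath _ _ h2
      have := hpath _ _ h3
      have := hpath _ _ h4
      have := hinj _ _ h5
      have := hinj _ _ h6
      omega
    -- For `n ≥ 5` the hubs dominate every vertex. The plain vertices beyond them are adjacent to
    -- the last hub, which has index `n / 5 - 1`.
    · rintro x - - - - - - - -
      refine Or.inl ?_
      rcases x with i | ⟨p, v⟩
      · by_cases hi : i.val < n / (4 + 1)
        · exact ⟨.inl i, mem_image.2 ⟨⟨i, hi⟩, mem_univ _, rfl⟩, Or.inl rfl⟩
        · have ha : n / (4 + 1) - 1 < n / (4 + 1) := by omega
          refine ⟨_, mem_image_of_mem _ (mem_univ ⟨n / (4 + 1) - 1, ha⟩), Or.inr ?_⟩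
          rw [B_adj_inl_inl]
          refine ⟨fun e => ?_, Or.inl ?_⟩
          · have := congrArg Fin.val e
            simp only at this
            omega
          · simp only [BRel, if_neg hn]
            omega
      · exact ⟨_, mem_image_of_mem _ (mem_univ p), Or.inr (B_adj_inl_inr.2 rfl)⟩
  · exact card_image_le.trans (by simp)

theorem isolationNumber_B :
    isolationNumber (B n 4 (SimpleGraph.cycleGraph 4)) (SimpleGraph.cycleGraph 4) = n / 5 := by
  obtain ⟨D, hD, hcard⟩ := exists_isolates_B (n := n)
  obtain ⟨E, hE, hE'⟩ := exists_isolates (B n 4 (SimpleGraph.cycleGraph 4))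
  exact le_antisymm ((isolationNumber_le hD).trans hcard) (hE' ▸ le_card_of_isolates_B hE)

end Extremal

end Isolation

namespace Isolation

open Finset

/-! ### Invariance of the isolation number under isomorphism -/

section Iso

variable {V W : Type*} [Fintype V] [Fintype W] {G : SimpleGraph V} {H : SimpleGraph W}

theorem isolationNumber_le_of_iso (e : G ≃g H) :
    isolationNumber G (SimpleGraph.cycleGraph 4) ≤ isolationNumber H (SimpleGraph.cycleGraph 4) := by
  obtain ⟨D, hD, hcard⟩ := exists_isolates H
  rw [← hcard, ← card_map e.symm.toEquiv.toEmbedding]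
  refine isolationNumber_le fun a b c d hc _ _ _ _ => ?_
  have hdom : ∀ v, Dom H D (e v) → Dom G (D.map e.symm.toEquiv.toEmbedding) v := by
    rintro v ⟨w, hw, h⟩
    refine ⟨e.symm w, mem_map_of_mem _ hw, ?_⟩
    rcases h with h | h
    · exact Or.inl (by rw [← h, e.symm_apply_apply])
    · refine Or.inr (e.map_adj_iff.1 ?_)
      rwa [e.apply_symm_apply]
  obtain ⟨h1, h2, h3, h4, h5, h6⟩ := hc
  exact (hD (e a) (e b) (e c) (e d) ⟨e.map_adj_iff.2 h1, e.map_adj_iff.2 h2, e.map_adj_iff.2 h3,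
    e.map_adj_iff.2 h4, e.injective.ne h5, e.injective.ne h6⟩ (mem_univ _) (mem_univ _) (mem_univ _)
    (mem_univ _)).imp (hdom _) (Or.imp (hdom _) (Or.imp (hdom _) (hdom _)))

theorem isolationNumber_eq_of_iso (e : G ≃g H) :
    isolationNumber G (SimpleGraph.cycleGraph 4) = isolationNumber H (SimpleGraph.cycleGraph 4) :=
  le_antisymm (isolationNumber_le_of_iso e) (isolationNumber_le_of_iso e.symm)

end Iso

/-! ### The exceptional graphs violate the bound and are pairwise non-isomorphic -/

section Exceptional

/-- The exceptional graphs as a list. -/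
def exceptionalList : List FinGraph :=
  [⟨4, SimpleGraph.cycleGraph 4⟩, ⟨4, diamond⟩, ⟨4, SimpleGraph.completeGraph (Fin 4)⟩,
   ⟨9, graph1⟩, ⟨9, graph2⟩, ⟨9, graph3⟩, ⟨9, graph4⟩, ⟨9, graph5⟩, ⟨9, graph6⟩]

theorem mem_exceptional {H : FinGraph} : H ∈ exceptional ↔ H ∈ exceptionalList := by
  simp [exceptional, exceptionalList]

theorem exceptional_finite : exceptional.Finite := by
  simp [exceptional]

/-- The number of vertices plus six times the number of triangles. -/
noncomputable def triangleCode (H : FinGraph) : ℕ :=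
  H.1 + Nat.card {t : Fin H.1 × Fin H.1 × Fin H.1 //
    H.2.Adj t.1 t.2.1 ∧ H.2.Adj t.2.1 t.2.2 ∧ H.2.Adj t.2.2 t.1}

theorem triangleCode_eq_of_iso {H K : FinGraph} (e : H.2 ≃g K.2) :
    triangleCode H = triangleCode K := by
  have h1 : H.1 = K.1 := by
    simpa using Fintype.card_congr e.toEquiv
  refine congrArg₂ (· + ·) h1 ?_
  refine Nat.card_congr ((e.toEquiv.prodCongr (e.toEquiv.prodCongr e.toEquiv)).subtypeEquiv ?_)
  rintro ⟨a, b, c⟩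
  exact (e.map_adj_iff.and (e.map_adj_iff.and e.map_adj_iff)).symm

theorem triangleCode_of_mask {H : SimpleGraph (Fin 9)} {M t : ℕ}
    (hM : ∀ i j : Fin 9, H.Adj i j ↔ M.testBit (9 * i + j) = true)
    (ht : Fintype.card {t : Fin 9 × Fin 9 × Fin 9 // M.testBit (9 * t.1 + t.2.1) = true ∧
      M.testBit (9 * t.2.1 + t.2.2) = true ∧ M.testBit (9 * t.2.2 + t.1) = true} = t) :
    triangleCode ⟨9, H⟩ = 9 + t := by
  rw [triangleCode, ← ht, ← Nat.card_eq_fintype_card]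
  simp only [hM]

theorem triangleCode_diamond : triangleCode ⟨4, diamond⟩ = 16 := by
  rw [triangleCode]
  simp only [diamond, adj_ofEdges_iff, Nat.card_eq_fintype_card]
  decide +kernel

theorem triangleCode_completeGraph :
    triangleCode ⟨4, SimpleGraph.completeGraph (Fin 4)⟩ = 28 := by
  rw [triangleCode]
  simp only [SimpleGraph.completeGraph, SimpleGraph.top_adj, Nat.card_eq_fintype_card]
  decide +kernel

theorem triangleCode_cycleGraph : triangleCode ⟨4, SimpleGraph.cycleGraph 4⟩ = 4 := by
  rw [triangleCode]
  simp only [SimpleGraph.cycleGraph_adj, Nat.card_eq_fintype_card]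
  decide +kernel

/-- The nine values are distinct, so this one invariant separates all the exceptional graphs. -/
theorem map_triangleCode :
    exceptionalList.map triangleCode = [4, 16, 28, 63, 45, 57, 69, 51, 33] := by
  obtain _ | ⟨h1, _ | ⟨h2, _ | ⟨h3, _ | ⟨h4, _ | ⟨h5, _ | ⟨h6, -⟩⟩⟩⟩⟩⟩ := forall₂_nineMasks
  rw [exceptionalList]
  simp only [List.map_cons, List.map_nil]
  rw [triangleCode_cycleGraph, triangleCode_diamond, triangleCode_completeGraph,
    triangleCode_of_mask (t := 54) h1 (by decide +kernel),
    triangleCode_of_mask (t := 36) h2 (by decide +kernel),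
    triangleCode_of_mask (t := 48) h3 (by decide +kernel),
    triangleCode_of_mask (t := 60) h4 (by decide +kernel),
    triangleCode_of_mask (t := 42) h5 (by decide +kernel),
    triangleCode_of_mask (t := 24) h6 (by decide +kernel)]

theorem nodup_map_triangleCode : (exceptionalList.map triangleCode).Nodup := by
  rw [map_triangleCode]
  decide

theorem ncard_exceptional : exceptional.ncard = 9 := by
  classical
  have : exceptional = exceptionalList.toFinset := by
    ext H
    rw [mem_exceptional, mem_coe, List.mem_toFinset]
  rw [this, Set.ncard_coe_finset,
    List.toFinset_card_of_nodup (List.Nodup.of_map _ nodup_map_triangleCode)]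
  rfl

theorem exceptional_pairwise_not_iso :
    exceptional.Pairwise (fun H K => ¬ Nonempty (H.2 ≃g K.2)) := by
  rintro H hH K hK hne ⟨e⟩
  exact hne (List.inj_on_of_nodup_map nodup_map_triangleCode (mem_exceptional.1 hH)
    (mem_exceptional.1 hK) (triangleCode_eq_of_iso e))

theorem exceptional_cases {H : FinGraph} (hH : H ∈ exceptional) :
    (∃ K : SimpleGraph (Fin 4), H = ⟨4, K⟩ ∧ IsC4 K 0 1 2 3) ∨
      ∃ K ∈ nineGraphs, H = ⟨9, K⟩ := by
  simp only [exceptional, Set.mem_insert_iff, Set.mem_singleton_iff] at hH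
  rcases hH with rfl | rfl | rfl | rfl | rfl | rfl | rfl | rfl | rfl
  · exact Or.inl ⟨_, rfl, by decide, by decide, by decide, by decide, by decide, by decide⟩
  · refine Or.inl ⟨_, rfl, ?_, ?_, ?_, ?_, by decide, by decide⟩ <;> simp [diamond, ofEdges]
  · exact Or.inl ⟨_, rfl, by simp, by simp, by simp, by simp, by decide, by decide⟩
  all_goals exact Or.inr ⟨_, by simp [nineGraphs], rfl⟩

theorem connected_of_isC4 {H : SimpleGraph (Fin 4)} (h : IsC4 H 0 1 2 3) : H.Connected := by
  obtain ⟨h1, h2, -, h4, -, -⟩ := h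
  refine (SimpleGraph.connected_iff_exists_forall_reachable _).2 ⟨0, fun i => ?_⟩
  fin_cases i
  exacts [SimpleGraph.Reachable.refl 0, h1.reachable, h1.reachable.trans h2.reachable,
    h4.symm.reachable]

theorem connected_nineGraph {H : SimpleGraph (Fin 9)} (hH : H ∈ nineGraphs) : H.Connected := by
  obtain ⟨M, hM, hadj⟩ := exists_nineMask hH
  refine (SimpleGraph.connected_iff_exists_forall_reachable _).2 ⟨0, fun i => ?_⟩
  rcases nineMasks_diam M hM 0 (by norm_num) i i.2 with h | h | ⟨k, hk, h, h'⟩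
  · rw [show i = 0 from Fin.ext h.symm]
  · exact ((hadj 0 i).2 h).reachable
  · exact ((hadj 0 ⟨k, hk⟩).2 h).reachable.trans ((hadj ⟨k, hk⟩ i).2 h').reachable

theorem nineMasks_not_isolate : ∀ M ∈ nineMasks, ∀ d < 9,
    ∃ a < 9, (away M d).testBit a = true ∧
    ∃ b < 9, (away M d).testBit b = true ∧ M.testBit (9 * a + b) = true ∧
    ∃ c < 9, (away M d).testBit c = true ∧ a ≠ c ∧ M.testBit (9 * b + c) = true ∧
    ∃ e < 9, (away M d).testBit e = true ∧ b ≠ e ∧ M.testBit (9 * c + e) = true ∧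
      M.testBit (9 * e + a) = true := by
  decide +kernel

theorem two_le_isolationNumber {H : SimpleGraph (Fin 9)} (hH : H ∈ nineGraphs) :
    2 ≤ isolationNumber H (SimpleGraph.cycleGraph 4) := by
  obtain ⟨D, hD, hcard⟩ := exists_isolates H
  rw [← hcard]
  by_contra hlt
  obtain ⟨d, hd⟩ := card_le_one_iff_subset_singleton.1 (Nat.le_of_lt_succ (not_le.1 hlt))
  obtain ⟨M, hM, hadj⟩ := exists_nineMask hH
  obtain ⟨a, ha, ha', b, hb, hb', hab, c, hc, hc', hac, hbc, e, he, he', hbe, hce, hea⟩ :=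
    nineMasks_not_isolate M hM d d.2
  have hnd : ∀ (i : ℕ) (hi : i < 9), (away M d).testBit i = true → ¬ Dom H D ⟨i, hi⟩ := by
    rintro i hi h ⟨u, hu, hui⟩
    obtain rfl := mem_singleton.1 (hd hu)
    rw [testBit_away u.2] at h
    rcases hui with hui | hui
    · exact h.2.1 (congrArg Fin.val hui)
    · rw [hadj] at hui
      simp [h.2.2] at hui
  rcases hD ⟨a, ha⟩ ⟨b, hb⟩ ⟨c, hc⟩ ⟨e, he⟩ ⟨(hadj _ _).2 hab, (hadj _ _).2 hbc, (hadj _ _).2 hce,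
    (hadj _ _).2 hea, fun h => hac (congrArg Fin.val h), fun h => hbe (congrArg Fin.val h)⟩
    (mem_univ _) (mem_univ _) (mem_univ _) (mem_univ _) with h | h | h | h
  exacts [hnd a ha ha' h, hnd b hb hb' h, hnd c hc hc' h, hnd e he he' h]

theorem IsC4.one_le_isolationNumber {V : Type*} [Fintype V] {G : SimpleGraph V} {a b c d : V}
    (h : IsC4 G a b c d) : 1 ≤ isolationNumber G (SimpleGraph.cycleGraph 4) := by
  obtain ⟨D, hD, hcard⟩ := exists_isolates G
  rw [← hcard, Nat.one_le_iff_ne_zero, Ne, card_eq_zero]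
  rintro rfl
  have hno : ∀ w, ¬ Dom G ∅ w := by
    rintro w ⟨u, hu, -⟩
    simp at hu
  rcases hD a b c d h (mem_univ _) (mem_univ _) (mem_univ _) (mem_univ _) with h | h | h | h <;>
    exact hno _ h

theorem exceptional_spec {V : Type*} [Fintype V] {G : SimpleGraph V}
    (hG : IsGraphOf exceptional G) :
    G.Connected ∧ Fintype.card V / 5 < isolationNumber G (SimpleGraph.cycleGraph 4) := by
  obtain ⟨H, hH, ⟨e⟩⟩ := hG
  rw [e.connected_iff, isolationNumber_eq_of_iso e, Fintype.card_congr e.toEquiv, Fintype.card_fin]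
  rcases exceptional_cases hH with ⟨K, rfl, hK⟩ | ⟨K, hK, rfl⟩
  · exact ⟨connected_of_isC4 hK, lt_of_lt_of_le (by simp) hK.one_le_isolationNumber⟩
  · exact ⟨connected_nineGraph hK, lt_of_lt_of_le (by simp) (two_le_isolationNumber hK)⟩

end Exceptional

/-! ### The optimal constant -/

section Constant

theorem isAdmissible_fifth : IsAdmissible.{u} 4 (1 / 5) := by
  refine ⟨exceptional, exceptional_finite, fun V _ G hG hexc => ?_⟩
  have h : (isolationNumber G (SimpleGraph.cycleGraph 4) : ℝ) ≤ ((Fintype.card V / 5 : ℕ) : ℝ) :=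
    Nat.cast_le.2 (isolationNumber_le_card_div_five V G hG hexc)
  have h' : ((Fintype.card V / 5 : ℕ) : ℝ) ≤ (Fintype.card V : ℝ) / ((5 : ℕ) : ℝ) := Nat.cast_div_le
  push_cast at h'
  linarith

/-- A finite exceptional set has bounded orders, so `B_{n,C₄}` with `n` a larger multiple of 5 is
not covered by it and has isolation number exactly `n / 5`. The lift only adjusts the universe. -/
theorem IsAdmissible.fifth_le {c : ℝ} (hc : IsAdmissible.{u} 4 c) : 1 / 5 ≤ c := by
  obtain ⟨ℰ, hfin, hℰ⟩ := hc
  obtain ⟨m, hm⟩ := (hfin.image Sigma.fst).bddAbove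
  set n := 5 * (m + 1) with hn
  have e : (B n 4 (SimpleGraph.cycleGraph 4)).comap (Equiv.ulift.{u} : ULift.{u} (BVert n 4) ≃ _) ≃g
      B n 4 (SimpleGraph.cycleGraph 4) := SimpleGraph.Iso.comap Equiv.ulift _
  have hcard : Fintype.card (ULift.{u} (BVert n 4)) = n := by
    rw [Fintype.card_ulift, card_BVert]
  have h := hℰ _ _ (e.connected_iff.2 (B_connected (by omega))) (by
    rintro ⟨H, hH, ⟨e'⟩⟩
    have h1 := hm (Set.mem_image_of_mem _ hH)
    have h2 := Fintype.card_congr e'.toEquiv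
    rw [hcard, Fintype.card_fin] at h2
    omega)
  rw [isolationNumber_eq_of_iso e, isolationNumber_B, hcard, hn, Nat.mul_div_cancel_left _ (by norm_num)]
    at h
  push_cast at h
  have hpos : (0 : ℝ) < m + 1 := by positivity
  nlinarith

end Constant

end Isolation

theorem mainTheorem1 :
    -- the bound for every connected finite graph that is not exceptional
    (∀ (V : Type u) [Fintype V] (G : SimpleGraph V), G.Connected →
      ¬ Isolation.IsGraphOf Isolation.exceptional G →
      Isolation.isolationNumber G (SimpleGraph.cycleGraph 4) ≤ Fintype.card V / 5) ∧
    -- equality for the connected `n`-vertex graph `B_{n,C₄}`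
    (∀ n : ℕ, 1 ≤ n →
      Fintype.card (Isolation.BVert n 4) = n ∧
      (Isolation.B n 4 (SimpleGraph.cycleGraph 4)).Connected ∧
      Isolation.isolationNumber (Isolation.B n 4 (SimpleGraph.cycleGraph 4))
        (SimpleGraph.cycleGraph 4) = n / 5) ∧
    -- `c₄ = 1/5`
    IsLeast {c : ℝ | Isolation.IsAdmissible.{u} 4 c} (1 / 5) ∧
    -- the exceptional graphs are connected and all of them violate the bound, and
    -- they are nine pairwise non-isomorphic graphs
    (∀ (V : Type u) [Fintype V] (G : SimpleGraph V),
      Isolation.IsGraphOf Isolation.exceptional G →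
        G.Connected ∧
        Fintype.card V / 5 < Isolation.isolationNumber G (SimpleGraph.cycleGraph 4)) ∧
    Isolation.exceptional.ncard = 9 ∧
    Isolation.exceptional.Pairwise (fun H K => ¬ Nonempty (H.2 ≃g K.2)) := by
  refine ⟨Isolation.isolationNumber_le_card_div_five,
    fun n hn => ⟨Isolation.card_BVert, Isolation.B_connected hn, Isolation.isolationNumber_B⟩,
    ⟨Isolation.isAdmissible_fifth, fun c hc => Isolation.IsAdmissible.fifth_le hc⟩,
    fun V _ G hG => Isolation.exceptional_spec hG, Isolation.ncard_exceptional,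
    Isolation.exceptional_pairwise_not_iso⟩
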